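/- **Setting.** Let $\omega=e^{i\pi/4}$. A single-qubit Clifford+$T$ circuit is a finite word in the gates $H$, $S=\mathrm{diag}(1,i)$, $T=\mathrm{diag}(1,\omega)$ and the scalar $\omega$ (no ancillas); it implements the product of its gates, and its $T$-count is the number of gates $T$ in it. Let $R_z(\theta)=\mathrm{diag}(e^{-i\theta/2},e^{i\theta/2})$. A circuit implementing $V$ approximates $R_z(\theta)$ up to $\varepsilon$ if $\|R_z(\theta)-V\|\le\varepsilon$ in the operator norm. Let $\mathbb D=\mathbb Z[\frac12]$ and $\mathbb D[\omega]=\mathbb Z[\frac1{\sqrt2},i]$. On $\mathbb D[\omega]$, $\dagger$ denotes complex conjugation and $\bullet$ denotes the automorphism with $\omega\mapsto-\omega$ (so $\sqrt2\mapsto-\sqrt2$, $i\mapsto i$). The least denominator exponent of $u\in\mathbb D[\omega]$ is the least $k\ge0$ with $\sqrt2^{\,k}u\in\mathbb Z[\omega]$. An oracle for integer factoring returns, for every integer $n\ne0$, the list of the prime factors of $|n|$ with multiplicity. **Algorithm.** Input: $\theta\in\mathbb R$ and $\varepsilon>0$. Let $\overline{\mathcal D}$ be the closed unit disk, let $z=e^{-i\theta/2}$,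 and let $\mathcal R_\varepsilon=\{u\in\overline{\mathcal D} : \mathrm{Re}(\bar z u)\ge 1-\varepsilon^2/2\}$. 1. Enumerate all $u\in\mathbb D[\omega]$ with $u\in\mathcal R_\varepsilon$ and $u^\bullet\in\overline{\mathcal D}$, in order of increasing least denominator exponent (in any order among those with equal exponent; repetitions are allowed). 2. For each such $u$ in turn: (a) let $\xi=1-u^\dagger u$, and write $\xi^\bullet\xi=n/2^\ell$ with $n\in\mathbb Z$ and $\ell\ge0$ minimal; (b) attempt to factor $n$; if $n\neq0$ and no factorization is found, continue with the next $u$; (c) use the procedure (P) below, with the factorization of $n$, to look for $t\in\mathbb D[\omega]$ with $t^\dagger t=\xi$; if it returns a $t$, go to step 3, otherwise continue with the next $u$. 3. Let $U=\begin{pmatrix}u&-t^\dagger\\ t&u^\dagger\end{pmatrix}$ and $U'=TUT^\dagger$. By exact synthesis, find a circuit of minimal $T$-count among those implementing $U$, and one of minimal $T$-count among those implementing $U'$. Output the one with the smaller $T$-count, and stop. **Procedure (P).** If $\xi<0$ or $\xi^\bullet<0$, return "no solution". Otherwise, if $n=0$, return $t=0$. Otherwise let $\xi'=\sqrt2^{\,\ell}\xi\in\mathbb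 Z[\sqrt2]$. For each prime $p\mid n$ find the primes $\eta$ of $\mathbb Z[\sqrt2]$ above $p$: $\eta=\sqrt2$ if $p=2$; $\eta=p$ if $p\equiv3,5\pmod 8$; and $\eta=\gcd(p,x+\sqrt2)$ together with $\eta^\bullet$, for some integer $x$ with $x^2\equiv2\pmod p$, if $p\equiv1,7\pmod 8$. Let $m_\eta$ be the multiplicity of $\eta$ in $\xi'$. If $m_\eta$ is odd for some $\eta$ above a prime $p\equiv7\pmod 8$, return "no solution". Otherwise let $s\in\mathbb Z[\omega]$ be the product, over all these $\eta$, of: $\eta^{m_\eta/2}$ if $m_\eta$ is even; and, if $m_\eta$ is odd, $(1+\omega)^{m_\eta}$ when $p=2$, $\gcd(\eta,y+i)^{m_\eta}$ with $y^2\equiv-1\pmod p$ when $p\equiv1\pmod 4$, and $\gcd(\eta,y+i\sqrt2)^{m_\eta}$ with $y^2\equiv-2\pmod p$ when $p\equiv3\pmod 8$ (the gcds with $i$ and $i\sqrt2$ are taken in $\mathbb Z[\omega]$, and all choices of roots and gcds are arbitrary). Let $t'=(1+\omega)^{-\ell}s$, let $w$ be the unit of $\mathbb Z[\sqrt2]$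 with $\xi=w\,t'^\dagger t'$, and return $t=vt'$ where $v\in\mathbb Z[\sqrt2]$ and $v^2=w$. **Proposition (optimality in the presence of a factoring oracle).** Let $\theta\in\mathbb R$, let $\varepsilon>0$, and let the factorizations in step 2(b) be provided by an oracle for integer factoring. Then an enumeration as in step 1 exists, and for every such enumeration and all choices made in the algorithm, the algorithm never gets stuck, stops after finitely many steps, and returns a Clifford+$T$ circuit that approximates $R_z(\theta)$ up to $\varepsilon$ and has the smallest $T$-count of all single-qubit Clifford+$T$ circuits approximating $R_z(\theta)$ up to $\varepsilon$. -/

import Mathlib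

namespace CliffordT

noncomputable section

/-! ## Single-qubit Clifford+T circuits -/

/-- The gates: `H`, `S` and the scalar `ω = e^{iπ/4}` generate the Clifford group; `T` is the only
non-Clifford gate.  (Inverses are words in these gates: `S⁻¹ = S S S` and `T⁻¹ = S S S T`.) -/
inductive Gate where
  | H : Gate
  | S : Gate
  | T : Gate
  | omega : Gate
  deriving DecidableEq

/-- The complex number `ω = e^{iπ/4}`. -/
def omegaC : ℂ := Complex.exp (Complex.I * (Real.pi / 4))

/-- The unitary matrix of a gate. -/
def Gate.matrix : Gate → Matrix (Fin 2) (Fin 2) ℂ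
  | .H => ((1 / Real.sqrt 2 : ℝ) : ℂ) • !![1, 1; 1, -1]
  | .S => !![1, 0; 0, Complex.I]
  | .T => !![1, 0; 0, omegaC]
  | .omega => !![omegaC, 0; 0, omegaC]

/-- An ancilla-free single-qubit Clifford+T circuit is a finite word in the gates. -/
abbrev Circuit := List Gate

/-- The operator implemented by a circuit. -/
def Circuit.eval (C : Circuit) : Matrix (Fin 2) (Fin 2) ℂ := (C.map Gate.matrix).prod

/-- The `T`-count of a circuit: the number of `T`-gates appearing in it. -/
def Circuit.tCount (C : Circuit) : ℕ := C.count Gate.T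

/-- The `z`-rotation `R_z(θ) = diag(e^{-iθ/2}, e^{iθ/2})`. -/
def Rz (θ : ℝ) : Matrix (Fin 2) (Fin 2) ℂ :=
  !![Complex.exp (-(Complex.I * (θ / 2))), 0; 0, Complex.exp (Complex.I * (θ / 2))]

/-- The operator norm of a `2 × 2` complex matrix acting on the Hilbert space `ℂ²`. -/
def opNorm (M : Matrix (Fin 2) (Fin 2) ℂ) : ℝ := ‖Matrix.toEuclideanCLM (𝕜 := ℂ) M‖

/-- The circuit `C` approximates `R_z(θ)` up to `ε`, in the operator norm. -/
def Approximates (θ ε : ℝ) (C : Circuit) : Prop := opNorm (Rz θ - C.eval) ≤ ε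

/-! ## The rings `ℤ[ω]` and `𝔻[ω]` -/

/-- The element `a ω³ + b ω² + c ω + d`, where `ω⁴ = -1`, with coefficients in `R`. -/
@[ext]
structure Cyc (R : Type) where
  a : R
  b : R
  c : R
  d : R

namespace Cyc

variable {R : Type} [CommRing R]

instance : Zero (Cyc R) := ⟨⟨0, 0, 0, 0⟩⟩
instance : One (Cyc R) := ⟨⟨0, 0, 0, 1⟩⟩
instance : Add (Cyc R) := ⟨fun x y => ⟨x.a + y.a, x.b + y.b, x.c + y.c, x.d + y.d⟩⟩
instance : Neg (Cyc R) := ⟨fun x => ⟨-x.a, -x.b, -x.c, -x.d⟩⟩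
instance : Sub (Cyc R) := ⟨fun x y => ⟨x.a - y.a, x.b - y.b, x.c - y.c, x.d - y.d⟩⟩
instance : Mul (Cyc R) := ⟨fun x y =>
  ⟨x.a * y.d + x.b * y.c + x.c * y.b + x.d * y.a,
   x.b * y.d + x.c * y.c + x.d * y.b - x.a * y.a,
   x.c * y.d + x.d * y.c - x.a * y.b - x.b * y.a,
   x.d * y.d - x.a * y.c - x.b * y.b - x.c * y.a⟩⟩
instance : NatCast (Cyc R) := ⟨fun n => ⟨0, 0, 0, n⟩⟩
instance : IntCast (Cyc R) := ⟨fun n => ⟨0, 0, 0, n⟩⟩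

@[simp] theorem zero_a : (0 : Cyc R).a = 0 := rfl
@[simp] theorem zero_b : (0 : Cyc R).b = 0 := rfl
@[simp] theorem zero_c : (0 : Cyc R).c = 0 := rfl
@[simp] theorem zero_d : (0 : Cyc R).d = 0 := rfl
@[simp] theorem one_a : (1 : Cyc R).a = 0 := rfl
@[simp] theorem one_b : (1 : Cyc R).b = 0 := rfl
@[simp] theorem one_c : (1 : Cyc R).c = 0 := rfl
@[simp] theorem one_d : (1 : Cyc R).d = 1 := rfl
@[simp] theorem add_a (x y : Cyc R) : (x + y).a = x.a + y.a := rfl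
@[simp] theorem add_b (x y : Cyc R) : (x + y).b = x.b + y.b := rfl
@[simp] theorem add_c (x y : Cyc R) : (x + y).c = x.c + y.c := rfl
@[simp] theorem add_d (x y : Cyc R) : (x + y).d = x.d + y.d := rfl
@[simp] theorem neg_a (x : Cyc R) : (-x).a = -x.a := rfl
@[simp] theorem neg_b (x : Cyc R) : (-x).b = -x.b := rfl
@[simp] theorem neg_c (x : Cyc R) : (-x).c = -x.c := rfl
@[simp] theorem neg_d (x : Cyc R) : (-x).d = -x.d := rfl
@[simp] theorem sub_a (x y : Cyc R) : (x - y).a = x.a - y.a := rfl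
@[simp] theorem sub_b (x y : Cyc R) : (x - y).b = x.b - y.b := rfl
@[simp] theorem sub_c (x y : Cyc R) : (x - y).c = x.c - y.c := rfl
@[simp] theorem sub_d (x y : Cyc R) : (x - y).d = x.d - y.d := rfl
@[simp] theorem mul_a (x y : Cyc R) :
    (x * y).a = x.a * y.d + x.b * y.c + x.c * y.b + x.d * y.a := rfl
@[simp] theorem mul_b (x y : Cyc R) :
    (x * y).b = x.b * y.d + x.c * y.c + x.d * y.b - x.a * y.a := rfl
@[simp] theorem mul_c (x y : Cyc R) :
    (x * y).c = x.c * y.d + x.d * y.c - x.a * y.b - x.b * y.a := rfl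
@[simp] theorem mul_d (x y : Cyc R) :
    (x * y).d = x.d * y.d - x.a * y.c - x.b * y.b - x.c * y.a := rfl

instance : CommRing (Cyc R) where
  add_assoc x y z := by ext <;> simp <;> ring
  zero_add x := by ext <;> simp
  add_zero x := by ext <;> simp
  add_comm x y := by ext <;> simp <;> ring
  neg_add_cancel x := by ext <;> simp
  sub_eq_add_neg x y := by ext <;> simp <;> ring
  mul_assoc x y z := by ext <;> simp <;> ring
  one_mul x := by ext <;> simp
  mul_one x := by ext <;> simp
  zero_mul x := by ext <;> simp
  mul_zero x := by ext <;> simp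
  left_distrib x y z := by ext <;> simp <;> ring
  right_distrib x y z := by ext <;> simp <;> ring
  mul_comm x y := by ext <;> simp <;> ring
  nsmul := nsmulRec
  zsmul := zsmulRec
  natCast_zero := by
    change (⟨0, 0, 0, ((0 : ℕ) : R)⟩ : Cyc R) = 0
    ext <;> simp
  natCast_succ n := by
    change (⟨0, 0, 0, ((n + 1 : ℕ) : R)⟩ : Cyc R) = ⟨0, 0, 0, (n : R)⟩ + 1
    ext <;> simp
  intCast_ofNat n := by
    change (⟨0, 0, 0, ((n : ℤ) : R)⟩ : Cyc R) = ⟨0, 0, 0, (n : R)⟩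
    ext <;> simp
  intCast_negSucc n := by
    change (⟨0, 0, 0, ((Int.negSucc n : ℤ) : R)⟩ : Cyc R) = -⟨0, 0, 0, ((n + 1 : ℕ) : R)⟩
    ext <;> simp

/-- Complex conjugation `(-)†`. -/
def dag (x : Cyc R) : Cyc R := ⟨-x.c, -x.b, -x.a, x.d⟩

/-- `√2`-conjugation `(-)•`. -/
def bullet (x : Cyc R) : Cyc R := ⟨-x.a, x.b, -x.c, x.d⟩

/-- The element `ω`. -/
def omega : Cyc R := ⟨0, 0, 1, 0⟩

/-- The element `i = ω²`. -/
def imag : Cyc R := ⟨0, 1, 0, 0⟩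

/-- The element `√2 = ω - ω³`. -/
def sqrtTwo : Cyc R := ⟨-1, 0, 1, 0⟩

/-- The element `δ = 1 + ω`. -/
def delta : Cyc R := ⟨0, 0, 1, 1⟩

end Cyc

/-- The ring `𝔻 = ℤ[1/2]` of dyadic fractions. -/
def dyadic : Subring ℚ where
  carrier := {q | ∃ (m : ℤ) (k : ℕ), q = m / 2 ^ k}
  zero_mem' := ⟨0, 0, by simp⟩
  one_mem' := ⟨1, 0, by simp⟩
  add_mem' := by
    rintro _ _ ⟨m, k, rfl⟩ ⟨n, l, rfl⟩
    refine ⟨m * 2 ^ l + n * 2 ^ k, k + l, ?_⟩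
    push_cast
    rw [pow_add]
    field_simp
  mul_mem' := by
    rintro _ _ ⟨m, k, rfl⟩ ⟨n, l, rfl⟩
    refine ⟨m * n, k + l, ?_⟩
    push_cast
    rw [pow_add]
    field_simp
  neg_mem' := by
    rintro _ ⟨m, k, rfl⟩
    exact ⟨-m, k, by push_cast; ring⟩

/-- The ring `ℤ[ω]`. -/
abbrev ZOmega := Cyc ℤ

/-- The ring `𝔻[ω]`. -/
abbrev DOmega := Cyc dyadic

/-- The inclusion `ℤ[ω] ⊆ 𝔻[ω]`. -/
def Cyc.toD (x : ZOmega) : DOmega := ⟨x.a, x.b, x.c, x.d⟩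

/-- The inclusion `ℤ[√2] ⊆ ℤ[ω]`, using `√2 = ω - ω³`. -/
def zsqrtToZOmega (x : ℤ√2) : ZOmega := ⟨-x.im, 0, x.im, x.re⟩

/-- The inclusion `ℤ[√2] ⊆ 𝔻[ω]`. -/
def zsqrtToD (x : ℤ√2) : DOmega := (zsqrtToZOmega x).toD

/-- The inclusion `𝔻[ω] ⊆ ℂ`. -/
def Cyc.toComplex (x : DOmega) : ℂ :=
  ((x.a : ℚ) : ℂ) * omegaC ^ 3 + ((x.b : ℚ) : ℂ) * omegaC ^ 2 + ((x.c : ℚ) : ℂ) * omegaC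
    + ((x.d : ℚ) : ℂ)

/-- `k` is a denominator exponent of `u`: `√2ᵏ u ∈ ℤ[ω]`. -/
def IsDenominatorExponent (k : ℕ) (u : DOmega) : Prop :=
  ∃ v : ZOmega, Cyc.sqrtTwo ^ k * u = v.toD

/-- The least denominator exponent of `u` (every element of `𝔻[ω]` has a denominator exponent). -/
def leastDenominatorExponent (u : DOmega) : ℕ := sInf {k | IsDenominatorExponent k u}

/-! ## The scaled grid problem -/

/-- The solutions `u ∈ 𝔻[ω]` of the scaled grid problem `u ∈ A`, `u• ∈ B` (arbitrary `k`). -/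
def scaledGridSolutions (A B : Set ℂ) : Set DOmega :=
  {u | u.toComplex ∈ A ∧ u.bullet.toComplex ∈ B}

/-- The closed unit disk. -/
def unitDisk : Set ℂ := Metric.closedBall 0 1

/-- The `ε`-region for `θ`: the points `u` of the unit disk whose inner product with
`z = e^{-iθ/2}`, as vectors of the real plane, is at least `1 - ε²/2`. -/
def epsRegion (θ ε : ℝ) : Set ℂ :=
  {u | u ∈ unitDisk ∧
    1 - ε ^ 2 / 2 ≤ u.re * (Complex.exp (-(Complex.I * (θ / 2)))).re
      + u.im * (Complex.exp (-(Complex.I * (θ / 2)))).im}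

/-- The sequence `e` enumerates exactly the solutions of the scaled grid problem for `A` and `B`
(arbitrary `k`), in the order of increasing least denominator exponent.  The order among solutions
with the same exponent is free, and repetitions are allowed. -/
structure EnumeratesGrid (A B : Set ℂ) (e : ℕ → DOmega) : Prop where
  range_eq : Set.range e = scaledGridSolutions A B
  increasing : Monotone fun i => leastDenominatorExponent (e i)

/-! ## Factoring -/

/-- A factoring procedure: on input `n` it outputs a list of primes, or gives up. -/
abbrev FactoringProcedure := ℤ → Option (List ℕ)

/-- An oracle for integer factoring: for every `n ≠ 0` it outputs the list of the prime factors of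
`|n|`, with multiplicity, in some order. -/
def IsFactoringOracle (factor : FactoringProcedure) : Prop :=
  ∀ n : ℤ, n ≠ 0 → ∃ F : List ℕ, factor n = some F ∧ (∀ p ∈ F, p.Prime) ∧ F.prod = n.natAbs

/-! ## The algorithm for the Diophantine equation `t† t = ξ`

The algorithm takes `ξ ∈ 𝔻[√2]`, where `ξ• ξ = n / 2^ℓ`, and the prime factors `F` of `n`.  It is
probabilistic; it is described as the relation between its input and its possible outputs. -/

/-- `g` is a greatest common divisor of `x` and `y`. -/
def IsGreatestCommonDivisor {R : Type} [CommRing R] (g x y : R) : Prop :=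
  g ∣ x ∧ g ∣ y ∧ ∀ f, f ∣ x → f ∣ y → f ∣ g

/-- `PrimesAbove p L`: the list `L` is a possible output of the procedure that finds the primes of
`ℤ[√2]` dividing the prime number `p`.  For `p ≡ ±1 (mod 8)`, it finds a root `x` of `x² ≡ 2`
modulo `p` and computes `η = gcd(p, x + √2)`; the primes are then `η` and `η•`. -/
inductive PrimesAbove : ℕ → List (ℤ√2) → Prop
  | two : PrimesAbove 2 [Zsqrtd.sqrtd]
  | inert (p : ℕ) (hp : p % 8 = 3 ∨ p % 8 = 5) : PrimesAbove p [(p : ℤ√2)]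
  | split (p : ℕ) (hp : p % 8 = 1 ∨ p % 8 = 7) (x : ℤ) (hx : (p : ℤ) ∣ x ^ 2 - 2)
      (η : ℤ√2) (hη : IsGreatestCommonDivisor η (p : ℤ√2) ((x : ℤ√2) + Zsqrtd.sqrtd)) :
      PrimesAbove p [η, star η]

/-- `η` occurs in `ξ'` with multiplicity exactly `m`. -/
def HasMultiplicity (η ξ' : ℤ√2) (m : ℕ) : Prop := η ^ m ∣ ξ' ∧ ¬ η ^ (m + 1) ∣ ξ'

/-- `PowerSolution p η m s`: `s` is a possible output of the procedure that finds `s ∈ ℤ[ω]` such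
that `s† s` is associated to `η ^ m`, where `η` is a prime of `ℤ[√2]` above `p`.  There is no output
when `m` is odd and `p ≡ 7 (mod 8)`. -/
inductive PowerSolution : ℕ → ℤ√2 → ℕ → ZOmega → Prop
  | even (p : ℕ) (η : ℤ√2) (r : ℕ) : PowerSolution p η (2 * r) (zsqrtToZOmega η ^ r)
  | two (η : ℤ√2) (m : ℕ) (hm : Odd m) : PowerSolution 2 η m (Cyc.delta ^ m)
  | one_mod_four (p : ℕ) (η : ℤ√2) (m : ℕ) (hm : Odd m) (hp : p % 8 = 1 ∨ p % 8 = 5)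
      (x : ℤ) (hx : (p : ℤ) ∣ x ^ 2 + 1) (g : ZOmega)
      (hg : IsGreatestCommonDivisor g (zsqrtToZOmega η) ((x : ZOmega) + Cyc.imag)) :
      PowerSolution p η m (g ^ m)
  | three_mod_eight (p : ℕ) (η : ℤ√2) (m : ℕ) (hm : Odd m) (hp : p % 8 = 3)
      (x : ℤ) (hx : (p : ℤ) ∣ x ^ 2 + 2) (g : ZOmega)
      (hg : IsGreatestCommonDivisor g (zsqrtToZOmega η)
        ((x : ZOmega) + Cyc.imag * Cyc.sqrtTwo)) :
      PowerSolution p η m (g ^ m)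

/-- `ξ ≥ 0` and `ξ• ≥ 0`, for `ξ ∈ 𝔻[√2]`. -/
def DoublyPositive (ξ : DOmega) : Prop :=
  0 ≤ ξ.toComplex.re ∧ 0 ≤ ξ.bullet.toComplex.re

/-- `DiophantineReturns ξ n ℓ F r`: on input `ξ` with `ξ• ξ = n / 2^ℓ` and with the prime factors `F`
of `n` (which are not used if `n = 0`), the algorithm may return `r`: either `some t`, or `none` for
the answer that there is no solution.  Unless one of the first two cases applies, it sets
`ξ' = √2^ℓ ξ ∈ ℤ[√2]`, and computes the primes `η` of `ℤ[√2]` above the primes `p` in `F` and their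
multiplicities in `ξ'`.  It returns `none` if some `η` above some `p ≡ 7 (mod 8)` has odd
multiplicity.  Otherwise it solves the equation up to a unit for each prime power in `ξ'`, takes the
product of these solutions, divides by `δ^ℓ` to get `t'` such that `t'† t'` differs from `ξ` by a
unit `w` of `ℤ[√2]`, and returns `v t'`, where `v² = w`. -/
inductive DiophantineReturns (ξ : DOmega) (n : ℤ) (ℓ : ℕ) (F : List ℕ) : Option DOmega → Prop
  | not_doublyPositive (h : ¬ DoublyPositive ξ) : DiophantineReturns ξ n ℓ F none
  | zero (h : DoublyPositive ξ) (hn : n = 0) : DiophantineReturns ξ n ℓ F (some 0)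
  | obstruction (h : DoublyPositive ξ) (hn : n ≠ 0)
      (ξ' : ℤ√2) (hξ' : zsqrtToD ξ' = Cyc.sqrtTwo ^ ℓ * ξ)
      (P : ℕ → List (ℤ√2)) (hP : ∀ p ∈ F, PrimesAbove p (P p))
      (p : ℕ) (hp : p ∈ F) (hp7 : p % 8 = 7) (η : ℤ√2) (hη : η ∈ P p)
      (m : ℕ) (hm : HasMultiplicity η ξ' m) (hodd : Odd m) :
      DiophantineReturns ξ n ℓ F none
  | solution (h : DoublyPositive ξ) (hn : n ≠ 0)
      (ξ' : ℤ√2) (hξ' : zsqrtToD ξ' = Cyc.sqrtTwo ^ ℓ * ξ)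
      (P : ℕ → List (ℤ√2)) (hP : ∀ p ∈ F, PrimesAbove p (P p))
      (s : ℕ → ℤ√2 → ZOmega)
      (hs : ∀ p ∈ F, ∀ η ∈ P p, ∃ m, HasMultiplicity η ξ' m ∧ PowerSolution p η m (s p η))
      (t' : DOmega)
      (ht' : Cyc.delta ^ ℓ * t' = Cyc.toD (F.dedup.map fun p => ((P p).map (s p)).prod).prod)
      (w v : ℤ√2) (hw : IsUnit w) (hξ : ξ = zsqrtToD w * (t'.dag * t')) (hv : v ^ 2 = w) :
      DiophantineReturns ξ n ℓ F (some (zsqrtToD v * t'))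

/-! ## Exact synthesis -/

/-- Exact synthesis: `C` is a circuit implementing the operator `M` with minimal `T`-count. -/
def ExactSynthesis (M : Matrix (Fin 2) (Fin 2) ℂ) (C : Circuit) : Prop :=
  C.eval = M ∧ ∀ D : Circuit, D.eval = M → C.tCount ≤ D.tCount

/-! ## The approximate synthesis algorithm -/

/-- The matrix `U` with rows `(u, -t†)` and `(t, u†)`. -/
def matrixU (u t : DOmega) : Matrix (Fin 2) (Fin 2) ℂ :=
  !![u.toComplex, -t.dag.toComplex; t.toComplex, u.dag.toComplex]

/-- The matrix `U' = T U T†`. -/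
def matrixU' (u t : DOmega) : Matrix (Fin 2) (Fin 2) ℂ :=
  Gate.matrix .T * matrixU u t * (Gate.matrix .T).conjTranspose

/-- The number `ξ = 1 - u† u`. -/
def xi (u : DOmega) : DOmega := 1 - u.dag * u

/-- `ξ• ξ = n / 2^ℓ` where `n ∈ ℤ` and `ℓ ≥ 0` is minimal. -/
def NormIs (ξ : DOmega) (n : ℤ) (ℓ : ℕ) : Prop :=
  2 ^ ℓ * (ξ.bullet * ξ) = (n : DOmega) ∧
    ∀ (n' : ℤ) (ℓ' : ℕ), 2 ^ ℓ' * (ξ.bullet * ξ) = (n' : DOmega) → ℓ ≤ ℓ'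

/-- The states of the algorithm: about to treat the `i`-th candidate, about to synthesize a circuit
for the pair `u, t`, and stopped with an output. -/
inductive State where
  | candidate (i : ℕ) : State
  | synthesize (u t : DOmega) : State
  | output (C : Circuit) : State

/-- One step of the algorithm, where `e` is the enumeration of the candidates and `factor` is the
procedure used to attempt to find prime factorizations. -/
inductive Step (e : ℕ → DOmega) (factor : FactoringProcedure) : State → State → Prop
  /- No factorization of `n` is found: continue with the next candidate. -/
  | skip (i : ℕ) (n : ℤ) (ℓ : ℕ) (hn : NormIs (xi (e i)) n ℓ) (hn0 : n ≠ 0)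
      (hF : factor n = none) :
      Step e factor (.candidate i) (.candidate (i + 1))
  /- The equation `t† t = ξ` is found to have no solution: continue with the next candidate. -/
  | reject (i : ℕ) (n : ℤ) (ℓ : ℕ) (hn : NormIs (xi (e i)) n ℓ) (F : List ℕ)
      (hF : n ≠ 0 → factor n = some F) (h : DiophantineReturns (xi (e i)) n ℓ F none) :
      Step e factor (.candidate i) (.candidate (i + 1))
  /- A solution `t` of `t† t = ξ` is found. -/
  | accept (i : ℕ) (n : ℤ) (ℓ : ℕ) (hn : NormIs (xi (e i)) n ℓ) (F : List ℕ)
      (hF : n ≠ 0 → factor n = some F) (t : DOmega)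
      (h : DiophantineReturns (xi (e i)) n ℓ F (some t)) :
      Step e factor (.candidate i) (.synthesize (e i) t)
  /- The circuit for `U` or for `U'` is output, whichever has the smaller `T`-count. -/
  | outputU (u t : DOmega) (C C' : Circuit) (hC : ExactSynthesis (matrixU u t) C)
      (hC' : ExactSynthesis (matrixU' u t) C') (h : C.tCount ≤ C'.tCount) :
      Step e factor (.synthesize u t) (.output C)
  | outputU' (u t : DOmega) (C C' : Circuit) (hC : ExactSynthesis (matrixU u t) C)
      (hC' : ExactSynthesis (matrixU' u t) C') (h : C'.tCount ≤ C.tCount) :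
      Step e factor (.synthesize u t) (.output C')

/-- The state `s` can be reached by the algorithm, which starts with the first candidate. -/
def Reachable (e : ℕ → DOmega) (factor : FactoringProcedure) (s : State) : Prop :=
  Relation.ReflTransGen (Step e factor) (.candidate 0) s

/-- Every run of the algorithm stops with an output: there is no infinite run, and every reachable
state that is not an output has a next state. -/
def AlwaysReturns (e : ℕ → DOmega) (factor : FactoringProcedure) : Prop :=
  (¬ ∃ s : ℕ → State, s 0 = .candidate 0 ∧ ∀ i, Step e factor (s i) (s (i + 1))) ∧
    ∀ s, Reachable e factor s → (∃ C, s = .output C) ∨ ∃ s', Step e factor s s'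

/-- The circuit `C` is returned by some run of the algorithm. -/
def Returns (e : ℕ → DOmega) (factor : FactoringProcedure) (C : Circuit) : Prop :=
  Reachable e factor (.output C)

end

end CliffordT

/-! A determinant-one operator over 𝔻[ω] is fixed by its first column `(u, t)` with `u† u + t† t =
1`. The difference of two special unitary matrices has a scalar Gram matrix, so `R_z(θ)` is
approximated within `ε` exactly when `u` lies in the `ε`-region (`opNorm_sub_matrixU`). The
condition on `u•` is automatic, by applying `•` to the unitarity equation. Thus the determinant-one
approximations correspond to the solvable candidates, those `u` for which some `t` exists.

The Diophantine procedure decides solvability. ℤ[√2] and ℤ[ω] are Euclidean, quadratic residues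
describe the primes of ℤ[√2] that are relative norms up to a unit, and the remaining unit is totally
positive, hence a square. Primes above `p ≡ 7 (mod 8)` stay inert in ℤ[ω], so an odd multiplicity
there is a genuine obstruction (`DiophantineReturns.sound_none`, `sound_some`,
`exists_diophantineReturns`). With an oracle the algorithm therefore stops at the first solvable
candidate, whose least denominator exponent is minimal among the solvable ones.

The exponent controls the `T`-count. Clifford gates preserve the ℤ[ω]-lattice spanned by `(1,0)` and
`(1,1)/√2`, and `T` does so after multiplication by `δ = 1 + ω`. Hence `m` gates `T` give level at
most `m`. Conversely, reduction modulo `δ` allows one `T` to be stripped per level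
(`exists_circuit_of_level`). As `δ²` is `√2` times a unit, a determinant-one circuit with exponent
`k` has at least `2k - 2` gates `T`, while for `k ≥ 1` one of `U`, `T U T†` needs at most `2k - 2`;
for `k = 0` one of them needs none.

Determinants `ω^j ≠ 1` give nothing better: they force `1 - ε²/2 ≤ cos(π/8)`, and then some power of
`ω` is itself a candidate, with exponent 0. Termination needs at least one solvable candidate, which
is a density statement: powers of a nearly diagonal operator sweep out the circle
(`exists_unit_near`). -/

namespace CliffordT

noncomputable section

/-! ### The conjugations `†` and `•` and the special elements of `Cyc R`. -/

namespace Cyc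

section Conjugations

variable {R : Type} [CommRing R]

@[simp] theorem dag_a (x : Cyc R) : x.dag.a = -x.c := rfl
@[simp] theorem dag_b (x : Cyc R) : x.dag.b = -x.b := rfl
@[simp] theorem dag_c (x : Cyc R) : x.dag.c = -x.a := rfl
@[simp] theorem dag_d (x : Cyc R) : x.dag.d = x.d := rfl
@[simp] theorem bullet_a (x : Cyc R) : x.bullet.a = -x.a := rfl
@[simp] theorem bullet_b (x : Cyc R) : x.bullet.b = x.b := rfl
@[simp] theorem bullet_c (x : Cyc R) : x.bullet.c = -x.c := rfl
@[simp] theorem bullet_d (x : Cyc R) : x.bullet.d = x.d := rfl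
@[simp] theorem intCast_a (n : ℤ) : (n : Cyc R).a = 0 := rfl
@[simp] theorem intCast_b (n : ℤ) : (n : Cyc R).b = 0 := rfl
@[simp] theorem intCast_c (n : ℤ) : (n : Cyc R).c = 0 := rfl
@[simp] theorem intCast_d (n : ℤ) : (n : Cyc R).d = n := rfl
@[simp] theorem natCast_a (n : ℕ) : (n : Cyc R).a = 0 := rfl
@[simp] theorem natCast_b (n : ℕ) : (n : Cyc R).b = 0 := rfl
@[simp] theorem natCast_c (n : ℕ) : (n : Cyc R).c = 0 := rfl
@[simp] theorem natCast_d (n : ℕ) : (n : Cyc R).d = n := rfl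
@[simp] theorem omega_a : (omega : Cyc R).a = 0 := rfl
@[simp] theorem omega_b : (omega : Cyc R).b = 0 := rfl
@[simp] theorem omega_c : (omega : Cyc R).c = 1 := rfl
@[simp] theorem omega_d : (omega : Cyc R).d = 0 := rfl
@[simp] theorem imag_a : (imag : Cyc R).a = 0 := rfl
@[simp] theorem imag_b : (imag : Cyc R).b = 1 := rfl
@[simp] theorem imag_c : (imag : Cyc R).c = 0 := rfl
@[simp] theorem imag_d : (imag : Cyc R).d = 0 := rfl
@[simp] theorem sqrtTwo_a : (sqrtTwo : Cyc R).a = -1 := rfl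
@[simp] theorem sqrtTwo_b : (sqrtTwo : Cyc R).b = 0 := rfl
@[simp] theorem sqrtTwo_c : (sqrtTwo : Cyc R).c = 1 := rfl
@[simp] theorem sqrtTwo_d : (sqrtTwo : Cyc R).d = 0 := rfl
@[simp] theorem delta_a : (delta : Cyc R).a = 0 := rfl
@[simp] theorem delta_b : (delta : Cyc R).b = 0 := rfl
@[simp] theorem delta_c : (delta : Cyc R).c = 1 := rfl
@[simp] theorem delta_d : (delta : Cyc R).d = 1 := rfl

@[simp] theorem two_a : (2 : Cyc R).a = 0 := by rw [← one_add_one_eq_two]; simp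
@[simp] theorem two_b : (2 : Cyc R).b = 0 := by rw [← one_add_one_eq_two]; simp
@[simp] theorem two_c : (2 : Cyc R).c = 0 := by rw [← one_add_one_eq_two]; simp
@[simp] theorem two_d : (2 : Cyc R).d = 2 := by rw [← one_add_one_eq_two]; simp; norm_num

/-- Complex conjugation as a star ring structure. -/
instance : StarRing (Cyc R) where
  star := dag
  star_involutive x := by ext <;> simp
  star_mul x y := by ext <;> simp <;> ring
  star_add x y := by ext <;> simp <;> ring

theorem star_eq_dag (x : Cyc R) : star x = x.dag := rfl

theorem dag_mul (x y : Cyc R) : (x * y).dag = x.dag * y.dag := by ext <;> simp <;> ring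
theorem dag_add (x y : Cyc R) : (x + y).dag = x.dag + y.dag := star_add x y
theorem dag_sub (x y : Cyc R) : (x - y).dag = x.dag - y.dag := star_sub x y
theorem dag_neg (x : Cyc R) : (-x).dag = -x.dag := star_neg x
@[simp] theorem dag_dag (x : Cyc R) : x.dag.dag = x := star_star x
@[simp] theorem dag_one : (1 : Cyc R).dag = 1 := star_one _
@[simp] theorem dag_zero : (0 : Cyc R).dag = 0 := star_zero _
theorem dag_pow (x : Cyc R) (n : ℕ) : (x ^ n).dag = x.dag ^ n := star_pow x n

/-- The automorphism `•` as a ring homomorphism. -/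
def bulletHom : Cyc R →+* Cyc R where
  toFun := bullet
  map_one' := by ext <;> simp
  map_mul' x y := by ext <;> simp <;> ring
  map_zero' := by ext <;> simp
  map_add' x y := by ext <;> simp <;> ring

theorem bullet_mul (x y : Cyc R) : (x * y).bullet = x.bullet * y.bullet := map_mul bulletHom x y
theorem bullet_add (x y : Cyc R) : (x + y).bullet = x.bullet + y.bullet := map_add bulletHom x y
theorem bullet_pow (x : Cyc R) (n : ℕ) : (x ^ n).bullet = x.bullet ^ n := map_pow bulletHom x n
@[simp] theorem bullet_one : (1 : Cyc R).bullet = 1 := map_one bulletHom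
theorem bullet_dag (x : Cyc R) : x.dag.bullet = x.bullet.dag := by ext <;> simp

theorem omega_pow_two : (omega : Cyc R) ^ 2 = imag := by rw [pow_two]; ext <;> simp
theorem omega_pow_four : (omega : Cyc R) ^ 4 = -1 := by
  rw [show 4 = 2 * 2 from rfl, pow_mul, omega_pow_two, pow_two]; ext <;> simp
theorem omega_pow_eight : (omega : Cyc R) ^ 8 = 1 := by
  rw [show 8 = 4 * 2 from rfl, pow_mul, omega_pow_four]; ring
theorem dag_omega_mul_omega : (omega : Cyc R).dag * omega = 1 := by ext <;> simp
theorem sqrtTwo_mul_self : (sqrtTwo : Cyc R) * sqrtTwo = 2 := by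
  ext <;> simp
  norm_num
@[simp] theorem dag_sqrtTwo : (sqrtTwo : Cyc R).dag = sqrtTwo := by ext <;> simp
theorem delta_mul_dag : (delta : Cyc R).dag * delta = sqrtTwo * (1 + sqrtTwo) := by
  ext <;> simp

/-- The unit by which `δ²` and `√2` differ. -/
def deltaUnit : Cyc R := ⟨0, 1, 1, 1⟩

theorem delta_sq : (delta : Cyc R) ^ 2 = sqrtTwo * deltaUnit := by
  rw [pow_two]
  ext <;> simp [deltaUnit]

theorem isUnit_deltaUnit : IsUnit (deltaUnit : Cyc R) :=
  .of_mul_eq_one (⟨1, -1, 0, 1⟩ : Cyc R) (by ext <;> simp [deltaUnit])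

end Conjugations

/-! ### The inclusion of `ℤ[ω]` in `𝔻[ω]` -/

@[simp] theorem toD_a (x : ZOmega) : x.toD.a = (x.a : dyadic) := rfl
@[simp] theorem toD_b (x : ZOmega) : x.toD.b = (x.b : dyadic) := rfl
@[simp] theorem toD_c (x : ZOmega) : x.toD.c = (x.c : dyadic) := rfl
@[simp] theorem toD_d (x : ZOmega) : x.toD.d = (x.d : dyadic) := rfl

/-- The inclusion `ℤ[ω] ⊆ 𝔻[ω]` as a ring homomorphism. -/
def toDHom : ZOmega →+* DOmega where
  toFun := toD
  map_one' := by ext <;> simp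
  map_mul' x y := by ext <;> simp
  map_zero' := by ext <;> simp
  map_add' x y := by ext <;> simp

theorem toDHom_apply (x : ZOmega) : toDHom x = x.toD := rfl
theorem toD_mul (x y : ZOmega) : (x * y).toD = x.toD * y.toD := map_mul toDHom x y
theorem toD_add (x y : ZOmega) : (x + y).toD = x.toD + y.toD := map_add toDHom x y
theorem toD_sub (x y : ZOmega) : (x - y).toD = x.toD - y.toD := map_sub toDHom x y
theorem toD_neg (x : ZOmega) : (-x).toD = -x.toD := map_neg toDHom x
theorem toD_pow (x : ZOmega) (n : ℕ) : (x ^ n).toD = x.toD ^ n := map_pow toDHom x n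
@[simp] theorem toD_one : (1 : ZOmega).toD = 1 := map_one toDHom
@[simp] theorem toD_zero : (0 : ZOmega).toD = 0 := map_zero toDHom
theorem toD_dag (x : ZOmega) : x.dag.toD = x.toD.dag := by ext <;> simp
theorem toD_bullet (x : ZOmega) : x.bullet.toD = x.toD.bullet := by ext <;> simp
@[simp] theorem toD_sqrtTwo : (sqrtTwo : ZOmega).toD = sqrtTwo := by ext <;> simp
@[simp] theorem toD_delta : (delta : ZOmega).toD = delta := by ext <;> simp
@[simp] theorem toD_omega : (omega : ZOmega).toD = omega := by ext <;> simp
@[simp] theorem toD_imag : (imag : ZOmega).toD = imag := by ext <;> simp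

theorem toD_injective : Function.Injective toD := by
  intro x y h
  have ha := congrArg Cyc.a h
  have hb := congrArg Cyc.b h
  have hc := congrArg Cyc.c h
  have hd := congrArg Cyc.d h
  simp only [toD_a, toD_b, toD_c, toD_d] at ha hb hc hd
  ext
  · exact_mod_cast ha
  · exact_mod_cast hb
  · exact_mod_cast hc
  · exact_mod_cast hd

end Cyc

/-! ### Units and denominator exponents of 𝔻[ω]. -/

/-- The dyadic fraction `1/2`. -/
def half : dyadic := ⟨1 / 2, 1, 1, by norm_num⟩

theorem two_mul_half : (2 : dyadic) * half = 1 := by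
  ext
  change (2 : ℚ) * (1 / 2) = 1
  norm_num

namespace Cyc

/-- The element `1/√2` of `𝔻[ω]`. -/
def invSqrtTwo : DOmega := ⟨-half, 0, half, 0⟩

theorem sqrtTwo_mul_invSqrtTwo : (sqrtTwo : DOmega) * invSqrtTwo = 1 := by
  have h := two_mul_half
  ext <;> simp [invSqrtTwo]
  norm_cast
  rw [← h]; ring_nf

theorem isUnit_sqrtTwo : IsUnit (sqrtTwo : DOmega) := .of_mul_eq_one _ sqrtTwo_mul_invSqrtTwo

theorem isUnit_delta : IsUnit (delta : DOmega) := by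
  have h : IsUnit ((delta : DOmega) ^ 2) := by
    rw [delta_sq]; exact isUnit_sqrtTwo.mul isUnit_deltaUnit
  exact isUnit_pow_iff two_ne_zero |>.1 h

end Cyc

theorem dyadic_exists_mul_pow (x : dyadic) : ∃ (k : ℕ) (m : ℤ), (2 : dyadic) ^ k * x = m := by
  obtain ⟨q, m, k, rfl⟩ := x
  refine ⟨k, m, ?_⟩
  ext
  change (2 : ℚ) ^ k * (m / 2 ^ k) = m
  field_simp

theorem dyadic_mul_pow_mono {x : dyadic} {k l : ℕ} (h : k ≤ l)
    (hk : ∃ m : ℤ, (2 : dyadic) ^ k * x = m) : ∃ m : ℤ, (2 : dyadic) ^ l * x = m := by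
  obtain ⟨m, hm⟩ := hk
  refine ⟨2 ^ (l - k) * m, ?_⟩
  push_cast
  rw [← hm, ← mul_assoc, ← pow_add, Nat.sub_add_cancel h]

namespace Cyc

theorem two_pow_mul_a {R : Type} [CommRing R] (k : ℕ) (x : Cyc R) :
    ((2 : Cyc R) ^ k * x) = ⟨2 ^ k * x.a, 2 ^ k * x.b, 2 ^ k * x.c, 2 ^ k * x.d⟩ := by
  have h : (2 : Cyc R) ^ k = ⟨0, 0, 0, 2 ^ k⟩ := by
    rw [show (2 : Cyc R) ^ k = ((2 ^ k : ℕ) : Cyc R) by push_cast; rfl]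
    ext <;> simp only [natCast_a, natCast_b, natCast_c, natCast_d]
    push_cast; rfl
  rw [h]
  ext <;> simp

theorem exists_two_pow_mul_eq_toD (x : DOmega) : ∃ (k : ℕ) (v : ZOmega), 2 ^ k * x = v.toD := by
  obtain ⟨ka, ha⟩ := dyadic_exists_mul_pow x.a
  obtain ⟨kb, hb⟩ := dyadic_exists_mul_pow x.b
  obtain ⟨kc, hc⟩ := dyadic_exists_mul_pow x.c
  obtain ⟨kd, hd⟩ := dyadic_exists_mul_pow x.d
  obtain ⟨ma, ha⟩ := dyadic_mul_pow_mono (show ka ≤ ka + kb + kc + kd by omega) ha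
  obtain ⟨mb, hb⟩ := dyadic_mul_pow_mono (show kb ≤ ka + kb + kc + kd by omega) hb
  obtain ⟨mc, hc⟩ := dyadic_mul_pow_mono (show kc ≤ ka + kb + kc + kd by omega) hc
  obtain ⟨md, hd⟩ := dyadic_mul_pow_mono (show kd ≤ ka + kb + kc + kd by omega) hd
  refine ⟨ka + kb + kc + kd, ⟨ma, mb, mc, md⟩, ?_⟩
  rw [two_pow_mul_a]
  ext1 <;> simp only [toD_a, toD_b, toD_c, toD_d, ha, hb, hc, hd]

theorem exists_isDenominatorExponent (x : DOmega) : ∃ k, IsDenominatorExponent k x := by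
  obtain ⟨k, v, h⟩ := exists_two_pow_mul_eq_toD x
  exact ⟨2 * k, v, by rw [pow_mul, pow_two, sqrtTwo_mul_self, h]⟩

theorem isDenominatorExponent_mono {x : DOmega} {k l : ℕ} (h : k ≤ l)
    (hk : IsDenominatorExponent k x) : IsDenominatorExponent l x := by
  obtain ⟨v, hv⟩ := hk
  refine ⟨sqrtTwo ^ (l - k) * v, ?_⟩
  rw [toD_mul, ← hv, toD_pow, toD_sqrtTwo, ← mul_assoc, ← pow_add, Nat.sub_add_cancel h]

theorem isDenominatorExponent_least (x : DOmega) :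
    IsDenominatorExponent (leastDenominatorExponent x) x :=
  Nat.sInf_mem (exists_isDenominatorExponent x)

theorem isDenominatorExponent_iff {x : DOmega} {k : ℕ} :
    IsDenominatorExponent k x ↔ leastDenominatorExponent x ≤ k :=
  ⟨fun h => Nat.sInf_le h, fun h => isDenominatorExponent_mono h (isDenominatorExponent_least x)⟩

end Cyc

/-! ### The embedding in `ℂ` -/

theorem omegaC_eq : omegaC = ((Real.sqrt 2 / 2 : ℝ) : ℂ) * (1 + Complex.I) := by
  rw [omegaC, mul_comm, show (Real.pi / 4 : ℂ) = ((Real.pi / 4 : ℝ) : ℂ) by push_cast; rfl,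
    Complex.exp_mul_I, ← Complex.ofReal_cos, ← Complex.ofReal_sin, Real.cos_pi_div_four,
    Real.sin_pi_div_four]
  ring

theorem sqrt_two_sq_complex : ((Real.sqrt 2 : ℝ) : ℂ) ^ 2 = 2 := by
  rw [← Complex.ofReal_pow, Real.sq_sqrt (by norm_num)]; norm_num

theorem omegaC_sq : omegaC ^ 2 = Complex.I := by
  rw [omegaC_eq, mul_pow]
  push_cast
  rw [div_pow, sqrt_two_sq_complex]
  linear_combination (1 / 2 : ℂ) * Complex.I_sq

theorem omegaC_pow_four : omegaC ^ 4 = -1 := by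
  rw [show 4 = 2 * 2 from rfl, pow_mul, omegaC_sq, Complex.I_sq]

theorem conj_omegaC : (starRingEnd ℂ) omegaC = -omegaC ^ 3 := by
  rw [show omegaC ^ 3 = omegaC ^ 2 * omegaC by ring, omegaC_sq, omegaC_eq]
  simp only [map_mul, Complex.conj_ofReal, map_add, map_one, Complex.conj_I]
  linear_combination (((Real.sqrt 2 / 2 : ℝ) : ℂ)) * Complex.I_sq

namespace Cyc

/-- The inclusion `𝔻[ω] ⊆ ℂ` as a ring homomorphism. -/
def toComplexHom : DOmega →+* ℂ where
  toFun := toComplex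
  map_one' := by simp [toComplex]
  map_mul' x y := by
    simp only [toComplex, mul_a, mul_b, mul_c, mul_d]
    push_cast
    linear_combination (-(x.a * y.a * omegaC ^ 2 + (x.a * y.b + x.b * y.a) * omegaC
      + (x.a * y.c + x.b * y.b + x.c * y.a)) : ℂ) * omegaC_pow_four
  map_zero' := by simp [toComplex]
  map_add' x y := by
    simp only [toComplex, add_a, add_b, add_c, add_d]
    push_cast
    ring

theorem toComplexHom_apply (x : DOmega) : toComplexHom x = x.toComplex := rfl
theorem toComplex_mul (x y : DOmega) : (x * y).toComplex = x.toComplex * y.toComplex :=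
  map_mul toComplexHom x y
theorem toComplex_add (x y : DOmega) : (x + y).toComplex = x.toComplex + y.toComplex :=
  map_add toComplexHom x y
theorem toComplex_sub (x y : DOmega) : (x - y).toComplex = x.toComplex - y.toComplex :=
  map_sub toComplexHom x y
theorem toComplex_neg (x : DOmega) : (-x).toComplex = -x.toComplex := map_neg toComplexHom x
theorem toComplex_pow (x : DOmega) (n : ℕ) : (x ^ n).toComplex = x.toComplex ^ n :=
  map_pow toComplexHom x n
@[simp] theorem toComplex_one : (1 : DOmega).toComplex = 1 := map_one toComplexHom
@[simp] theorem toComplex_zero : (0 : DOmega).toComplex = 0 := map_zero toComplexHom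
theorem toComplex_intCast (n : ℤ) : (n : DOmega).toComplex = n := map_intCast toComplexHom n

theorem toComplex_dag (x : DOmega) : x.dag.toComplex = (starRingEnd ℂ) x.toComplex := by
  simp only [toComplex, dag_a, dag_b, dag_c, dag_d, map_add, map_mul, map_pow, conj_omegaC,
    map_ratCast]
  push_cast
  linear_combination (x.a * (omegaC ^ 5 - omegaC) - x.b * omegaC ^ 2 : ℂ) * omegaC_pow_four

@[simp] theorem toComplex_omega : (omega : DOmega).toComplex = omegaC := by simp [toComplex]
@[simp] theorem toComplex_imag : (imag : DOmega).toComplex = Complex.I := by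
  simp [toComplex, omegaC_sq]

theorem omegaC_sub_pow_three : omegaC - omegaC ^ 3 = (Real.sqrt 2 : ℝ) := by
  rw [show omegaC ^ 3 = omegaC ^ 2 * omegaC by ring, omegaC_sq, omegaC_eq]
  push_cast
  linear_combination (-(Real.sqrt 2 : ℂ) / 2) * Complex.I_sq

@[simp] theorem toComplex_sqrtTwo : (sqrtTwo : DOmega).toComplex = (Real.sqrt 2 : ℝ) := by
  rw [← omegaC_sub_pow_three]
  simp [toComplex]
  ring

theorem toComplex_invSqrtTwo : invSqrtTwo.toComplex = ((1 / Real.sqrt 2 : ℝ) : ℂ) := by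
  have h := congrArg toComplex sqrtTwo_mul_invSqrtTwo
  rw [toComplex_mul, toComplex_sqrtTwo, toComplex_one] at h
  have h2 : ((Real.sqrt 2 : ℝ) : ℂ) ≠ 0 := by simp
  push_cast
  field_simp
  rw [mul_comm]; exact h

/-- The norm form: `x† x = N + M √2`. -/
theorem toComplex_dag_mul_self (x : DOmega) :
    (x.dag * x).toComplex = ((Complex.normSq x.toComplex : ℝ) : ℂ) := by
  rw [toComplex_mul, toComplex_dag, Complex.normSq_eq_conj_mul_self]

end Cyc

/-! ### Arithmetic in `ℤ[√2]` and `ℤ[ω]` -/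

theorem isPrincipalIdealRing_of_division {R : Type} [CommRing R] (N : R → ℕ)
    (h : ∀ x y : R, y ≠ 0 → ∃ q, N (x - y * q) < N y) : IsPrincipalIdealRing R := by
  classical
  refine ⟨fun I => ?_⟩
  by_cases hI : I = ⊥
  · exact ⟨0, by simp [hI]⟩
  obtain ⟨y₀, hy₀, hy₀'⟩ := Submodule.exists_mem_ne_zero_of_ne_bot hI
  have hex : ∃ n, ∃ y ∈ I, y ≠ 0 ∧ N y = n := ⟨_, y₀, hy₀, hy₀', rfl⟩
  obtain ⟨y, hyI, hy, hyN⟩ := Nat.find_spec hex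
  refine ⟨y, le_antisymm (fun x hx => ?_) (by simpa [Ideal.span_le] using hyI)⟩
  obtain ⟨q, hq⟩ := h x y hy
  have hmem : x - y * q ∈ I := I.sub_mem hx (I.mul_mem_right q hyI)
  by_cases h0 : x - y * q = 0
  · exact Ideal.mem_span_singleton'.2 ⟨q, by rw [mul_comm]; exact (sub_eq_zero.1 h0).symm⟩
  · exact absurd (hyN ▸ hq) (not_lt.2 (Nat.find_min' hex ⟨_, hmem, h0, rfl⟩))

/-- Rounding `z / N` to a nearest integer; this is how both Euclidean divisions below choose their
quotients, coordinate by coordinate. -/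
theorem exists_two_mul_abs_sub_mul_le (z N : ℤ) (hN : N ≠ 0) : ∃ q, 2 * |z - N * q| ≤ |N| := by
  have h0 := Int.emod_nonneg z hN
  have h1 := Int.emod_lt_abs z hN
  have h2 := Int.emod_add_mul_ediv z N
  by_cases h : 2 * (z % N) ≤ |N|
  · refine ⟨z / N, ?_⟩
    rw [show z - N * (z / N) = z % N by linarith, abs_of_nonneg h0]
    exact h
  · refine ⟨z / N + N.sign, ?_⟩
    have h3 : z - N * (z / N + N.sign) = z % N - |N| := by
      rw [mul_add, Int.mul_sign_self, ← Int.natCast_natAbs]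
      linarith
    rw [h3, abs_of_neg (by linarith)]
    linarith

/-! ### ℤ[√2] is norm-Euclidean. -/

section ZsqrtTwo

theorem two_ne_mul_self (n : ℤ) : (2 : ℤ) ≠ n * n := by
  intro h
  have h1 : n < 2 := by nlinarith
  have h2 : -2 < n := by nlinarith
  interval_cases n <;> omega

theorem zsqrtTwo_norm_eq_zero (x : ℤ√2) : x.norm = 0 ↔ x = 0 :=
  Zsqrtd.norm_eq_zero two_ne_mul_self x

instance : NoZeroDivisors (ℤ√2) where
  eq_zero_or_eq_zero_of_mul_eq_zero {x y} h := by
    rw [← zsqrtTwo_norm_eq_zero, ← zsqrtTwo_norm_eq_zero y, ← mul_eq_zero, ← Zsqrtd.norm_mul, h,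
      Zsqrtd.norm_zero]

instance : IsDomain (ℤ√2) := NoZeroDivisors.to_isDomain _

/-- Both coordinates of `x ȳ / N(y)` are rounded. The errors `r₁, r₂` are at most `|N|/2`, so `|r₁²
- 2 r₂²| ≤ N²/2 < N²`. -/
theorem zsqrtTwo_division (x y : ℤ√2) (hy : y ≠ 0) :
    ∃ q, (x - y * q).norm.natAbs < y.norm.natAbs := by
  have hN : y.norm ≠ 0 := mt (zsqrtTwo_norm_eq_zero y).1 hy
  set z := x * star y with hz
  obtain ⟨q₁, h₁⟩ := exists_two_mul_abs_sub_mul_le z.re y.norm hN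
  obtain ⟨q₂, h₂⟩ := exists_two_mul_abs_sub_mul_le z.im y.norm hN
  refine ⟨⟨q₁, q₂⟩, ?_⟩
  set q : ℤ√2 := ⟨q₁, q₂⟩
  have h3 : star y * (x - y * q) = ⟨z.re - y.norm * q₁, z.im - y.norm * q₂⟩ := by
    have : star y * (x - y * q) = z - (y.norm : ℤ√2) * q := by
      rw [Zsqrtd.norm_eq_mul_conj, hz]; ring
    rw [this]
    ext <;> simp [q]
  have h4 := congrArg Zsqrtd.norm h3
  rw [Zsqrtd.norm_mul, Zsqrtd.norm_conj] at h4
  set N := y.norm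
  generalize z.re - N * q₁ = r₁ at *
  generalize z.im - N * q₂ = r₂ at *
  rw [Zsqrtd.norm_def ⟨r₁, r₂⟩] at h4
  have hNpos : 0 < |N| := abs_pos.2 hN
  have h5 : 4 * r₁ ^ 2 ≤ N ^ 2 := by
    rw [← sq_abs r₁, ← sq_abs N]; nlinarith [abs_nonneg r₁]
  have h6 : 4 * r₂ ^ 2 ≤ N ^ 2 := by
    rw [← sq_abs r₂, ← sq_abs N]; nlinarith [abs_nonneg r₂]
  have h7 : |N * (x - y * q).norm| < |N| * |N| := by
    rw [h4, abs_mul_abs_self, abs_lt]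
    have : 0 < N * N := mul_self_pos.2 hN
    constructor <;> nlinarith [sq_nonneg r₁, sq_nonneg r₂]
  rw [abs_mul] at h7
  have h8 := lt_of_mul_lt_mul_left h7 hNpos.le
  zify
  exact h8

instance : IsPrincipalIdealRing (ℤ√2) :=
  isPrincipalIdealRing_of_division (fun x => x.norm.natAbs) zsqrtTwo_division

end ZsqrtTwo

/-! ### ℤ[ω] is norm-Euclidean. -/

namespace Cyc

/-- The relative norm `x† x` as an element of `ℤ[√2]`. -/
def relNorm (x : ZOmega) : ℤ√2 :=
  ⟨x.a ^ 2 + x.b ^ 2 + x.c ^ 2 + x.d ^ 2, x.a * x.b + x.b * x.c + x.c * x.d - x.d * x.a⟩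

end Cyc

@[simp] theorem zsqrtToZOmega_a (x : ℤ√2) : (zsqrtToZOmega x).a = -x.im := rfl
@[simp] theorem zsqrtToZOmega_b (x : ℤ√2) : (zsqrtToZOmega x).b = 0 := rfl
@[simp] theorem zsqrtToZOmega_c (x : ℤ√2) : (zsqrtToZOmega x).c = x.im := rfl
@[simp] theorem zsqrtToZOmega_d (x : ℤ√2) : (zsqrtToZOmega x).d = x.re := rfl

/-- The inclusion `ℤ[√2] ⊆ ℤ[ω]` as a ring homomorphism. -/
def zsqrtHom : ℤ√2 →+* ZOmega where
  toFun := zsqrtToZOmega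
  map_one' := by ext <;> simp
  map_mul' x y := by ext <;> simp <;> ring
  map_zero' := by ext <;> simp
  map_add' x y := by ext <;> simp; ring

theorem zsqrtHom_apply (x : ℤ√2) : zsqrtHom x = zsqrtToZOmega x := rfl

theorem zsqrtHom_injective : Function.Injective zsqrtHom := by
  intro x y h
  have h1 := congrArg Cyc.c h
  have h2 := congrArg Cyc.d h
  exact Zsqrtd.ext h2 h1

theorem dag_zsqrtHom (x : ℤ√2) : (zsqrtHom x).dag = zsqrtHom x := by
  ext <;> simp [zsqrtHom_apply]

theorem bullet_zsqrtHom (x : ℤ√2) : (zsqrtHom x).bullet = zsqrtHom (star x) := by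
  ext <;> simp [zsqrtHom_apply]

theorem exists_eq_zsqrtHom {x : ZOmega} (h : x.dag = x) : ∃ y, x = zsqrtHom y := by
  have hb := congrArg Cyc.b h
  have hc := congrArg Cyc.c h
  simp only [Cyc.dag_b, Cyc.dag_c] at hb hc
  refine ⟨⟨x.d, x.c⟩, ?_⟩
  ext <;> simp [zsqrtHom_apply] <;> omega

theorem zsqrtHom_relNorm (x : ZOmega) : zsqrtHom x.relNorm = x.dag * x := by
  ext <;> simp [zsqrtHom_apply, Cyc.relNorm] <;> ring

namespace Cyc

theorem relNorm_mul (x y : ZOmega) : (x * y).relNorm = x.relNorm * y.relNorm := by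
  apply zsqrtHom_injective
  rw [map_mul, zsqrtHom_relNorm, zsqrtHom_relNorm, zsqrtHom_relNorm, dag_mul]
  ring

/-- The absolute norm of an element of `ℤ[ω]`. -/
def absNorm (x : ZOmega) : ℤ := x.relNorm.norm

theorem absNorm_mul (x y : ZOmega) : (x * y).absNorm = x.absNorm * y.absNorm := by
  rw [absNorm, relNorm_mul, Zsqrtd.norm_mul]; rfl

theorem absNorm_eq_zero (x : ZOmega) : x.absNorm = 0 ↔ x = 0 := by
  rw [absNorm, zsqrtTwo_norm_eq_zero]
  refine ⟨fun h => ?_, fun h => by subst h; rfl⟩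
  have h1 := congrArg Zsqrtd.re h
  simp only [relNorm, Zsqrtd.re_zero] at h1
  have ha : x.a = 0 := by nlinarith [sq_nonneg x.a, sq_nonneg x.b, sq_nonneg x.c, sq_nonneg x.d]
  have hb : x.b = 0 := by nlinarith [sq_nonneg x.a, sq_nonneg x.b, sq_nonneg x.c, sq_nonneg x.d]
  have hc : x.c = 0 := by nlinarith [sq_nonneg x.a, sq_nonneg x.b, sq_nonneg x.c, sq_nonneg x.d]
  have hd : x.d = 0 := by nlinarith [sq_nonneg x.a, sq_nonneg x.b, sq_nonneg x.c, sq_nonneg x.d]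
  ext <;> simp [ha, hb, hc, hd]

theorem absNorm_def (x : ZOmega) : x.absNorm = (x.a ^ 2 + x.b ^ 2 + x.c ^ 2 + x.d ^ 2) ^ 2
    - 2 * (x.a * x.b + x.b * x.c + x.c * x.d - x.d * x.a) ^ 2 := by
  simp only [absNorm, relNorm, Zsqrtd.norm_def]; ring

theorem absNorm_nonneg (x : ZOmega) : 0 ≤ x.absNorm := by
  rw [absNorm_def]
  -- The norm equals the first of these squares plus twice the second.
  nlinarith [sq_nonneg (x.a ^ 2 + x.c ^ 2 - x.b ^ 2 - x.d ^ 2),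
    sq_nonneg (x.a * (x.b + x.d) - x.c * (x.b - x.d))]

instance : NoZeroDivisors ZOmega where
  eq_zero_or_eq_zero_of_mul_eq_zero {x y} h := by
    rw [← absNorm_eq_zero, ← absNorm_eq_zero y, ← mul_eq_zero, ← absNorm_mul, h, absNorm_eq_zero]

instance : Nontrivial ZOmega := ⟨0, 1, fun h => by simpa using congrArg Cyc.d h⟩

instance : IsDomain ZOmega := NoZeroDivisors.to_isDomain _

end Cyc

/-- The quotient of two elements fixed by `†` is fixed by `†`, so it already lies in ℤ[√2]. -/
theorem zsqrtHom_dvd_iff {x y : ℤ√2} : zsqrtHom x ∣ zsqrtHom y ↔ x ∣ y := by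
  refine ⟨fun ⟨z, hz⟩ => ?_, map_dvd zsqrtHom⟩
  by_cases hx : x = 0
  · subst hx
    rw [map_zero, zero_mul] at hz
    rw [zsqrtHom_injective (hz.trans (map_zero _).symm)]
  have hz' := congrArg Cyc.dag hz
  rw [Cyc.dag_mul, dag_zsqrtHom, dag_zsqrtHom, hz] at hz'
  have hx' : zsqrtHom x ≠ 0 := fun h => hx (zsqrtHom_injective (h.trans (map_zero _).symm))
  obtain ⟨w, rfl⟩ := exists_eq_zsqrtHom (mul_left_cancel₀ hx' hz').symm
  exact ⟨w, zsqrtHom_injective (by rw [hz, map_mul])⟩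

namespace Cyc

theorem absNorm_intCast (n : ℤ) : (n : ZOmega).absNorm = n ^ 4 := by
  rw [absNorm_def]; simp; ring

/-- The sum of the squares is at most `N²`, which gives `≤ N⁴`. Equality would need all coefficients
to be `±N/2` and the `√2`-part of `r† r` to vanish. But if `c = ±a`, that part is `2ab` or `-2ad`,
which is then nonzero. -/
theorem absNorm_lt_of_coeff_le {r : ZOmega} {N : ℤ} (hN : 0 < N) (ha : 2 * |r.a| ≤ N)
    (hb : 2 * |r.b| ≤ N) (hc : 2 * |r.c| ≤ N) (hd : 2 * |r.d| ≤ N) : r.absNorm < N ^ 4 := by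
  rw [absNorm_def]
  obtain ⟨a, b, c, d⟩ := r
  simp only at *
  have key : ∀ t : ℤ, 2 * |t| ≤ N → 4 * t ^ 2 ≤ N ^ 2 := fun t ht => by
    rw [← sq_abs t]; nlinarith [abs_nonneg t]
  have ka := key a ha
  have kb := key b hb
  have kc := key c hc
  have kd := key d hd
  by_contra hlt
  rw [not_lt] at hlt
  have h0 : 0 ≤ a ^ 2 + b ^ 2 + c ^ 2 + d ^ 2 := by positivity
  have h1 : (a ^ 2 + b ^ 2 + c ^ 2 + d ^ 2) ^ 2 ≤ (N ^ 2) ^ 2 := by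
    apply pow_le_pow_left₀ h0; linarith
  have h2 : a * b + b * c + c * d - d * a = 0 := by
    have : (a * b + b * c + c * d - d * a) ^ 2 ≤ 0 := by nlinarith
    exact pow_eq_zero_iff two_ne_zero |>.1 (le_antisymm this (sq_nonneg _))
  rw [h2] at hlt
  have h3 : N ^ 2 ≤ a ^ 2 + b ^ 2 + c ^ 2 + d ^ 2 := by
    apply le_of_sq_le_sq _ h0 |> fun h => h
    nlinarith
  have ea : (2 * a) ^ 2 = N ^ 2 := by nlinarith
  have eb : (2 * b) ^ 2 = N ^ 2 := by nlinarith
  have ec : (2 * c) ^ 2 = N ^ 2 := by nlinarith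
  have ed : (2 * d) ^ 2 = N ^ 2 := by nlinarith
  have hNN : 0 < N ^ 2 := by positivity
  have hac : a = c ∨ a = -c := sq_eq_sq_iff_eq_or_eq_neg.1 (by linarith)
  have h5 : a * b = 0 ∨ a * d = 0 := by
    rcases hac with rfl | rfl
    · exact .inl (by linarith)
    · exact .inr (by linarith)
  rcases h5 with h5 | h5 <;> rcases mul_eq_zero.1 h5 with h5 | h5 <;> subst h5 <;> linarith

theorem exists_mul_eq_absNorm (y : ZOmega) : ∃ z : ZOmega, z * y = (y.absNorm : ZOmega) := by
  refine ⟨zsqrtHom (star y.relNorm) * y.dag, ?_⟩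
  rw [mul_assoc, ← zsqrtHom_relNorm, ← map_mul, mul_comm, ← Zsqrtd.norm_eq_mul_conj]
  simp [absNorm]

theorem division (x y : ZOmega) (hy : y ≠ 0) :
    ∃ q, (x - y * q).absNorm.natAbs < y.absNorm.natAbs := by
  have hN : y.absNorm ≠ 0 := mt (absNorm_eq_zero y).1 hy
  have hN0 := (absNorm_nonneg y).lt_of_ne' hN
  obtain ⟨y', hy'⟩ := exists_mul_eq_absNorm y
  set z := y' * x with hz
  obtain ⟨qa, ha⟩ := exists_two_mul_abs_sub_mul_le z.a y.absNorm hN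
  obtain ⟨qb, hb⟩ := exists_two_mul_abs_sub_mul_le z.b y.absNorm hN
  obtain ⟨qc, hc⟩ := exists_two_mul_abs_sub_mul_le z.c y.absNorm hN
  obtain ⟨qd, hd⟩ := exists_two_mul_abs_sub_mul_le z.d y.absNorm hN
  refine ⟨⟨qa, qb, qc, qd⟩, ?_⟩
  set q : ZOmega := ⟨qa, qb, qc, qd⟩
  rw [abs_of_pos hN0] at ha hb hc hd
  have h1 : (y' * (x - y * q)).absNorm < y.absNorm ^ 4 := by
    have h2 : y' * (x - y * q) = z - (y.absNorm : ZOmega) * q := by rw [← hy', hz]; ring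
    rw [h2]
    apply absNorm_lt_of_coeff_le hN0 <;> simpa [q]
  have h3 := congrArg absNorm hy'
  rw [absNorm_mul, absNorm_intCast] at h3
  rw [absNorm_mul] at h1
  -- The cofactor `y'` has norm `N³`, so the bound `N⁴` on the norm of `y'` times the remainder
  -- becomes the bound `N` on the remainder.
  have h4 : y'.absNorm = y.absNorm ^ 3 := mul_right_cancel₀ hN (by rw [h3]; ring)
  rw [h4, pow_succ _ 3] at h1
  have h5 := lt_of_mul_lt_mul_left h1 (by positivity)
  have := absNorm_nonneg (x - y * q)
  omega

instance : IsPrincipalIdealRing ZOmega :=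
  isPrincipalIdealRing_of_division (fun x => x.absNorm.natAbs) division

end Cyc

/-! ### Greatest common divisors -/

section Gcd

variable {R : Type} [CommRing R]

theorem exists_isGreatestCommonDivisor [IsPrincipalIdealRing R] (x y : R) :
    ∃ g, IsGreatestCommonDivisor g x y ∧ ∃ a b, a * x + b * y = g := by
  obtain ⟨g, hg⟩ := (IsPrincipalIdealRing.principal (Ideal.span {x, y})).principal
  have hx : x ∈ Ideal.span {g} := by
    rw [Ideal.span, ← hg]; exact Ideal.subset_span (by simp)
  have hy : y ∈ Ideal.span {g} := by
    rw [Ideal.span, ← hg]; exact Ideal.subset_span (by simp)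
  have hgm : g ∈ Ideal.span {x, y} := by rw [hg]; exact Ideal.mem_span_singleton_self g
  obtain ⟨a, b, hab⟩ := Ideal.mem_span_pair.1 hgm
  refine ⟨g, ⟨Ideal.mem_span_singleton.1 hx, Ideal.mem_span_singleton.1 hy, fun f hf hf' => ?_⟩,
    a, b, hab⟩
  rw [← hab]
  exact dvd_add (hf.mul_left a) (hf'.mul_left b)

theorem IsGreatestCommonDivisor.exists_combination [IsPrincipalIdealRing R] {g x y : R}
    (h : IsGreatestCommonDivisor g x y) : ∃ a b, a * x + b * y = g := by
  obtain ⟨g', h', a, b, hab⟩ := exists_isGreatestCommonDivisor x y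
  obtain ⟨c, hc⟩ := h.2.2 g' h'.1 h'.2.1
  exact ⟨a * c, b * c, by rw [hc, ← hab]; ring⟩

theorem IsGreatestCommonDivisor.star [StarRing R] {g x y : R}
    (h : IsGreatestCommonDivisor g x y) :
    IsGreatestCommonDivisor (star g) (star x) (star y) := by
  have key : ∀ {a b : R}, a ∣ b → Star.star a ∣ Star.star b := fun {a b} ⟨c, hc⟩ =>
    ⟨Star.star c, by rw [hc, star_mul']⟩
  refine ⟨key h.1, key h.2.1, fun f hf hf' => ?_⟩
  have h1 := key hf
  have h2 := key hf'
  rw [star_star] at h1 h2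
  simpa using key (h.2.2 _ h1 h2)

/-- In the product of the two Bézout expressions every term contains `η` or `b b'`, so `η ∣ g g'`;
coprimality gives the converse. It is applied with `g'` a conjugate of `g`, to split `p` in ℤ[√2]
and `η` in ℤ[ω]. -/
theorem IsGreatestCommonDivisor.associated_mul [IsDomain R] [IsPrincipalIdealRing R]
    {g g' η b b' : R} (h : IsGreatestCommonDivisor g η b) (h' : IsGreatestCommonDivisor g' η b')
    (hη : η ∣ b * b') (hgg' : IsCoprime g g') : Associated (g * g') η := by
  refine associated_of_dvd_dvd (hgg'.mul_dvd h.1 h'.1) ?_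
  obtain ⟨x, y, rfl⟩ := h.exists_combination
  obtain ⟨x', y', rfl⟩ := h'.exists_combination
  have : (x * η + y * b) * (x' * η + y' * b')
      = η * (x * (x' * η + y' * b') + y * b * x') + y * y' * (b * b') := by ring
  rw [this]
  exact dvd_add (dvd_mul_right _ _) (hη.mul_left _)

theorem isCoprime_of_forall_isUnit [IsDomain R] [IsPrincipalIdealRing R] {x y : R}
    (h : ∀ d, d ∣ x → d ∣ y → IsUnit d) : IsCoprime x y :=
  isRelPrime_iff_isCoprime.1 fun _ hx hy => h _ hx hy

theorem isCoprime_list_prod {x : R} {L : List R} (h : ∀ y ∈ L, IsCoprime x y) :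
    IsCoprime x L.prod := by
  induction L with
  | nil => simpa using isCoprime_one_right
  | cons y L ih =>
    rw [List.prod_cons]
    exact (h y (by simp)).mul_right (ih fun z hz => h z (by simp [hz]))

theorem list_prod_dvd_of_coprime {z : R} {L : List R} (hL : L.Pairwise IsCoprime)
    (h : ∀ y ∈ L, y ∣ z) : L.prod ∣ z := by
  induction L with
  | nil => simp
  | cons y L ih =>
    rw [List.pairwise_cons] at hL
    rw [List.prod_cons]
    exact (isCoprime_list_prod hL.1).mul_dvd (h y (by simp))
      (ih hL.2 fun z hz => h z (by simp [hz]))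

theorem associated_list_prod {ι : Type} {f g : ι → R} {L : List ι}
    (h : ∀ i ∈ L, Associated (f i) (g i)) : Associated (L.map f).prod (L.map g).prod := by
  induction L with
  | nil => simp
  | cons y L ih =>
    simp only [List.map_cons, List.prod_cons]
    exact (h y (by simp)).mul_mul (ih fun z hz => h z (by simp [hz]))

end Gcd

/-! ### Primes of `ℤ[√2]` -/

theorem zsqrt_isUnit_iff (x : ℤ√2) : IsUnit x ↔ x.norm.natAbs = 1 := Zsqrtd.norm_eq_one_iff.symm

theorem zsqrt_norm_dvd {x y : ℤ√2} (h : x ∣ y) : x.norm ∣ y.norm := by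
  obtain ⟨z, rfl⟩ := h
  exact ⟨z.norm, Zsqrtd.norm_mul _ _⟩

theorem zsqrt_natAbs_norm_dvd {x y : ℤ√2} (h : x ∣ y) : x.norm.natAbs ∣ y.norm.natAbs :=
  Int.natAbs_dvd_natAbs.2 (zsqrt_norm_dvd h)

theorem zsqrt_isCoprime_of_norm {x y : ℤ√2} (h : Nat.Coprime x.norm.natAbs y.norm.natAbs) :
    IsCoprime x y :=
  isCoprime_of_forall_isUnit fun d hx hy => by
    rw [zsqrt_isUnit_iff]
    exact Nat.eq_one_of_dvd_coprimes h (zsqrt_natAbs_norm_dvd hx) (zsqrt_natAbs_norm_dvd hy)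

theorem zsqrt_prime_of_norm_prime {x : ℤ√2} (h : x.norm.natAbs.Prime) : Prime x := by
  refine Irreducible.prime ⟨fun hu => h.one_lt.ne' ((zsqrt_isUnit_iff x).1 hu), fun a b hab => ?_⟩
  rw [hab, Zsqrtd.norm_mul, Int.natAbs_mul, Nat.prime_mul_iff] at h
  rw [zsqrt_isUnit_iff, zsqrt_isUnit_iff]
  tauto

theorem zsqrt_norm_sqrtd : (Zsqrtd.sqrtd : ℤ√2).norm = -2 := by simp [Zsqrtd.norm_def]

theorem zsqrt_prime_sqrtd : Prime (Zsqrtd.sqrtd : ℤ√2) :=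
  zsqrt_prime_of_norm_prime (by rw [zsqrt_norm_sqrtd]; exact Nat.prime_two)

/-- Here 2 is not a square modulo `p`, so `p ∣ a² - 2b²` forces `p ∣ a` and `p ∣ b`: a norm
divisible by `p` comes only from a multiple of `p`. -/
theorem zsqrt_natCast_prime {p : ℕ} (hp : p.Prime) (h : p % 8 = 3 ∨ p % 8 = 5) :
    Prime (p : ℤ√2) := by
  have : Fact p.Prime := ⟨hp⟩
  have hp2 : p ≠ 2 := by rintro rfl; omega
  have key : ∀ x : ℤ√2, (p : ℤ) ∣ x.norm → (p : ℤ√2) ∣ x := by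
    intro x hx
    rw [Zsqrtd.norm_def] at hx
    have h2 : ¬ IsSquare (2 : ZMod p) := by
      rw [ZMod.exists_sq_eq_two_iff hp2]; omega
    have h0 : ((x.re : ZMod p)) ^ 2 = 2 * (x.im : ZMod p) ^ 2 := by
      have := (ZMod.intCast_zmod_eq_zero_iff_dvd _ p).2 hx
      push_cast at this
      linear_combination this
    have him : (x.im : ZMod p) = 0 := by
      by_contra hne
      apply h2
      refine ⟨x.re / x.im, ?_⟩
      field_simp
      exact h0.symm
    have hre : (x.re : ZMod p) = 0 := by
      rw [him] at h0
      exact pow_eq_zero_iff two_ne_zero |>.1 (h0.trans (by ring))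
    obtain ⟨r, hr⟩ := (ZMod.intCast_zmod_eq_zero_iff_dvd _ p).1 hre
    obtain ⟨i, hi⟩ := (ZMod.intCast_zmod_eq_zero_iff_dvd _ p).1 him
    exact ⟨⟨r, i⟩, by ext <;> simp [hr, hi]⟩
  refine ⟨by exact_mod_cast hp.ne_zero, fun hu => ?_, fun a b hab => ?_⟩
  · rw [zsqrt_isUnit_iff, Zsqrtd.norm_natCast, Int.natAbs_mul, Int.natAbs_natCast] at hu
    exact hp.one_lt.ne' (Nat.eq_one_of_mul_eq_one_right hu)
  · have h1 := zsqrt_norm_dvd hab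
    rw [Zsqrtd.norm_natCast, Zsqrtd.norm_mul] at h1
    rcases (Nat.prime_iff_prime_int.1 hp).dvd_or_dvd ((dvd_mul_right _ _).trans h1) with h1 | h1
    · exact .inl (key a h1)
    · exact .inr (key b h1)

section Split

variable {p : ℕ} {x : ℤ} {η : ℤ√2}

/-- A common divisor divides `(x + √2) - (x - √2) = 2√2`, of norm `-8`, and also `p`, of norm `p²`.
-/
theorem split_isCoprime (hp : p.Prime) (hp2 : p ≠ 2)
    (hη : IsGreatestCommonDivisor η (p : ℤ√2) ((x : ℤ√2) + Zsqrtd.sqrtd)) :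
    IsCoprime η (star η) := by
  refine isCoprime_of_forall_isUnit fun d h1 h2 => ?_
  have h3 : d ∣ ((x : ℤ√2) + Zsqrtd.sqrtd) - star ((x : ℤ√2) + Zsqrtd.sqrtd) :=
    dvd_sub (h1.trans hη.2.1) (h2.trans hη.star.2.1)
  have h4 := zsqrt_natAbs_norm_dvd h3
  have h5 := zsqrt_natAbs_norm_dvd (h1.trans hη.1)
  rw [Zsqrtd.norm_natCast, Int.natAbs_mul, Int.natAbs_natCast] at h5
  have h6 : (((x : ℤ√2) + Zsqrtd.sqrtd) - star ((x : ℤ√2) + Zsqrtd.sqrtd)).norm.natAbs = 2 ^ 3 := by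
    simp [Zsqrtd.norm_def]
  rw [h6] at h4
  rw [zsqrt_isUnit_iff]
  have h7 : Nat.Coprime 2 p := (Nat.coprime_primes Nat.prime_two hp).2 hp2.symm
  exact Nat.eq_one_of_dvd_coprimes ((h7.pow_left 3).mul_right (h7.pow_left 3)) h4 h5

theorem split_associated (hp : p.Prime) (hp2 : p ≠ 2) (hx : (p : ℤ) ∣ x ^ 2 - 2)
    (hη : IsGreatestCommonDivisor η (p : ℤ√2) ((x : ℤ√2) + Zsqrtd.sqrtd)) :
    Associated (η * star η) (p : ℤ√2) := by
  have h := hη.star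
  rw [star_natCast] at h
  refine hη.associated_mul h ?_ (split_isCoprime hp hp2 hη)
  obtain ⟨k, hk⟩ := hx
  refine ⟨k, ?_⟩
  rw [← Zsqrtd.norm_eq_mul_conj]
  have : ((x : ℤ√2) + Zsqrtd.sqrtd).norm = p * k := by
    rw [← hk]; simp [Zsqrtd.norm_def]; ring
  rw [this]; push_cast; rfl

theorem split_norm (hp : p.Prime) (hp2 : p ≠ 2) (hx : (p : ℤ) ∣ x ^ 2 - 2)
    (hη : IsGreatestCommonDivisor η (p : ℤ√2) ((x : ℤ√2) + Zsqrtd.sqrtd)) :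
    η.norm.natAbs = p := by
  obtain ⟨u, hu⟩ := split_associated hp hp2 hx hη
  have h1 := congrArg (fun z => (Zsqrtd.norm z).natAbs) hu
  simp only [Zsqrtd.norm_mul, Zsqrtd.norm_conj, Zsqrtd.norm_natCast, Int.natAbs_mul,
    Int.natAbs_natCast, (zsqrt_isUnit_iff _).1 u.isUnit, mul_one] at h1
  exact Nat.mul_self_inj.1 h1

end Split

/-- This records that the residue field of `η` is `𝔽_p`, with `√2` reducing to the integer `-x`; for
the conjugate prime the sign of `x` changes. -/
theorem PrimesAbove.norm_of_mod_seven {p : ℕ} {L : List (ℤ√2)} (h : PrimesAbove p L)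
    (hp : p.Prime) (h7 : p % 8 = 7) {η : ℤ√2} (hη : η ∈ L) :
    η.norm.natAbs = p ∧ ∃ x : ℤ, η ∣ (x : ℤ√2) + Zsqrtd.sqrtd := by
  cases h with
  | two => omega
  | inert _ h => omega
  | split _ h x hx η₀ hη₀ =>
    have hp2 : p ≠ 2 := by rintro rfl; omega
    have hn := split_norm hp hp2 hx hη₀
    simp only [List.mem_cons, List.not_mem_nil, or_false] at hη
    rcases hη with rfl | rfl
    · exact ⟨hn, x, hη₀.2.1⟩
    · refine ⟨by rw [Zsqrtd.norm_conj, hn], -x, ?_⟩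
      have := hη₀.star.2.1
      rw [← dvd_neg] at this
      convert this using 1
      ext <;> simp

theorem PrimesAbove.prime {p : ℕ} {L : List (ℤ√2)} (h : PrimesAbove p L) (hp : p.Prime)
    {η : ℤ√2} (hη : η ∈ L) : Prime η := by
  cases h with
  | two =>
    rw [List.mem_singleton] at hη
    exact hη ▸ zsqrt_prime_sqrtd
  | inert _ h =>
    rw [List.mem_singleton] at hη
    exact hη ▸ zsqrt_natCast_prime hp h
  | split _ h x hx η₀ hη₀ =>
    have hp2 : p ≠ 2 := by rintro rfl; omega
    have hn := split_norm hp hp2 hx hη₀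
    simp only [List.mem_cons, List.not_mem_nil, or_false] at hη
    rcases hη with rfl | rfl
    · exact zsqrt_prime_of_norm_prime (hn.symm ▸ hp)
    · exact zsqrt_prime_of_norm_prime (by rw [Zsqrtd.norm_conj, hn]; exact hp)

theorem PrimesAbove.dvd {p : ℕ} {L : List (ℤ√2)} (h : PrimesAbove p L)
    {η : ℤ√2} (hη : η ∈ L) : η ∣ (p : ℤ√2) := by
  cases h with
  | two =>
    rw [List.mem_singleton] at hη
    exact hη ▸ ⟨Zsqrtd.sqrtd, by ext <;> simp⟩
  | inert _ h =>
    rw [List.mem_singleton] at hη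
    exact hη ▸ dvd_rfl
  | split _ h x hx η₀ hη₀ =>
    simp only [List.mem_cons, List.not_mem_nil, or_false] at hη
    rcases hη with rfl | rfl
    · exact hη₀.1
    · simpa using hη₀.star.1

theorem PrimesAbove.exists_dvd {p : ℕ} {L : List (ℤ√2)} (h : PrimesAbove p L) (hp : p.Prime)
    {π : ℤ√2} (hπ : Prime π) (hπp : π ∣ (p : ℤ√2)) : ∃ η ∈ L, η ∣ π := by
  -- Divisibility between primes is symmetric, so the direction that primality of `π` yields is
  -- enough.
  suffices ∃ η ∈ L, π ∣ η by
    obtain ⟨η, hη, hd⟩ := this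
    exact ⟨η, hη, (hπ.associated_of_dvd (h.prime hp hη) hd).symm.dvd⟩
  cases h with
  | two =>
    refine ⟨_, List.mem_singleton_self _, hπ.dvd_of_dvd_pow (n := 2) (hπp.trans (dvd_of_eq ?_))⟩
    rw [pow_two]; ext <;> simp
  | inert _ h => exact ⟨_, List.mem_singleton_self _, hπp⟩
  | split _ h x hx η₀ hη₀ =>
    have hp2 : p ≠ 2 := by rintro rfl; omega
    rcases hπ.dvd_or_dvd (hπp.trans (split_associated hp hp2 hx hη₀).symm.dvd) with h | h
    · exact ⟨_, by simp, h⟩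
    · exact ⟨_, by simp, h⟩

theorem PrimesAbove.pairwise {p : ℕ} {L : List (ℤ√2)} (h : PrimesAbove p L) (hp : p.Prime) :
    L.Pairwise IsCoprime := by
  cases h with
  | two => simp
  | inert _ h => simp
  | split _ h x hx η₀ hη₀ =>
    have hp2 : p ≠ 2 := by rintro rfl; omega
    simpa using split_isCoprime hp hp2 hη₀

theorem exists_primesAbove {p : ℕ} (hp : p.Prime) : ∃ L, PrimesAbove p L := by
  have : Fact p.Prime := ⟨hp⟩
  by_cases h2 : p = 2
  · subst h2; exact ⟨_, .two⟩
  have hodd : p % 2 = 1 := hp.eq_two_or_odd.resolve_left h2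
  by_cases h : p % 8 = 3 ∨ p % 8 = 5
  · exact ⟨_, .inert p h⟩
  have h' : p % 8 = 1 ∨ p % 8 = 7 := by omega
  obtain ⟨y, hy⟩ := (ZMod.exists_sq_eq_two_iff h2).2 h'
  obtain ⟨x, rfl⟩ := ZMod.intCast_surjective y
  obtain ⟨η, hη, -⟩ := exists_isGreatestCommonDivisor (p : ℤ√2) ((x : ℤ√2) + Zsqrtd.sqrtd)
  refine ⟨_, .split p h' x ?_ η hη⟩
  rw [← ZMod.intCast_zmod_eq_zero_iff_dvd]
  push_cast
  rw [hy]; ring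

/-! ### Totally positive units of `ℤ[√2]` are squares -/

/-- No fundamental unit is needed. From `a² - 2b² = 1` follow `a = 2k + 1`, `b = 2j` and `k(k+1) =
2j²`. Halving the even one of `k`, `k + 1` leaves two coprime nonnegative integers whose product is
`j²`, so both are squares, and their roots are the coordinates of a square root of `w` up to a sign.
-/
theorem exists_sq_eq_of_norm_eq_one {w : ℤ√2} (hw : w.norm = 1) (hre : 0 < w.re) :
    ∃ v, v ^ 2 = w := by
  obtain ⟨a, b⟩ := w
  simp only [Zsqrtd.norm_def] at hw hre
  have ha : a % 2 = 1 := by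
    by_contra h
    obtain ⟨k, hk⟩ : ∃ k, a = 2 * k := ⟨a / 2, by omega⟩
    subst hk
    have : 2 * (2 * k * k - b * b) = 1 := by linarith
    omega
  obtain ⟨k, rfl⟩ : ∃ k, a = 2 * k + 1 := ⟨a / 2, by omega⟩
  have hb : b % 2 = 0 := by
    by_contra h
    obtain ⟨j, rfl⟩ : ∃ j, b = 2 * j + 1 := ⟨b / 2, by omega⟩
    have : 2 * (2 * (k * k + k) - 4 * (j * j + j) - 1) = 0 := by linarith
    omega
  obtain ⟨j, rfl⟩ : ∃ j, b = 2 * j := ⟨b / 2, by omega⟩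
  have h1 : k * (k + 1) = 2 * j ^ 2 := by linarith
  have hk : 0 ≤ k := by omega
  have hpos : ∀ {m n : ℤ}, 0 ≤ m → 0 ≤ n → IsCoprime m n → (∃ c, m * n = c ^ 2) →
      ∃ r s, m = r ^ 2 ∧ n = s ^ 2 := by
    intro m n hm hn hc ⟨c, h⟩
    obtain ⟨r, hr⟩ := Int.sq_of_isCoprime hc h
    obtain ⟨s, hs⟩ := Int.sq_of_isCoprime hc.symm ((mul_comm _ _).trans h)
    refine ⟨r, s, ?_, ?_⟩
    · rcases hr with hr | hr
      · exact hr
      · nlinarith [sq_nonneg r]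
    · rcases hs with hs | hs
      · exact hs
      · nlinarith [sq_nonneg s]
  rcases Int.even_or_odd' k with ⟨l, rfl | rfl⟩
  · obtain ⟨r, s, hr, hs⟩ := hpos (m := l) (n := 2 * l + 1) (by omega) (by omega)
      ⟨-2, 1, by ring⟩ ⟨j, by linarith⟩
    have hj : j ^ 2 = (r * s) ^ 2 := by rw [mul_pow, ← hr, ← hs]; linarith
    rcases sq_eq_sq_iff_eq_or_eq_neg.1 hj with hj | hj
    · refine ⟨⟨s, r⟩, ?_⟩
      rw [pow_two]
      ext <;> simp
      · linarith
      · rw [hj]; ring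
    · refine ⟨⟨s, -r⟩, ?_⟩
      rw [pow_two]
      ext <;> simp
      · linarith
      · rw [hj]; ring
  · obtain ⟨r, s, hr, hs⟩ := hpos (m := 2 * l + 1) (n := l + 1) (by omega) (by omega)
      ⟨-1, 2, by ring⟩ ⟨j, by linarith⟩
    have hj : j ^ 2 = (r * s) ^ 2 := by rw [mul_pow, ← hr, ← hs]; linarith
    rcases sq_eq_sq_iff_eq_or_eq_neg.1 hj with hj | hj
    · refine ⟨⟨r, s⟩, ?_⟩
      rw [pow_two]
      ext <;> simp
      · linarith
      · rw [hj]; ring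
    · refine ⟨⟨r, -s⟩, ?_⟩
      rw [pow_two]
      ext <;> simp
      · linarith
      · rw [hj]; ring

/-! ### The relative norm equation, prime power by prime power -/

namespace Cyc

/-- The relative norm `x ↦ x† x` as a monoid homomorphism. -/
def relNormHom : ZOmega →* ℤ√2 where
  toFun := relNorm
  map_one' := by ext <;> simp [relNorm]
  map_mul' := relNorm_mul

theorem relNormHom_apply (x : ZOmega) : relNormHom x = x.relNorm := rfl

theorem relNorm_pow (x : ZOmega) (n : ℕ) : (x ^ n).relNorm = x.relNorm ^ n :=
  map_pow relNormHom x n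

theorem relNorm_zsqrtHom (x : ℤ√2) : (zsqrtHom x).relNorm = x ^ 2 :=
  zsqrtHom_injective (by rw [zsqrtHom_relNorm, dag_zsqrtHom, map_pow, pow_two])

/-- A common divisor of `g` and `g†` divides `b - b†`, hence 4, and the odd number `p`; so they are
coprime. As `η ∣ p ∣ b b†`, their product is `η` up to a unit, and associatedness descends from ℤ[ω]
to ℤ[√2]. -/
theorem relNorm_gcd_associated {p : ℕ} (hp : Odd p) {η : ℤ√2} (hη : η ∣ (p : ℤ√2))
    {g b : ZOmega} (hg : IsGreatestCommonDivisor g (zsqrtHom η) b)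
    (hb : (p : ZOmega) ∣ b * b.dag) (h4 : b - b.dag ∣ 4) : Associated g.relNorm η := by
  have hg' := hg.star
  rw [star_eq_dag, star_eq_dag, star_eq_dag, dag_zsqrtHom] at hg'
  have hηp : zsqrtHom η ∣ (p : ZOmega) := by simpa using map_dvd zsqrtHom hη
  have hc : IsCoprime g g.dag := by
    refine isCoprime_of_forall_isUnit fun d h1 h2 => ?_
    have h3 : d ∣ 4 := (dvd_sub (h1.trans hg.2.1) (h2.trans hg'.2.1)).trans h4
    have h5 : d ∣ (p : ZOmega) := h1.trans (hg.1.trans hηp)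
    have h6 : IsCoprime (4 : ℤ) p :=
      Nat.isCoprime_iff_coprime (m := 4).2 ((Nat.coprime_two_left.2 hp).pow_left 2)
    obtain ⟨u, v, huv⟩ := h6
    have h7 : (u : ZOmega) * 4 + v * (p : ZOmega) = 1 := by
      simpa using congrArg (Int.cast : ℤ → ZOmega) huv
    exact isUnit_of_dvd_one (h7 ▸ dvd_add (h3.mul_left _) (h5.mul_left _))
  have h := hg.associated_mul hg' (hηp.trans hb) hc
  rw [mul_comm, ← zsqrtHom_relNorm] at h
  exact associated_of_dvd_dvd (zsqrtHom_dvd_iff.1 h.dvd) (zsqrtHom_dvd_iff.1 h.symm.dvd)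

theorem imag_mul_self {R : Type} [CommRing R] : (imag : Cyc R) * imag = -1 := by ext <;> simp

theorem intCast_add_imag_mul_dag (x : ℤ) :
    ((x : ZOmega) + imag) * ((x : ZOmega) + imag).dag = ((x ^ 2 + 1 : ℤ) : ZOmega) := by
  rw [pow_two]
  ext <;> simp

theorem intCast_add_imag_sqrtTwo_mul_dag (x : ℤ) :
    ((x : ZOmega) + imag * sqrtTwo) * ((x : ZOmega) + imag * sqrtTwo).dag
      = ((x ^ 2 + 2 : ℤ) : ZOmega) := by
  rw [pow_two]
  ext <;> simp
  ring

theorem relNorm_gcd_imag {p : ℕ} (hp : Odd p) {η : ℤ√2} (hη : η ∣ (p : ℤ√2)) {x : ℤ}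
    (hx : (p : ℤ) ∣ x ^ 2 + 1) {g : ZOmega}
    (hg : IsGreatestCommonDivisor g (zsqrtHom η) ((x : ZOmega) + imag)) :
    Associated g.relNorm η := by
  refine relNorm_gcd_associated hp hη hg ?_ ⟨-2 * imag, ?_⟩
  · rw [intCast_add_imag_mul_dag]
    exact_mod_cast map_dvd (Int.castRingHom ZOmega) hx
  · rw [show (4 : ZOmega) = 2 * 2 by norm_num]
    ext <;> simp

theorem relNorm_gcd_imag_sqrtTwo {p : ℕ} (hp : Odd p) {η : ℤ√2} (hη : η ∣ (p : ℤ√2)) {x : ℤ}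
    (hx : (p : ℤ) ∣ x ^ 2 + 2) {g : ZOmega}
    (hg : IsGreatestCommonDivisor g (zsqrtHom η) ((x : ZOmega) + imag * sqrtTwo)) :
    Associated g.relNorm η := by
  refine relNorm_gcd_associated hp hη hg ?_ ⟨-imag * sqrtTwo, ?_⟩
  · rw [intCast_add_imag_sqrtTwo_mul_dag]
    exact_mod_cast map_dvd (Int.castRingHom ZOmega) hx
  · rw [show (4 : ZOmega) = 2 * 2 by norm_num]
    ext <;> simp

end Cyc

open Cyc

theorem PowerSolution.relNorm_associated {p : ℕ} {L : List (ℤ√2)} (hL : PrimesAbove p L)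
    {η : ℤ√2} (hη : η ∈ L) {m : ℕ} {s : ZOmega} (h : PowerSolution p η m s) :
    Associated s.relNorm (η ^ m) := by
  cases h with
  | even _ _ r =>
    rw [← zsqrtHom_apply, ← map_pow, relNorm_zsqrtHom, ← pow_mul, mul_comm]
  | two _ _ hm =>
    have : η = Zsqrtd.sqrtd := by
      cases hL with
      | two => simpa using hη
      | inert _ h => omega
      | split _ h => omega
    subst this
    rw [relNorm_pow]
    refine Associated.pow_pow ?_
    have h1 : relNorm delta = Zsqrtd.sqrtd * (1 + Zsqrtd.sqrtd) := by ext <;> simp [relNorm]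
    rw [h1]
    refine associated_mul_unit_left _ _ ?_
    rw [zsqrt_isUnit_iff]; simp [Zsqrtd.norm_def]
  | one_mod_four _ _ _ hm hp x hx g hg =>
    rw [relNorm_pow]
    exact (relNorm_gcd_imag (Nat.odd_iff.2 (by omega)) (hL.dvd hη) hx hg).pow_pow
  | three_mod_eight _ _ _ hm hp x hx g hg =>
    rw [relNorm_pow]
    exact (relNorm_gcd_imag_sqrtTwo (Nat.odd_iff.2 (by omega)) (hL.dvd hη) hx hg).pow_pow

/-- For odd `m` the roots exist because `-1` is a square modulo `p ≡ 1 (mod 4)` and `-2` is a square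
modulo `p ≡ 3 (mod 8)`; the only remaining odd class is 7. -/
theorem exists_powerSolution {p : ℕ} (hp : p.Prime) (η : ℤ√2) {m : ℕ}
    (h : p % 8 = 7 → ¬ Odd m) : ∃ s, PowerSolution p η m s := by
  have : Fact p.Prime := ⟨hp⟩
  rcases Nat.even_or_odd' m with ⟨r, rfl | hm⟩
  · exact ⟨_, .even p η r⟩
  have hm : Odd m := ⟨r, hm⟩
  by_cases h2 : p = 2
  · subst h2; exact ⟨_, .two η m hm⟩
  have hodd : p % 2 = 1 := hp.eq_two_or_odd.resolve_left h2
  by_cases h1 : p % 8 = 1 ∨ p % 8 = 5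
  · obtain ⟨y, hy⟩ := (ZMod.exists_sq_eq_neg_one_iff (p := p)).2 (by omega)
    obtain ⟨x, rfl⟩ := ZMod.intCast_surjective y
    obtain ⟨g, hg, -⟩ := exists_isGreatestCommonDivisor (zsqrtToZOmega η) ((x : ZOmega) + imag)
    refine ⟨_, .one_mod_four p η m hm h1 x ?_ g hg⟩
    rw [← ZMod.intCast_zmod_eq_zero_iff_dvd]
    push_cast
    linear_combination -hy
  · have h3 : p % 8 = 3 := by
      have : p % 8 ≠ 7 := fun h' => h h' hm
      omega
    obtain ⟨y, hy⟩ := (ZMod.exists_sq_eq_neg_two_iff h2).2 (.inr h3)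
    obtain ⟨x, rfl⟩ := ZMod.intCast_surjective y
    obtain ⟨g, hg, -⟩ := exists_isGreatestCommonDivisor (zsqrtToZOmega η)
      ((x : ZOmega) + imag * sqrtTwo)
    refine ⟨_, .three_mod_eight p η m hm h3 x ?_ g hg⟩
    rw [← ZMod.intCast_zmod_eq_zero_iff_dvd]
    push_cast
    linear_combination -hy

/-! ### The obstruction at primes `p ≡ 7 (mod 8)` -/

/-- The prime `η` is inert in ℤ[ω]: writing `√2 T = α + iβ` gives `α² + β² = 2 T† T ≡ 0` in the
residue field `𝔽_p`, where `-1` is not a square because `p ≡ 3 (mod 4)`. So `α` and `β` vanish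
modulo `η`, and the factor `√2` is coprime to `η`. -/
theorem dvd_of_dvd_relNorm {p : ℕ} (hp : p.Prime) (h7 : p % 8 = 7) {η : ℤ√2}
    (hn : η.norm.natAbs = p) {x : ℤ} (hx : η ∣ (x : ℤ√2) + Zsqrtd.sqrtd) {T : ZOmega}
    (hT : η ∣ T.relNorm) : zsqrtHom η ∣ T := by
  have : Fact p.Prime := ⟨hp⟩
  obtain ⟨a, b, c, d⟩ := T
  have hpη : η ∣ (p : ℤ√2) := by
    have h1 : η ∣ (η.norm : ℤ√2) := by rw [Zsqrtd.norm_eq_mul_conj]; exact dvd_mul_right _ _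
    rcases Int.natAbs_eq η.norm with h | h <;> rw [h, hn] at h1 <;> simpa using h1
  have hint : ∀ z : ℤ, η ∣ (z : ℤ√2) → (z : ZMod p) = 0 := by
    intro z hz
    rw [ZMod.intCast_zmod_eq_zero_iff_dvd]
    have h1 := zsqrt_natAbs_norm_dvd hz
    rw [hn, Zsqrtd.norm_intCast, Int.natAbs_mul] at h1
    rcases hp.dvd_mul.1 h1 with h | h <;> exact Int.natCast_dvd.2 h
  have hint' : ∀ z : ℤ, (z : ZMod p) = 0 → η ∣ (z : ℤ√2) := by
    intro z hz
    obtain ⟨k, rfl⟩ := (ZMod.intCast_zmod_eq_zero_iff_dvd _ p).1 hz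
    rw [Int.cast_mul, Int.cast_natCast]
    exact hpη.mul_right _
  -- `√2 T = α + i β`, and `α`, `β` are congruent to the integers `A`, `B` modulo `η`
  set α : ℤ√2 := ⟨c - a, d⟩ with hα
  set β : ℤ√2 := ⟨a + c, b⟩ with hβ
  set A : ℤ := c - a - x * d with hA
  set B : ℤ := a + c - x * b with hB
  have hαA : α - (A : ℤ√2) = (d : ℤ√2) * ((x : ℤ√2) + Zsqrtd.sqrtd) := by
    ext <;> simp [hα, hA, mul_comm]
  have hβB : β - (B : ℤ√2) = (b : ℤ√2) * ((x : ℤ√2) + Zsqrtd.sqrtd) := by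
    ext <;> simp [hβ, hB, mul_comm]
  have h1 : η ∣ α - (A : ℤ√2) := hαA ▸ hx.mul_left _
  have h2 : η ∣ β - (B : ℤ√2) := hβB ▸ hx.mul_left _
  have hsum : α ^ 2 + β ^ 2 = 2 * relNorm ⟨a, b, c, d⟩ := by
    rw [pow_two, pow_two]
    ext <;> simp [hα, hβ, relNorm] <;> ring
  have h3 : η ∣ ((A ^ 2 + B ^ 2 : ℤ) : ℤ√2) := by
    have h4 : ((A ^ 2 + B ^ 2 : ℤ) : ℤ√2)
        = 2 * relNorm ⟨a, b, c, d⟩ - ((α - (A : ℤ√2)) * (α + A) + (β - (B : ℤ√2)) * (β + B)) := by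
      rw [← hsum]; push_cast; ring
    rw [h4]
    exact dvd_sub (hT.mul_left _) (dvd_add (h1.mul_right _) (h2.mul_right _))
  have h4 := hint _ h3
  push_cast at h4
  have hB0 : (B : ZMod p) = 0 := by
    by_contra hne
    refine (ZMod.exists_sq_eq_neg_one_iff (p := p)).1 ⟨A / B, ?_⟩ (by omega)
    field_simp
    linear_combination -h4
  have hA0 : (A : ZMod p) = 0 := by
    rw [hB0] at h4
    exact pow_eq_zero_iff two_ne_zero |>.1 (by linear_combination h4)
  have h5 : η ∣ α := by simpa using dvd_add h1 (hint' _ hA0)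
  have h6 : η ∣ β := by simpa using dvd_add h2 (hint' _ hB0)
  have h7' : zsqrtHom η ∣ sqrtTwo * ⟨a, b, c, d⟩ := by
    have h8 : (sqrtTwo : ZOmega) * ⟨a, b, c, d⟩ = zsqrtHom α + imag * zsqrtHom β := by
      ext <;> simp [zsqrtHom_apply, hα, hβ] <;> ring
    rw [h8]
    exact dvd_add (map_dvd _ h5) ((map_dvd _ h6).mul_left _)
  have hco : IsCoprime η Zsqrtd.sqrtd := by
    refine zsqrt_isCoprime_of_norm ?_
    rw [hn, zsqrt_norm_sqrtd]
    exact (Nat.coprime_primes hp Nat.prime_two).2 (by omega)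
  have hs : zsqrtHom Zsqrtd.sqrtd = sqrtTwo := by ext <;> simp [zsqrtHom_apply]
  exact (hs ▸ hco.map zsqrtHom).dvd_of_dvd_mul_left h7'

/-- Descent: if `η` divides `T† T`, it divides `T`, and removing it from `T` removes `η²` from the
relative norm. -/
theorem even_of_hasMultiplicity_relNorm {p : ℕ} (hp : p.Prime) (h7 : p % 8 = 7) {η : ℤ√2}
    (hn : η.norm.natAbs = p) {x : ℤ} (hx : η ∣ (x : ℤ√2) + Zsqrtd.sqrtd) {m : ℕ} :
    ∀ {T : ZOmega}, HasMultiplicity η T.relNorm m → Even m := by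
  have hη0 : η ≠ 0 := by
    rintro rfl
    rw [Zsqrtd.norm_zero] at hn
    exact hp.ne_zero hn.symm
  induction m using Nat.strong_induction_on with
  | _ m ih =>
    intro T hT
    rcases Nat.eq_zero_or_pos m with rfl | hm
    · exact Even.zero
    have h1 : η ∣ T.relNorm := (dvd_pow_self η hm.ne').trans hT.1
    obtain ⟨T₁, rfl⟩ := dvd_of_dvd_relNorm hp h7 hn hx h1
    rw [relNorm_mul, relNorm_zsqrtHom] at hT
    have hm2 : 2 ≤ m := by
      by_contra h
      obtain rfl : m = 1 := by omega
      exact hT.2 (dvd_mul_right _ _)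
    obtain ⟨k, rfl⟩ : ∃ k, m = k + 2 := ⟨m - 2, by omega⟩
    have h2 : HasMultiplicity η T₁.relNorm k := by
      obtain ⟨ha, hb⟩ := hT
      have hne := pow_ne_zero 2 hη0
      refine ⟨?_, fun h => hb ?_⟩
      · rw [pow_add, mul_comm] at ha
        exact (mul_dvd_mul_iff_left hne).1 ha
      · rw [show k + 2 + 1 = 2 + (k + 1) by omega, pow_add]
        exact mul_dvd_mul_left _ h
    exact (ih k (by omega) h2).add (by decide)

theorem exists_hasMultiplicity {η ξ : ℤ√2} (hη : Prime η) (hξ : ξ ≠ 0) :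
    ∃ m, HasMultiplicity η ξ m := by
  have hf := FiniteMultiplicity.of_not_isUnit hη.not_isUnit hξ
  exact ⟨multiplicity η ξ, pow_multiplicity_dvd _ _, hf.not_pow_dvd_of_multiplicity_lt (by omega)⟩

/-! ### Factorization in `ℤ[√2]` over the primes above the factors of the norm -/

/-- The prime powers are pairwise coprime, so their product divides `ξ`. A prime factor of the
cofactor would divide the norm of `ξ`, hence some `p ∈ F`, hence be associated to a listed `η`,
whose multiplicity would then be exceeded. Duplicates are removed from `F` because `m` already
counts multiplicity in `ξ`. -/
theorem associated_prod_primesAbove {ξ : ℤ√2} (hξ : ξ ≠ 0) {F : List ℕ}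
    (hF : ∀ p ∈ F, p.Prime) (hprod : F.prod = ξ.norm.natAbs) {P : ℕ → List (ℤ√2)}
    (hP : ∀ p ∈ F, PrimesAbove p (P p)) {m : ℕ → ℤ√2 → ℕ}
    (hm : ∀ p ∈ F, ∀ η ∈ P p, HasMultiplicity η ξ (m p η)) :
    Associated (F.dedup.map fun p => ((P p).map fun η => η ^ m p η).prod).prod ξ := by
  set Q := (F.dedup.map fun p => ((P p).map fun η => η ^ m p η).prod).prod with hQ
  have hdvd : Q ∣ ξ := by
    refine list_prod_dvd_of_coprime ?_ ?_
    · rw [List.pairwise_map]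
      refine (List.nodup_dedup F).pairwise_of_forall_ne ?_
      intro p hp q hq hpq
      rw [List.mem_dedup] at hp hq
      refine isCoprime_list_prod fun y hy => (isCoprime_list_prod fun z hz => ?_).symm
      obtain ⟨η, hη, rfl⟩ := List.mem_map.1 hy
      obtain ⟨η', hη', rfl⟩ := List.mem_map.1 hz
      refine IsCoprime.pow (IsCoprime.of_isCoprime_of_dvd_left (IsCoprime.of_isCoprime_of_dvd_right
        ?_ ((hP p hp).dvd hη')) ((hP q hq).dvd hη))
      exact ((Nat.coprime_primes (hF q hq) (hF p hp)).2 hpq.symm).cast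
    · intro y hy
      obtain ⟨p, hp, rfl⟩ := List.mem_map.1 hy
      rw [List.mem_dedup] at hp
      refine list_prod_dvd_of_coprime ?_ ?_
      · rw [List.pairwise_map]
        exact ((hP p hp).pairwise (hF p hp)).imp fun h => h.pow
      · intro z hz
        obtain ⟨η, hη, rfl⟩ := List.mem_map.1 hz
        exact (hm p hp η hη).1
  obtain ⟨c, hc⟩ := hdvd
  refine ⟨IsUnit.unit (a := c) ?_, hc.symm⟩
  by_contra hcu
  have hc0 : c ≠ 0 := by rintro rfl; exact hξ (by rw [hc, mul_zero])
  obtain ⟨π, hπ, hπc⟩ := WfDvdMonoid.exists_irreducible_factor hcu hc0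
  have hπ := hπ.prime
  have h1 : π ∣ ((F.prod : ℕ) : ℤ√2) := by
    have h2 : π ∣ (ξ.norm : ℤ√2) := by
      rw [Zsqrtd.norm_eq_mul_conj]
      exact (hπc.trans ⟨Q, by rw [hc, mul_comm]⟩).mul_right _
    rw [hprod]
    rcases Int.natAbs_eq ξ.norm with h | h <;> rw [h] at h2 <;> simpa using h2
  obtain ⟨p, hp, hπp⟩ : ∃ p ∈ F, π ∣ (p : ℤ√2) := by
    rw [Nat.cast_list_prod] at h1
    obtain ⟨y, hy, hd⟩ := hπ.dvd_prod_iff.1 h1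
    obtain ⟨p, hp, rfl⟩ := List.mem_map.1 hy
    exact ⟨p, hp, hd⟩
  obtain ⟨η, hη, hηπ⟩ := (hP p hp).exists_dvd (hF p hp) hπ hπp
  refine (hm p hp η hη).2 ?_
  rw [hc, pow_succ]
  refine mul_dvd_mul ?_ (hηπ.trans hπc)
  refine (List.dvd_prod (List.mem_map_of_mem (f := fun η => η ^ m p η) hη)).trans
    (List.dvd_prod (List.mem_map_of_mem (f := fun p => ((P p).map fun η => η ^ m p η).prod)
      (List.mem_dedup.2 hp)))

/-! ### The inclusion of `ℤ[√2]` in `𝔻[ω]` -/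

/-- The inclusion `ℤ[√2] ⊆ 𝔻[ω]` as a ring homomorphism. -/
def zsqrtDHom : ℤ√2 →+* DOmega := toDHom.comp zsqrtHom

theorem zsqrtDHom_apply (x : ℤ√2) : zsqrtDHom x = zsqrtToD x := rfl

theorem zsqrtDHom_eq_toD (x : ℤ√2) : zsqrtDHom x = (zsqrtHom x).toD := rfl

theorem zsqrtDHom_injective : Function.Injective zsqrtDHom :=
  fun _ _ h => zsqrtHom_injective (toD_injective h)

theorem dag_zsqrtDHom (x : ℤ√2) : (zsqrtDHom x).dag = zsqrtDHom x := by
  rw [zsqrtDHom_eq_toD, ← toD_dag, dag_zsqrtHom]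

theorem bullet_zsqrtDHom (x : ℤ√2) : (zsqrtDHom x).bullet = zsqrtDHom (star x) := by
  rw [zsqrtDHom_eq_toD, ← toD_bullet, bullet_zsqrtHom]; rfl

theorem zsqrtDHom_relNorm (x : ZOmega) : zsqrtDHom x.relNorm = x.toD.dag * x.toD := by
  rw [zsqrtDHom_eq_toD, zsqrtHom_relNorm, toD_mul, toD_dag]

theorem zsqrtDHom_sqrtd : zsqrtDHom Zsqrtd.sqrtd = sqrtTwo := by
  rw [zsqrtDHom_eq_toD, ← toD_sqrtTwo]
  congr 1

/-- The embedding `a + b√2 ↦ a + b√2` of `ℤ[√2]` in `ℝ`. -/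
def zsqrtToReal (x : ℤ√2) : ℝ := x.re + x.im * Real.sqrt 2

theorem toComplex_zsqrtDHom (x : ℤ√2) :
    (zsqrtDHom x).toComplex = ((zsqrtToReal x : ℝ) : ℂ) := by
  have h : zsqrtDHom x = (x.re : DOmega) + (x.im : DOmega) * sqrtTwo := by
    rw [← zsqrtDHom_sqrtd, ← map_intCast zsqrtDHom, ← map_intCast zsqrtDHom, ← map_mul, ← map_add]
    congr 1
    ext <;> simp
  rw [h, toComplex_add, toComplex_mul, toComplex_sqrtTwo, toComplex_intCast, toComplex_intCast,
    zsqrtToReal]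
  push_cast
  rfl

theorem zsqrtToReal_mul_star (x : ℤ√2) : zsqrtToReal x * zsqrtToReal (star x) = x.norm := by
  have h : Real.sqrt 2 * Real.sqrt 2 = 2 := Real.mul_self_sqrt (by norm_num)
  simp only [zsqrtToReal, Zsqrtd.re_star, Zsqrtd.im_star, Zsqrtd.norm_def]
  push_cast
  linear_combination (-(x.im : ℝ) * x.im) * h

theorem intCast_DOmega_injective : Function.Injective (Int.cast : ℤ → DOmega) := by
  intro m n h
  rw [← map_intCast zsqrtDHom, ← map_intCast zsqrtDHom] at h
  exact Int.cast_injective (zsqrtDHom_injective h)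

/-! ### Norms and denominators in 𝔻[√2]. -/

theorem exists_zsqrtDHom_eq {ξ : DOmega} (hξ : ξ.dag = ξ) {k : ℕ}
    (hk : IsDenominatorExponent k ξ) : ∃ a, zsqrtDHom a = sqrtTwo ^ k * ξ := by
  obtain ⟨v, hv⟩ := hk
  have h : v.dag = v := by
    apply toD_injective
    rw [toD_dag, ← hv, dag_mul, dag_pow, dag_sqrtTwo, hξ]
  obtain ⟨a, rfl⟩ := exists_eq_zsqrtHom h
  exact ⟨a, hv.symm⟩

theorem bullet_sqrtTwo {R : Type} [CommRing R] : (sqrtTwo : Cyc R).bullet = -sqrtTwo := by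
  ext <;> simp

theorem intCast_norm_eq {ξ : DOmega} {k : ℕ} {a : ℤ√2} (ha : zsqrtDHom a = sqrtTwo ^ k * ξ) :
    (a.norm : DOmega) = (-1) ^ k * (2 ^ k * (ξ.bullet * ξ)) := by
  have h : (a.norm : DOmega) = (zsqrtDHom a).bullet * zsqrtDHom a := by
    rw [bullet_zsqrtDHom, ← map_mul, mul_comm, ← Zsqrtd.norm_eq_mul_conj, map_intCast]
  rw [h, ha, bullet_mul, bullet_pow, bullet_sqrtTwo, neg_pow, ← sqrtTwo_mul_self]
  ring

theorem exists_normIs {ξ : DOmega} (hξ : ξ.dag = ξ) : ∃ n ℓ, NormIs ξ n ℓ := by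
  classical
  obtain ⟨k, hk⟩ := exists_isDenominatorExponent ξ
  obtain ⟨a, ha⟩ := exists_zsqrtDHom_eq hξ hk
  have h := intCast_norm_eq ha
  have hex : ∃ ℓ : ℕ, ∃ n : ℤ, 2 ^ ℓ * (ξ.bullet * ξ) = (n : DOmega) := by
    refine ⟨k, (-1) ^ k * a.norm, ?_⟩
    push_cast
    rw [h, ← mul_assoc ((-1) ^ k), ← mul_pow]
    simp
  obtain ⟨n, hn⟩ := Nat.find_spec hex
  exact ⟨n, Nat.find hex, hn, fun n' ℓ' h' => Nat.find_min' hex ⟨n', h'⟩⟩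

/-- The denominator of the norm already clears `ξ`. If the least exponent `k` of `ξ` exceeded `ℓ`,
then `√2^k ξ` would have even norm, so its rational part would be even and it would be divisible by
`√2`, against minimality of `k`. -/
theorem NormIs.exists_zsqrt {ξ : DOmega} (hξ : ξ.dag = ξ) {n : ℤ} {ℓ : ℕ} (h : NormIs ξ n ℓ) :
    ∃ ξ' : ℤ√2, zsqrtToD ξ' = sqrtTwo ^ ℓ * ξ := by
  obtain ⟨a, ha⟩ := exists_zsqrtDHom_eq hξ (isDenominatorExponent_least ξ)
  set k := leastDenominatorExponent ξ with hk
  have hle : k ≤ ℓ := by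
    by_contra hlt
    rw [not_le] at hlt
    obtain ⟨j, hj⟩ : ∃ j, k = ℓ + (j + 1) := ⟨k - ℓ - 1, by omega⟩
    have h1 := intCast_norm_eq ha
    have h2 : a.norm = (-1) ^ k * (2 ^ (j + 1) * n) := by
      apply intCast_DOmega_injective
      push_cast
      rw [h1, ← h.1, hj]
      ring
    have h3 : (2 : ℤ) ∣ a.re := by
      have h4 : (2 : ℤ) ∣ a.norm := h2 ▸ ⟨(-1) ^ k * (2 ^ j * n), by ring⟩
      rw [Zsqrtd.norm_def, mul_assoc] at h4
      have h5 : (2 : ℤ) ∣ a.re * a.re := (dvd_sub_left (dvd_mul_right _ _)).1 h4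
      exact (Int.prime_two.dvd_or_dvd h5).elim id id
    obtain ⟨r, hr⟩ := h3
    have h4 : a = Zsqrtd.sqrtd * ⟨a.im, r⟩ := by ext <;> simp [hr]
    have h5 : IsDenominatorExponent (k - 1) ξ := by
      refine ⟨zsqrtHom ⟨a.im, r⟩, isUnit_sqrtTwo.mul_left_cancel ?_⟩
      rw [← mul_assoc, ← pow_succ', show k - 1 + 1 = k by omega, ← ha, ← zsqrtDHom_eq_toD,
        ← zsqrtDHom_sqrtd, ← map_mul, ← h4]
    have := isDenominatorExponent_iff.1 h5
    omega
  obtain ⟨a, ha⟩ := exists_zsqrtDHom_eq hξ (isDenominatorExponent_iff.2 hle)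
  exact ⟨a, ha⟩

theorem NormIs.natAbs_norm {ξ : DOmega} {n : ℤ} {ℓ : ℕ} (h : NormIs ξ n ℓ) {ξ' : ℤ√2}
    (hξ' : zsqrtToD ξ' = sqrtTwo ^ ℓ * ξ) : ξ'.norm.natAbs = n.natAbs := by
  have h1 := intCast_norm_eq hξ'
  rw [h.1] at h1
  have h2 : ξ'.norm = (-1) ^ ℓ * n := intCast_DOmega_injective (by push_cast; exact h1)
  rw [h2, Int.natAbs_mul, Int.natAbs_pow]
  simp

/-! ### Soundness of the Diophantine algorithm -/

theorem doublyPositive_dag_mul_self (t : DOmega) : DoublyPositive (t.dag * t) := by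
  refine ⟨?_, ?_⟩
  · rw [toComplex_dag_mul_self, Complex.ofReal_re]; exact Complex.normSq_nonneg _
  · rw [bullet_mul, bullet_dag, toComplex_dag_mul_self, Complex.ofReal_re]
    exact Complex.normSq_nonneg _

theorem HasMultiplicity.of_eq_mul {η a b c : ℤ√2} {m : ℕ} (h : HasMultiplicity η a m)
    {c' : ℤ√2} (heq : c * a = c' * b) (hc : IsCoprime η c) (hc' : IsCoprime η c') :
    HasMultiplicity η b m := by
  refine ⟨(hc'.pow_left).dvd_of_dvd_mul_left (heq ▸ h.1.mul_left c), fun hd => h.2 ?_⟩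
  exact (hc.pow_left).dvd_of_dvd_mul_left (heq ▸ hd.mul_left c')

/-- Clearing the denominator of a solution `t` changes `ξ'` only by powers of `√2`, which do not
affect the multiplicity of `η`; this multiplicity would be that of a relative norm, hence even. -/
theorem no_solution_of_obstruction {ξ : DOmega} {ℓ : ℕ} {ξ' : ℤ√2}
    (hξ' : zsqrtToD ξ' = sqrtTwo ^ ℓ * ξ) {p : ℕ} (hp : p.Prime) (h7 : p % 8 = 7)
    {L : List (ℤ√2)} (hL : PrimesAbove p L) {η : ℤ√2} (hη : η ∈ L) {m : ℕ}
    (hm : HasMultiplicity η ξ' m) (hodd : Odd m) (t : DOmega) : t.dag * t ≠ ξ := by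
  intro ht
  obtain ⟨hn, x, hx⟩ := hL.norm_of_mod_seven hp h7 hη
  obtain ⟨K, T, hT⟩ := exists_isDenominatorExponent t
  have h1 : Zsqrtd.sqrtd ^ (2 * K) * ξ' = Zsqrtd.sqrtd ^ ℓ * T.relNorm := by
    apply zsqrtDHom_injective
    rw [map_mul, map_mul, map_pow, map_pow, zsqrtDHom_sqrtd, zsqrtDHom_relNorm, ← hT, dag_mul,
      dag_pow, dag_sqrtTwo, zsqrtDHom_apply, hξ', ← ht]
    ring
  have hco : IsCoprime η Zsqrtd.sqrtd := by
    refine zsqrt_isCoprime_of_norm ?_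
    rw [hn, zsqrt_norm_sqrtd]
    exact (Nat.coprime_primes hp Nat.prime_two).2 (by omega)
  have h2 := even_of_hasMultiplicity_relNorm hp h7 hn hx
    (hm.of_eq_mul h1 hco.pow_right hco.pow_right)
  exact (Nat.not_even_iff_odd.2 hodd) h2

theorem DiophantineReturns.sound_none {ξ : DOmega} {n : ℤ} {ℓ : ℕ} {F : List ℕ}
    (hF : n ≠ 0 → ∀ p ∈ F, p.Prime) (h : DiophantineReturns ξ n ℓ F none) (t : DOmega) :
    t.dag * t ≠ ξ := by
  cases h with
  | not_doublyPositive h =>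
    rintro rfl
    exact h (doublyPositive_dag_mul_self t)
  | obstruction h hn ξ' hξ' P hP p hp hp7 η hη m hm hodd =>
    exact no_solution_of_obstruction hξ' (hF hn p hp) hp7 (hP p hp) hη hm hodd t

theorem eq_zero_of_bullet_mul_self {ξ : DOmega} (hξ : ξ.dag = ξ) (h : ξ.bullet * ξ = 0) :
    ξ = 0 := by
  obtain ⟨k, hk⟩ := exists_isDenominatorExponent ξ
  obtain ⟨a, ha⟩ := exists_zsqrtDHom_eq hξ hk
  have h1 := intCast_norm_eq ha
  rw [h, mul_zero, mul_zero] at h1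
  have h2 : a.norm = 0 := intCast_DOmega_injective (by simpa using h1)
  rw [(zsqrtTwo_norm_eq_zero a).1 h2, map_zero] at ha
  exact ((isUnit_sqrtTwo.pow k).mul_right_eq_zero).1 ha.symm

theorem NormIs.eq_zero {ξ : DOmega} (hξ : ξ.dag = ξ) {ℓ : ℕ} (h : NormIs ξ 0 ℓ) : ξ = 0 := by
  refine eq_zero_of_bullet_mul_self hξ ?_
  have h2 : IsUnit ((2 : DOmega) ^ ℓ) := by
    rw [← sqrtTwo_mul_self]
    exact (isUnit_sqrtTwo.mul isUnit_sqrtTwo).pow ℓ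
  exact h2.mul_right_eq_zero.1 (by rw [h.1]; simp)

theorem DiophantineReturns.sound_some {ξ : DOmega} (hξ : ξ.dag = ξ) {n : ℤ} {ℓ : ℕ} {F : List ℕ}
    (hN : NormIs ξ n ℓ) {t : DOmega} (h : DiophantineReturns ξ n ℓ F (some t)) :
    t.dag * t = ξ := by
  cases h with
  | zero h hn =>
    subst hn
    rw [hN.eq_zero hξ, dag_zero, mul_zero]
  | solution h hn ξ' hξ' P hP s hs t' ht' w v hw hξ hv =>
    rw [← zsqrtDHom_apply, dag_mul, dag_zsqrtDHom, hξ, ← hv, ← zsqrtDHom_apply, map_pow]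
    ring

/-! ### The Diophantine algorithm never gets stuck -/

/-- Positivity of both conjugates makes the norm `+1` and, through the trace, the rational part
positive. -/
theorem exists_sq_of_isUnit_of_pos {w : ℤ√2} (hw : IsUnit w) (h1 : 0 < zsqrtToReal w)
    (h2 : 0 < zsqrtToReal (star w)) : ∃ v, v ^ 2 = w := by
  have h3 : (0 : ℝ) < w.norm := zsqrtToReal_mul_star w ▸ mul_pos h1 h2
  have h4 : 0 < w.norm := by exact_mod_cast h3
  have h5 := (zsqrt_isUnit_iff w).1 hw
  refine exists_sq_eq_of_norm_eq_one (by omega) ?_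
  have h6 : (0 : ℝ) < 2 * w.re := by
    have : zsqrtToReal w + zsqrtToReal (star w) = 2 * w.re := by
      simp only [zsqrtToReal, Zsqrtd.re_star, Zsqrtd.im_star]; push_cast; ring
    linarith
  have h7 : (0 : ℝ) < w.re := by linarith
  exact_mod_cast h7

theorem pos_of_eq_zsqrtDHom_mul {ξ t : DOmega} {w : ℤ√2} (h : ξ = zsqrtDHom w * (t.dag * t))
    (h0 : 0 ≤ ξ.toComplex.re) (hne : ξ.toComplex ≠ 0) : 0 < zsqrtToReal w := by
  have h1 : ξ.toComplex = ((zsqrtToReal w * Complex.normSq t.toComplex : ℝ) : ℂ) := by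
    rw [h, toComplex_mul, toComplex_zsqrtDHom, toComplex_dag_mul_self]
    push_cast; rfl
  rw [h1, Complex.ofReal_re] at h0
  rw [h1] at hne
  have h2 : zsqrtToReal w * Complex.normSq t.toComplex ≠ 0 := fun h => hne (by rw [h]; simp)
  exact pos_of_mul_pos_left (h0.lt_of_ne' h2) (Complex.normSq_nonneg _)

theorem exists_diophantineReturns {ξ : DOmega} (hξ : ξ.dag = ξ) {n : ℤ} {ℓ : ℕ}
    (hN : NormIs ξ n ℓ) {F : List ℕ} (hF : n ≠ 0 → (∀ p ∈ F, p.Prime) ∧ F.prod = n.natAbs) :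
    ∃ r, DiophantineReturns ξ n ℓ F r := by
  classical
  by_cases hpos : DoublyPositive ξ
  swap
  · exact ⟨_, .not_doublyPositive hpos⟩
  by_cases hn : n = 0
  · exact ⟨_, .zero hpos hn⟩
  obtain ⟨hFp, hFn⟩ := hF hn
  obtain ⟨ξ', hξ'⟩ := hN.exists_zsqrt hξ
  have hnorm := hN.natAbs_norm hξ'
  have hξ0 : ξ' ≠ 0 := by
    rintro rfl
    rw [Zsqrtd.norm_zero] at hnorm
    omega
  -- The three choices are made as total functions, with dummy values where the procedure never
  -- looks.
  have hP : ∀ p, ∃ L, p ∈ F → PrimesAbove p L := fun p => by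
    by_cases hp : p ∈ F
    · exact (exists_primesAbove (hFp p hp)).imp fun _ h _ => h
    · exact ⟨[], fun h => absurd h hp⟩
  choose P hP using hP
  have hm : ∀ p η, ∃ m, p ∈ F → η ∈ P p → HasMultiplicity η ξ' m := fun p η => by
    by_cases h : p ∈ F ∧ η ∈ P p
    · exact (exists_hasMultiplicity ((hP p h.1).prime (hFp p h.1) h.2) hξ0).imp fun _ h _ _ => h
    · exact ⟨0, fun h1 h2 => absurd ⟨h1, h2⟩ h⟩
  choose m hm using hm
  by_cases hobs : ∃ p ∈ F, p % 8 = 7 ∧ ∃ η ∈ P p, Odd (m p η)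
  · obtain ⟨p, hp, hp7, η, hη, hodd⟩ := hobs
    exact ⟨_, .obstruction hpos hn ξ' hξ' P hP p hp hp7 η hη _ (hm p η hp hη) hodd⟩
  push Not at hobs
  have hs : ∀ p η, ∃ s, p ∈ F → η ∈ P p → PowerSolution p η (m p η) s := fun p η => by
    by_cases h : p ∈ F ∧ η ∈ P p
    · exact (exists_powerSolution (hFp p h.1) η fun h7 => by
        simpa using hobs p h.1 h7 η h.2).imp fun _ h _ _ => h
    · exact ⟨0, fun h1 h2 => absurd ⟨h1, h2⟩ h⟩
  choose s hs using hs
  set S := (F.dedup.map fun p => ((P p).map (s p)).prod).prod with hS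
  have hassoc : Associated S.relNorm ξ' := by
    have h1 : S.relNorm
        = (F.dedup.map fun p => ((P p).map fun η => (s p η).relNorm).prod).prod := by
      rw [← relNormHom_apply, hS, map_list_prod, List.map_map]
      congr 1
      refine List.map_congr_left fun p _ => ?_
      rw [Function.comp_apply, map_list_prod, List.map_map]
      rfl
    rw [h1]
    refine (associated_list_prod fun p hp => associated_list_prod fun η hη => ?_).trans
      (associated_prod_primesAbove hξ0 hFp (hFn.trans hnorm.symm) hP fun p hp η => hm p η hp)
    rw [List.mem_dedup] at hp
    exact (hs p η hp hη).relNorm_associated (hP p hp) hη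
  obtain ⟨w₀, hw₀⟩ := hassoc
  have hε : IsUnit (1 + Zsqrtd.sqrtd : ℤ√2) := by
    rw [zsqrt_isUnit_iff]; simp [Zsqrtd.norm_def]
  obtain ⟨t', ht'⟩ := (isUnit_delta.pow ℓ).dvd (a := S.toD)
  -- Since `δ† δ = √2 (1 + √2)`, dividing `S` by `δ^ℓ` removes `√2^ℓ` from its relative norm and
  -- leaves the unit `(1 + √2)^ℓ`.
  have hw : IsUnit ((w₀ : ℤ√2) * (1 + Zsqrtd.sqrtd) ^ ℓ) := w₀.isUnit.mul (hε.pow ℓ)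
  have hξt : ξ = zsqrtDHom ((w₀ : ℤ√2) * (1 + Zsqrtd.sqrtd) ^ ℓ) * (t'.dag * t') := by
    apply (isUnit_sqrtTwo.pow ℓ).mul_left_cancel
    rw [← hξ', ← zsqrtDHom_apply, ← hw₀, map_mul, zsqrtDHom_relNorm, ht', dag_mul, dag_pow,
      map_mul, map_pow, map_add, map_one, zsqrtDHom_sqrtd]
    have h : (delta.dag ^ ℓ * t'.dag * (delta ^ ℓ * t') : DOmega)
        = (sqrtTwo * (1 + sqrtTwo)) ^ ℓ * (t'.dag * t') := by
      rw [← delta_mul_dag, mul_pow]; ring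
    rw [h, mul_pow]
    ring
  have hne : (ξ.bullet * ξ).toComplex ≠ 0 := by
    intro h0
    have h1 := congrArg toComplex hN.1
    rw [toComplex_mul, h0, mul_zero, toComplex_intCast] at h1
    exact hn (by exact_mod_cast h1.symm)
  rw [toComplex_mul] at hne
  obtain ⟨v, hv⟩ := exists_sq_of_isUnit_of_pos hw
    (pos_of_eq_zsqrtDHom_mul hξt hpos.1 (right_ne_zero_of_mul hne))
    -- The conjugate of the unit is positive by the same argument applied to `ξ• = w• (t'•)† t'•`.
    (pos_of_eq_zsqrtDHom_mul (t := t'.bullet)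
      (by rw [← bullet_zsqrtDHom, ← bullet_dag, ← bullet_mul, ← bullet_mul, ← hξt]) hpos.2
      (left_ne_zero_of_mul hne))
  exact ⟨_, .solution hpos hn ξ' hξ' P hP s
    (fun p hp η hη => ⟨m p η, hm p η hp hη, hs p η hp hη⟩) t' ht'.symm _ v hw hξt hv⟩

open Cyc Matrix

/-! ### Residues modulo `δ` and modulo `√2` -/

namespace Cyc

/-- The reduction `ℤ[ω] → ℤ[ω]/δ = 𝔽₂`. -/
def par : ZOmega →+* ZMod 2 where
  toFun x := ((x.a + x.b + x.c + x.d : ℤ) : ZMod 2)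
  map_one' := by simp
  map_mul' x y := by
    have h : ∀ a b c d a' b' c' d' : ZMod 2,
        a * d' + b * c' + c * b' + d * a' + (b * d' + c * c' + d * b' - a * a')
          + (c * d' + d * c' - a * b' - b * a') + (d * d' - a * c' - b * b' - c * a')
        = (a + b + c + d) * (a' + b' + c' + d') := by
      intro a b c d a' b' c' d'
      have h2 : (2 : ZMod 2) = 0 := rfl
      linear_combination (-(a * a' + a * b' + b * a' + a * c' + b * b' + c * a')) * h2
    push_cast [mul_a, mul_b, mul_c, mul_d]
    exact h _ _ _ _ _ _ _ _
  map_zero' := by simp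
  map_add' x y := by
    simp only [add_a, add_b, add_c, add_d]
    push_cast
    ring

theorem par_apply (x : ZOmega) : par x = ((x.a + x.b + x.c + x.d : ℤ) : ZMod 2) := rfl

theorem par_eq_zero_iff {x : ZOmega} : par x = 0 ↔ (x.a + x.b + x.c + x.d) % 2 = 0 := by
  rw [par_apply, ZMod.intCast_zmod_eq_zero_iff_dvd]
  exact Int.dvd_iff_emod_eq_zero

theorem par_eq_zero_iff_dvd {x : ZOmega} : par x = 0 ↔ delta ∣ x := by
  refine ⟨fun h => ?_, fun ⟨y, hy⟩ => ?_⟩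
  · rw [par_eq_zero_iff] at h
    obtain ⟨a, b, c, d⟩ := x
    simp only at h
    -- Polynomial division by `1 + ω` leaves the remainder `-2A`, which is absorbed using `2 = (1 +
    -- ω)(1 - ω + ω² - ω³)`.
    obtain ⟨A, hA⟩ : ∃ A, a - b + c - d = 2 * A := ⟨(a - b + c - d) / 2, by omega⟩
    refine ⟨⟨A, a - A, b - a + A, c - b + a - A⟩, ?_⟩
    ext <;> simp
    linarith
  · rw [hy, map_mul, show par delta = 0 from by rw [par_apply]; simp; rfl, zero_mul]

@[simp] theorem par_delta : par delta = 0 := par_eq_zero_iff_dvd.2 dvd_rfl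
@[simp] theorem par_sqrtTwo : par sqrtTwo = 0 := by rw [par_apply]; simp
@[simp] theorem par_imag : par imag = 1 := by rw [par_apply]; simp
@[simp] theorem par_omega : par omega = 1 := by rw [par_apply]; simp

@[simp] theorem par_dag (x : ZOmega) : par x.dag = par x := by
  rw [par_apply, par_apply, ZMod.intCast_eq_intCast_iff_dvd_sub]
  exact ⟨x.a + x.b + x.c, by simp; ring⟩

theorem sqrtTwo_dvd_iff {x : ZOmega} :
    sqrtTwo ∣ x ↔ (x.a + x.c) % 2 = 0 ∧ (x.b + x.d) % 2 = 0 := by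
  obtain ⟨a, b, c, d⟩ := x
  constructor
  · rintro ⟨y, hy⟩
    have ha := congrArg Cyc.a hy
    have hb := congrArg Cyc.b hy
    have hc := congrArg Cyc.c hy
    have hd := congrArg Cyc.d hy
    simp at ha hb hc hd
    constructor <;> simp only <;> omega
  · simp only
    rintro ⟨h1, h2⟩
    refine ⟨⟨(b - d) / 2, (a + c) / 2, (b + d) / 2, (c - a) / 2⟩, ?_⟩
    ext <;> simp <;> omega

/-- Modulo `√2` the powers of `ω` alternate between the classes of 1 and `ω`. So divisibility by
`√2` detects the parity of an exponent. -/
theorem omega_pow_parity (j : ℕ) : (((omega : ZOmega) ^ j).a + ((omega : ZOmega) ^ j).c) % 2 = j % 2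
    ∧ (((omega : ZOmega) ^ j).b + ((omega : ZOmega) ^ j).d) % 2 = (j + 1) % 2 := by
  induction j with
  | zero => simp
  | succ j ih =>
    rw [pow_succ]
    simp
    omega

theorem exists_eq_omega_pow {x : ZOmega} (h : x.a ^ 2 + x.b ^ 2 + x.c ^ 2 + x.d ^ 2 = 1) :
    ∃ k, x = omega ^ k := by
  obtain ⟨a, b, c, d⟩ := x
  simp only at h
  have e1 : (omega : ZOmega) ^ 1 = ⟨0, 0, 1, 0⟩ := by rw [pow_one]; rfl
  have e2 : (omega : ZOmega) ^ 2 = ⟨0, 1, 0, 0⟩ := omega_pow_two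
  have e3 : (omega : ZOmega) ^ 3 = ⟨1, 0, 0, 0⟩ := by rw [pow_succ, e2]; ext <;> simp
  have e4 : (omega : ZOmega) ^ 4 = ⟨0, 0, 0, -1⟩ := by rw [pow_succ, e3]; ext <;> simp
  have e5 : (omega : ZOmega) ^ 5 = ⟨0, 0, -1, 0⟩ := by rw [pow_succ, e4]; ext <;> simp
  have e6 : (omega : ZOmega) ^ 6 = ⟨0, -1, 0, 0⟩ := by rw [pow_succ, e5]; ext <;> simp
  have e7 : (omega : ZOmega) ^ 7 = ⟨-1, 0, 0, 0⟩ := by rw [pow_succ, e6]; ext <;> simp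
  have ha : -1 ≤ a ∧ a ≤ 1 := by constructor <;> nlinarith [sq_nonneg b, sq_nonneg c, sq_nonneg d]
  have hb : -1 ≤ b ∧ b ≤ 1 := by constructor <;> nlinarith [sq_nonneg a, sq_nonneg c, sq_nonneg d]
  have hc : -1 ≤ c ∧ c ≤ 1 := by constructor <;> nlinarith [sq_nonneg b, sq_nonneg a, sq_nonneg d]
  have hd : -1 ≤ d ∧ d ≤ 1 := by constructor <;> nlinarith [sq_nonneg b, sq_nonneg c, sq_nonneg a]
  obtain ⟨ha1, ha2⟩ := ha
  obtain ⟨hb1, hb2⟩ := hb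
  obtain ⟨hc1, hc2⟩ := hc
  obtain ⟨hd1, hd2⟩ := hd
  interval_cases a <;> interval_cases b <;> interval_cases c <;> interval_cases d <;>
    first
    | omega
    | exact ⟨0, rfl⟩
    | exact ⟨1, e1.symm⟩
    | exact ⟨2, e2.symm⟩
    | exact ⟨3, e3.symm⟩
    | exact ⟨4, e4.symm⟩
    | exact ⟨5, e5.symm⟩
    | exact ⟨6, e6.symm⟩
    | exact ⟨7, e7.symm⟩

theorem dag_mul_self_d (x : ZOmega) :
    (x.dag * x).d = x.a ^ 2 + x.b ^ 2 + x.c ^ 2 + x.d ^ 2 := by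
  simp; ring

theorem eq_zero_of_sum_sq {x : ZOmega} (h : x.a ^ 2 + x.b ^ 2 + x.c ^ 2 + x.d ^ 2 = 0) : x = 0 := by
  have ha : x.a = 0 := by nlinarith [sq_nonneg x.a, sq_nonneg x.b, sq_nonneg x.c, sq_nonneg x.d]
  have hb : x.b = 0 := by nlinarith [sq_nonneg x.a, sq_nonneg x.b, sq_nonneg x.c, sq_nonneg x.d]
  have hc : x.c = 0 := by nlinarith [sq_nonneg x.a, sq_nonneg x.b, sq_nonneg x.c, sq_nonneg x.d]
  have hd : x.d = 0 := by nlinarith [sq_nonneg x.a, sq_nonneg x.b, sq_nonneg x.c, sq_nonneg x.d]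
  ext <;> simp [ha, hb, hc, hd]

/-- The trace `z + z†` is divisible by `√2`. -/
def halfTrace (z : ZOmega) : ZOmega := ⟨-z.d, 0, z.d, z.c - z.a⟩

theorem sqrtTwo_mul_halfTrace (z : ZOmega) : sqrtTwo * halfTrace z = z + z.dag := by
  ext <;> simp [halfTrace] <;> ring

theorem par_halfTrace_mul_delta (x : ZOmega) : par (halfTrace (x * delta)) = par x := by
  rw [par_apply, par_apply, ZMod.intCast_eq_intCast_iff_dvd_sub]
  exact ⟨x.a + x.b, by simp [halfTrace]; ring⟩

theorem sqrtTwo_dvd_sub_dag (x : ZOmega) : sqrtTwo ∣ x - x.dag := by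
  rw [sqrtTwo_dvd_iff]; simp; omega

theorem sqrtTwo_ne_zero : (sqrtTwo : ZOmega) ≠ 0 := fun h => by
  simpa using congrArg Cyc.c h

theorem delta_ne_zero : (delta : ZOmega) ≠ 0 := fun h => by
  simpa using congrArg Cyc.d h

end Cyc

/-! ### Circuits over `𝔻[ω]` -/

/-- The matrix of a gate, with entries in `𝔻[ω]`. -/
def gateD : Gate → Matrix (Fin 2) (Fin 2) DOmega
  | .H => !![invSqrtTwo, invSqrtTwo; invSqrtTwo, -invSqrtTwo]
  | .S => !![1, 0; 0, imag]
  | .T => !![1, 0; 0, omega]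
  | .omega => !![omega, 0; 0, omega]

/-- The operator of a circuit, with entries in `𝔻[ω]`. -/
def evalD (C : Circuit) : Matrix (Fin 2) (Fin 2) DOmega := (C.map gateD).prod

@[simp] theorem evalD_nil : evalD [] = 1 := rfl
theorem evalD_cons (g : Gate) (C : Circuit) : evalD (g :: C) = gateD g * evalD C := by simp [evalD]
theorem evalD_append (C D : Circuit) : evalD (C ++ D) = evalD C * evalD D := by simp [evalD]

theorem map_gateD (g : Gate) : toComplexHom.mapMatrix (gateD g) = g.matrix := by
  cases g <;> ext i j <;> fin_cases i <;> fin_cases j <;>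
    simp [gateD, Gate.matrix, toComplexHom_apply, toComplex_invSqrtTwo, toComplex_neg]

theorem map_evalD (C : Circuit) : toComplexHom.mapMatrix (evalD C) = C.eval := by
  rw [evalD, Circuit.eval, map_list_prod, List.map_map]
  congr 2
  funext g
  exact map_gateD g

theorem tCount_append (C D : Circuit) :
    Circuit.tCount (C ++ D) = Circuit.tCount C + Circuit.tCount D := List.count_append ..

theorem invSqrtTwo_mul_self_add : invSqrtTwo * invSqrtTwo + invSqrtTwo * invSqrtTwo = 1 := by
  have h := sqrtTwo_mul_invSqrtTwo
  have h2 := sqrtTwo_mul_self (R := dyadic)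
  linear_combination (sqrtTwo * invSqrtTwo + 1) * h - invSqrtTwo * invSqrtTwo * h2

@[simp] theorem dag_invSqrtTwo : invSqrtTwo.dag = invSqrtTwo := by ext <;> simp [invSqrtTwo]

/-- The unitary matrices over `𝔻[ω]` whose determinant is a power of `ω`. -/
def IsSpecial (V : Matrix (Fin 2) (Fin 2) DOmega) : Prop :=
  Vᴴ * V = 1 ∧ ∃ j : ℕ, V.det = omega ^ j

theorem conjTranspose_gateD_mul (g : Gate) : (gateD g)ᴴ * gateD g = 1 := by
  have h := invSqrtTwo_mul_self_add
  have h1 := dag_omega_mul_omega (R := dyadic)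
  have h2 : (imag : DOmega).dag * imag = 1 := by ext <;> simp
  cases g <;> ext1 i j <;> fin_cases i <;> fin_cases j <;>
    simp [gateD, Matrix.mul_apply, Fin.sum_univ_two, star_eq_dag, h, h1, h2, dag_neg]

/-- The determinants are `ω⁴, ω², ω, ω²`: only `T` contributes an odd power, so the determinant of a
circuit remembers the parity of its `T`-count. -/
theorem det_gateD (g : Gate) : ∃ j : ℕ, j % 2 = Circuit.tCount [g] % 2 ∧
    (gateD g).det = omega ^ j := by
  have h := invSqrtTwo_mul_self_add
  cases g
  · refine ⟨4, by decide, ?_⟩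
    rw [omega_pow_four]
    simp [gateD, Matrix.det_fin_two]
    linear_combination -h
  · refine ⟨2, by decide, ?_⟩
    rw [omega_pow_two]
    simp [gateD, Matrix.det_fin_two]
  · refine ⟨1, by decide, ?_⟩
    simp [gateD, Matrix.det_fin_two]
  · refine ⟨2, by decide, ?_⟩
    simp [gateD, Matrix.det_fin_two, pow_two]

theorem det_evalD (C : Circuit) :
    ∃ j : ℕ, j % 2 = Circuit.tCount C % 2 ∧ (evalD C).det = omega ^ j := by
  induction C with
  | nil => exact ⟨0, by simp [Circuit.tCount], by simp⟩
  | cons g C ih =>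
    obtain ⟨j, hj, hd⟩ := ih
    obtain ⟨k, hk, hd'⟩ := det_gateD g
    refine ⟨k + j, ?_, by rw [evalD_cons, Matrix.det_mul, hd, hd', pow_add]⟩
    have : Circuit.tCount (g :: C) = Circuit.tCount [g] + Circuit.tCount C := tCount_append [g] C
    omega

theorem IsSpecial.mul {V W : Matrix (Fin 2) (Fin 2) DOmega} (hV : IsSpecial V)
    (hW : IsSpecial W) : IsSpecial (V * W) := by
  obtain ⟨h1, j, h2⟩ := hV
  obtain ⟨h3, k, h4⟩ := hW
  refine ⟨?_, j + k, by rw [Matrix.det_mul, h2, h4, pow_add]⟩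
  rw [Matrix.conjTranspose_mul, Matrix.mul_assoc, ← Matrix.mul_assoc Vᴴ, h1, Matrix.one_mul, h3]

theorem isSpecial_gateD (g : Gate) : IsSpecial (gateD g) :=
  ⟨conjTranspose_gateD_mul g, (det_gateD g).imp fun _ h => h.2⟩

theorem isSpecial_evalD (C : Circuit) : IsSpecial (evalD C) := by
  induction C with
  | nil => exact ⟨by simp, 0, by simp⟩
  | cons g C ih => rw [evalD_cons]; exact (isSpecial_gateD g).mul ih

/-! ### The lattice fixed by the Clifford group -/

/-- The basis `(1, 0)`, `(1, 1)/√2` of the lattice fixed by the Clifford group. -/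
def latticeBasis : Matrix (Fin 2) (Fin 2) DOmega := !![1, invSqrtTwo; 0, invSqrtTwo]

/-- The inverse of `latticeBasis`. -/
def latticeBasisInv : Matrix (Fin 2) (Fin 2) DOmega := !![1, -1; 0, sqrtTwo]

theorem latticeBasis_mul_inv : latticeBasis * latticeBasisInv = 1 := by
  have h := sqrtTwo_mul_invSqrtTwo
  rw [mul_comm] at h
  ext1 i j; fin_cases i <;> fin_cases j <;>
    simp [latticeBasis, latticeBasisInv, Matrix.mul_apply, Fin.sum_univ_two, h]

theorem latticeBasisInv_mul : latticeBasisInv * latticeBasis = 1 :=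
  mul_eq_one_comm.1 latticeBasis_mul_inv

/-- The matrix of an operator in the basis of the lattice fixed by the Clifford group. -/
def inLattice (V : Matrix (Fin 2) (Fin 2) DOmega) : Matrix (Fin 2) (Fin 2) DOmega :=
  latticeBasisInv * V * latticeBasis

theorem inLattice_mul (V W : Matrix (Fin 2) (Fin 2) DOmega) :
    inLattice (V * W) = inLattice V * inLattice W := by
  simp only [inLattice, Matrix.mul_assoc]
  rw [← Matrix.mul_assoc latticeBasis, latticeBasis_mul_inv, Matrix.one_mul]

theorem inLattice_one : inLattice 1 = 1 := by
  rw [inLattice, Matrix.mul_one, latticeBasisInv_mul]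

theorem latticeBasis_mul_inLattice (V : Matrix (Fin 2) (Fin 2) DOmega) :
    latticeBasis * inLattice V = V * latticeBasis := by
  rw [inLattice, ← Matrix.mul_assoc, ← Matrix.mul_assoc, latticeBasis_mul_inv, Matrix.one_mul]

theorem det_inLattice (V : Matrix (Fin 2) (Fin 2) DOmega) : (inLattice V).det = V.det := by
  have h := congrArg Matrix.det latticeBasisInv_mul
  rw [Matrix.det_mul, Matrix.det_one] at h
  rw [inLattice, Matrix.det_mul, Matrix.det_mul, mul_right_comm, h, one_mul]

/-- `δᵐ V` preserves the lattice fixed by the Clifford group. -/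
def HasLevel (m : ℕ) (V : Matrix (Fin 2) (Fin 2) DOmega) : Prop :=
  ∃ M : Matrix (Fin 2) (Fin 2) ZOmega, (delta : DOmega) ^ m • inLattice V = toDHom.mapMatrix M

theorem HasLevel.mul {m n : ℕ} {V W : Matrix (Fin 2) (Fin 2) DOmega} (hV : HasLevel m V)
    (hW : HasLevel n W) : HasLevel (m + n) (V * W) := by
  obtain ⟨M, hM⟩ := hV
  obtain ⟨N, hN⟩ := hW
  refine ⟨M * N, ?_⟩
  rw [inLattice_mul, map_mul, ← hM, ← hN, pow_add, Matrix.smul_mul, Matrix.mul_smul, smul_smul]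

/-- The entries of `inLattice V`. -/
theorem inLattice_eq (V : Matrix (Fin 2) (Fin 2) DOmega) :
    inLattice V = !![V 0 0 - V 1 0, (V 0 0 - V 1 0 + V 0 1 - V 1 1) * invSqrtTwo;
      sqrtTwo * V 1 0, V 1 0 + V 1 1] := by
  have h := sqrtTwo_mul_invSqrtTwo
  rw [inLattice, Matrix.eta_fin_two V]
  ext1 i j; fin_cases i <;> fin_cases j <;> simp [latticeBasis, latticeBasisInv]
  · ring
  · ring
  · linear_combination (V 1 0 + V 1 1) * h

theorem inLattice_H : inLattice (gateD .H) = toDHom.mapMatrix !![0, 1; 1, 0] := by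
  have h := sqrtTwo_mul_invSqrtTwo
  have h2 := invSqrtTwo_mul_self_add
  rw [inLattice_eq]
  ext1 i j; fin_cases i <;> fin_cases j <;> simp [gateD, h]
  linear_combination h2

theorem imag_sub_one : (imag : DOmega) - 1 = omega ^ 3 * sqrtTwo := by
  rw [show (omega : DOmega) ^ 3 = omega ^ 2 * omega by ring, omega_pow_two]
  ext <;> simp

theorem inLattice_S : inLattice (gateD .S) = toDHom.mapMatrix !![1, -omega ^ 3; 0, imag] := by
  have h := sqrtTwo_mul_invSqrtTwo
  have h2 := imag_sub_one
  rw [inLattice_eq]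
  ext1 i j; fin_cases i <;> fin_cases j <;> simp [gateD, toDHom_apply, toD_neg, toD_pow]
  linear_combination (-omega ^ 3) * h - invSqrtTwo * h2

theorem inLattice_T : (delta : DOmega) • inLattice (gateD .T)
    = toDHom.mapMatrix !![delta, -omega ^ 3; 0, delta * omega] := by
  have h := sqrtTwo_mul_invSqrtTwo
  have h2 : (delta : DOmega) * (1 - omega) = -omega ^ 3 * sqrtTwo := by
    rw [show (omega : DOmega) ^ 3 = omega ^ 2 * omega by ring, omega_pow_two]
    ext <;> simp
  rw [inLattice_eq]
  ext1 i j; fin_cases i <;> fin_cases j <;> simp [gateD, toDHom_apply, toD_neg, toD_pow, toD_mul]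
  linear_combination (-omega ^ 3) * h + invSqrtTwo * h2

theorem inLattice_omega : inLattice (gateD .omega) = toDHom.mapMatrix !![omega, 0; 0, omega] := by
  rw [inLattice_eq]
  ext1 i j; fin_cases i <;> fin_cases j <;> simp [gateD, toDHom_apply]

theorem hasLevel_gateD (g : Gate) : HasLevel (Circuit.tCount [g]) (gateD g) := by
  cases g
  · exact ⟨_, by rw [show Circuit.tCount [Gate.H] = 0 by decide, pow_zero, one_smul, inLattice_H]⟩
  · exact ⟨_, by rw [show Circuit.tCount [Gate.S] = 0 by decide, pow_zero, one_smul, inLattice_S]⟩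
  · exact ⟨_, by rw [show Circuit.tCount [Gate.T] = 1 by decide, pow_one, inLattice_T]⟩
  · exact ⟨_, by
      rw [show Circuit.tCount [Gate.omega] = 0 by decide, pow_zero, one_smul, inLattice_omega]⟩

theorem hasLevel_evalD (C : Circuit) : HasLevel (Circuit.tCount C) (evalD C) := by
  induction C with
  | nil => exact ⟨1, by simp [Circuit.tCount, inLattice_one]⟩
  | cons g C ih =>
    rw [evalD_cons, show Circuit.tCount (g :: C) = Circuit.tCount [g] + Circuit.tCount C from
      tCount_append [g] C]
    exact (hasLevel_gateD g).mul ih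

/-- The special unitary matrix with first column `u, t`. -/
def specialMatrix (u t : DOmega) : Matrix (Fin 2) (Fin 2) DOmega := !![u, -t.dag; t, u.dag]

/-- A circuit for the special unitary matrix with first column `u, t` has at least `2k - 2` gates
`T`, where `k` is the least denominator exponent of `u`. -/
theorem two_mul_leastDenominatorExponent_le {u t : DOmega} {C : Circuit}
    (h : evalD C = specialMatrix u t) (hdet : (specialMatrix u t).det = 1) :
    2 * leastDenominatorExponent u ≤ C.tCount + 2 := by
  obtain ⟨j, hj, hd⟩ := det_evalD C
  rw [h, hdet] at hd
  have hd' : (omega : ZOmega) ^ j = 1 := toD_injective (by rw [toD_pow, toD_omega, ← hd, toD_one])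
  have hpar := (omega_pow_parity j).1
  rw [hd'] at hpar
  simp at hpar
  -- Determinant one forces an even `T`-count, so `δ^(2k)` is `√2^k` times a unit; passing from the
  -- lattice basis back to `u` costs one more `√2`.
  obtain ⟨k, hk⟩ : ∃ k, C.tCount = 2 * k := ⟨C.tCount / 2, by omega⟩
  obtain ⟨M, hM⟩ := hasLevel_evalD C
  rw [h, inLattice_eq] at hM
  have h00 := congrFun (congrFun hM 0) 0
  have h10 := congrFun (congrFun hM 1) 0
  simp [specialMatrix, toDHom_apply] at h00 h10
  have hden : IsDenominatorExponent (k + 1) u := by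
    obtain ⟨e, he⟩ := (isUnit_deltaUnit (R := ℤ)).exists_left_inv
    have he' : (toD e) * deltaUnit = 1 := by
      rw [← toD_one, ← he, toD_mul]; congr 1
    refine ⟨e ^ k * (sqrtTwo * M 0 0 + M 1 0), ?_⟩
    rw [toD_mul, toD_add, toD_mul, toD_sqrtTwo, ← h00, ← h10, toD_pow, hk, pow_mul, delta_sq,
      mul_pow]
    have h1 : toD e ^ k * deltaUnit ^ k = 1 := by rw [← mul_pow, he', one_pow]
    linear_combination (-(sqrtTwo ^ (k + 1) * u)) * h1
  have := isDenominatorExponent_iff.1 hden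
  omega

/-! ### Exact synthesis with control of the `T`-count -/

theorem omega_pow_mod (k : ℕ) : (omega : DOmega) ^ k = omega ^ (k % 8) := by
  conv_lhs => rw [← Nat.div_add_mod k 8, pow_add, pow_mul, omega_pow_eight, one_pow, one_mul]

theorem evalD_replicate_omega (k : ℕ) :
    evalD (List.replicate k Gate.omega) = !![omega ^ k, 0; 0, omega ^ k] := by
  induction k with
  | zero => simp [Matrix.one_fin_two]
  | succ k ih =>
    rw [List.replicate_succ, evalD_cons, ih]
    simp [gateD, pow_succ']

theorem evalD_replicate_S (k : ℕ) :
    evalD (List.replicate k Gate.S) = !![1, 0; 0, omega ^ (2 * k)] := by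
  induction k with
  | zero => simp [Matrix.one_fin_two]
  | succ k ih =>
    rw [List.replicate_succ, evalD_cons, ih]
    have h : (imag : DOmega) * omega ^ (2 * k) = omega ^ (2 * (k + 1)) := by
      rw [← omega_pow_two]; ring
    simp [gateD, h]

theorem tCount_replicate_of_ne {g : Gate} (hg : g ≠ .T) (k : ℕ) :
    Circuit.tCount (List.replicate k g) = 0 := by
  simp [Circuit.tCount, List.count_replicate, hg]

/-- Peeling off an invertible circuit. -/
theorem exists_circuit_of_mul {V : Matrix (Fin 2) (Fin 2) DOmega} {m n : ℕ} (P P' : Circuit)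
    (hP : evalD P' * evalD P = 1) (hn : Circuit.tCount P' + n ≤ m)
    (h : ∃ C, evalD C = evalD P * V ∧ Circuit.tCount C ≤ n) :
    ∃ C, evalD C = V ∧ Circuit.tCount C ≤ m := by
  obtain ⟨C, hC, hc⟩ := h
  refine ⟨P' ++ C, ?_, ?_⟩
  · rw [evalD_append, hC, ← Matrix.mul_assoc, hP, Matrix.one_mul]
  · rw [tCount_append]; omega

theorem evalD_replicate_omega_mul (k : ℕ) :
    evalD (List.replicate k Gate.omega) * evalD (List.replicate (7 * k) Gate.omega) = 1 := by
  rw [evalD_replicate_omega, evalD_replicate_omega, Matrix.one_fin_two]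
  have : (omega : DOmega) ^ k * omega ^ (7 * k) = 1 := by
    rw [← pow_add, show k + 7 * k = 8 * k by ring, pow_mul, omega_pow_eight, one_pow]
  simp [this]

theorem evalD_replicate_S_mul (k : ℕ) :
    evalD (List.replicate (3 * k) Gate.S) * evalD (List.replicate k Gate.S) = 1 := by
  rw [evalD_replicate_S, evalD_replicate_S, Matrix.one_fin_two]
  have : (omega : DOmega) ^ (2 * (3 * k)) * omega ^ (2 * k) = 1 := by
    rw [← pow_add, show 2 * (3 * k) + 2 * k = 8 * k by ring, pow_mul, omega_pow_eight, one_pow]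
  simp [this]

theorem gateD_H_mul_self : gateD .H * gateD .H = 1 := by
  have h := invSqrtTwo_mul_self_add
  rw [Matrix.one_fin_two]
  simp [gateD, h]

theorem evalD_H_mul_self : evalD [.H] * evalD [.H] = 1 := by
  simp [evalD, gateD_H_mul_self]

theorem hasLevel_zero_evalD_mul {P : Circuit} (hP : Circuit.tCount P = 0) {m : ℕ}
    {V : Matrix (Fin 2) (Fin 2) DOmega} (hV : HasLevel m V) : HasLevel m (evalD P * V) := by
  have := (hasLevel_evalD P).mul hV
  rwa [hP, zero_add] at this

/-- A special matrix of level zero that fixes the first basis vector is a power of `S`. -/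
theorem exists_circuit_of_fixes {V : Matrix (Fin 2) (Fin 2) DOmega} (hV : IsSpecial V)
    (hl : HasLevel 0 V) (h0 : V 0 0 = 1) (h1 : V 1 0 = 0) :
    ∃ C, evalD C = V ∧ Circuit.tCount C ≤ 0 := by
  obtain ⟨hu, j, hj⟩ := hV
  have hx : V 0 1 = 0 := by
    have := congrFun (congrFun hu 0) 1
    simpa [Matrix.mul_apply, Fin.sum_univ_two, h0, h1] using this
  have hy : V 1 1 = omega ^ j := by
    rw [← hj, Matrix.det_fin_two, h0, h1]; ring
  obtain ⟨M, hM⟩ := hl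
  rw [pow_zero, one_smul, inLattice_eq] at hM
  have h01 := congrFun (congrFun hM 0) 1
  simp [toDHom_apply, h0, h1, hx, hy] at h01
  -- In the lattice basis the operator `diag(1, ω^j)` has upper right entry `(1 - ω^j)/√2`; its
  -- integrality forces `j` to be even.
  have h2 : sqrtTwo * M 0 1 = 1 - omega ^ j := by
    apply toD_injective
    rw [toD_mul, ← h01, toD_sqrtTwo, toD_sub, toD_one, toD_pow, toD_omega]
    linear_combination (1 - omega ^ j) * sqrtTwo_mul_invSqrtTwo
  have h3 := (sqrtTwo_dvd_iff.1 ⟨_, h2.symm⟩).1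
  have h4 := (omega_pow_parity j).1
  simp at h3
  obtain ⟨k, rfl⟩ : ∃ k, j = 2 * k := ⟨j / 2, by omega⟩
  refine ⟨List.replicate k .S, ?_, by rw [tCount_replicate_of_ne (by decide)]⟩
  rw [evalD_replicate_S, Matrix.eta_fin_two V, h0, h1, hx, hy]

theorem exists_circuit_of_lower_left_eq_zero {V : Matrix (Fin 2) (Fin 2) DOmega}
    (hV : IsSpecial V) (hl : HasLevel 0 V) {k : ℕ} (h0 : V 0 0 = omega ^ k) (h1 : V 1 0 = 0) :
    ∃ C, evalD C = V ∧ Circuit.tCount C ≤ 0 := by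
  refine exists_circuit_of_mul (n := 0) (List.replicate (7 * k) .omega) (List.replicate k .omega)
    (evalD_replicate_omega_mul k) (by rw [tCount_replicate_of_ne (by decide)])
    (exists_circuit_of_fixes ((isSpecial_evalD _).mul hV)
      (hasLevel_zero_evalD_mul (tCount_replicate_of_ne (by decide) _) hl) ?_ ?_)
  · rw [evalD_replicate_omega, Matrix.mul_apply, Fin.sum_univ_two, h0, h1]
    simp only [Matrix.of_apply, Matrix.cons_val_zero, mul_zero, add_zero]
    rw [← pow_add, show 7 * k + k = 8 * k by ring, pow_mul, omega_pow_eight, one_pow]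
  · rw [evalD_replicate_omega, Matrix.mul_apply, Fin.sum_univ_two, h1]
    simp

/-- Unitarity in the lattice basis: the image of each basis vector, itself of norm one, keeps its
length. The factor 2 clears the `√2` in the denominators of the second basis vector. -/
theorem IsSpecial.column {V : Matrix (Fin 2) (Fin 2) DOmega} (hV : IsSpecial V) {m : ℕ}
    {M : Matrix (Fin 2) (Fin 2) ZOmega}
    (hM : (delta : DOmega) ^ m • inLattice V = toDHom.mapMatrix M) (c : Fin 2) :
    (sqrtTwo * M 0 c + M 1 c).dag * (sqrtTwo * M 0 c + M 1 c) + (M 1 c).dag * M 1 c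
      = 2 * (delta.dag * delta) ^ m := by
  set W := inLattice V
  have h1 : (latticeBasis * W)ᴴ * (latticeBasis * W) = latticeBasisᴴ * latticeBasis := by
    rw [latticeBasis_mul_inLattice, Matrix.conjTranspose_mul, Matrix.mul_assoc,
      ← Matrix.mul_assoc Vᴴ, hV.1, Matrix.one_mul]
  have h2 := congrFun (congrFun h1 c) c
  have h3 : (latticeBasisᴴ * latticeBasis) c c = 1 := by
    have h := invSqrtTwo_mul_self_add
    fin_cases c <;> simp [latticeBasis, Matrix.mul_apply, Fin.sum_univ_two, star_eq_dag, h]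
  rw [h3] at h2
  simp only [Matrix.mul_apply, Fin.sum_univ_two, Matrix.conjTranspose_apply, star_eq_dag] at h2
  simp [latticeBasis, dag_add, dag_mul] at h2
  have h4 : ∀ i, (M i c).toD = delta ^ m * W i c := fun i => (congrFun (congrFun hM i) c).symm
  apply toD_injective
  have hs := sqrtTwo_mul_invSqrtTwo
  have hs2 := sqrtTwo_mul_self (R := dyadic)
  have e1 : (sqrtTwo : DOmega) * (delta ^ m * W 0 c) + delta ^ m * W 1 c
      = delta ^ m * sqrtTwo * (W 0 c + invSqrtTwo * W 1 c) := by
    linear_combination (-(delta ^ m * W 1 c)) * hs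
  have e2 : delta ^ m * W 1 c = delta ^ m * sqrtTwo * (invSqrtTwo * W 1 c) := by
    linear_combination (-(delta ^ m * W 1 c)) * hs
  simp only [toD_add, toD_mul, toD_dag, toD_sqrtTwo, h4, toD_pow, toD_delta]
  rw [e1, e2, show toD 2 = 2 from map_ofNat toDHom 2, ← hs2]
  simp only [dag_mul, dag_pow, dag_add, dag_sqrtTwo, dag_invSqrtTwo]
  rw [mul_pow]
  linear_combination (sqrtTwo * sqrtTwo * (delta.dag ^ m * delta ^ m)) * h2

/-- The special matrices of level zero are Clifford operators. -/
theorem exists_circuit_of_level_zero {V : Matrix (Fin 2) (Fin 2) DOmega} (hV : IsSpecial V)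
    (hl : HasLevel 0 V) : ∃ C, evalD C = V ∧ Circuit.tCount C ≤ 0 := by
  have hl' := hl
  obtain ⟨M, hM⟩ := hl
  have hcol := hV.column hM 0
  rw [pow_zero, one_smul] at hM
  set p := M 0 0
  set r := M 1 0
  have hs := sqrtTwo_mul_invSqrtTwo
  have hs2 := sqrtTwo_mul_self (R := dyadic)
  have hV0 : V 0 0 = p.toD + invSqrtTwo * r.toD ∧ V 1 0 = invSqrtTwo * r.toD := by
    rw [inLattice_eq] at hM
    have h00 := congrFun (congrFun hM 0) 0
    have h10 := congrFun (congrFun hM 1) 0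
    simp [toDHom_apply] at h00 h10
    have e : V 1 0 = invSqrtTwo * r.toD := by
      rw [← h10]; linear_combination (-V 1 0) * hs
    exact ⟨by rw [← h00, ← e]; ring, e⟩
  obtain ⟨hV00, hV10⟩ := hV0
  set a := sqrtTwo * p + r with ha
  have hd := congrArg Cyc.d hcol
  rw [pow_zero, mul_one, add_d, dag_mul_self_d, dag_mul_self_d, two_d] at hd
  have hna : 0 ≤ a.a ^ 2 + a.b ^ 2 + a.c ^ 2 + a.d ^ 2 := by positivity
  have hnr : 0 ≤ r.a ^ 2 + r.b ^ 2 + r.c ^ 2 + r.d ^ 2 := by positivity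
  have norm_p : a = 0 ∨ r = 0 → ∃ k, p = omega ^ k := by
    intro h
    apply exists_eq_omega_pow
    have h2 : (2 : ZOmega) * (p.dag * p) = 2 := by
      have hs2' := sqrtTwo_mul_self (R := ℤ)
      rw [pow_zero, mul_one] at hcol
      rcases h with h | h
      · have hr : r = -(sqrtTwo * p) := by linear_combination h - ha
        rw [h, hr, dag_neg, dag_mul, dag_sqrtTwo, dag_zero] at hcol
        linear_combination hcol - p.dag * p * hs2'
      · rw [ha, h, add_zero, dag_mul, dag_sqrtTwo, dag_zero] at hcol
        linear_combination hcol - p.dag * p * hs2'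
    have h3 : p.dag * p = 1 :=
      mul_left_cancel₀ (fun h => by simpa using congrArg Cyc.d h) (h2.trans (mul_one 2).symm)
    rw [← dag_mul_self_d, h3, one_d]
  -- The first column of `√2 V` is `(a, r)`, with total squared coefficients 2. Either one entry
  -- vanishes and `V` is diagonal or antidiagonal, or both are powers of `ω`.
  have hcases : r.a ^ 2 + r.b ^ 2 + r.c ^ 2 + r.d ^ 2 = 0 ∨
      a.a ^ 2 + a.b ^ 2 + a.c ^ 2 + a.d ^ 2 = 0 ∨
      (a.a ^ 2 + a.b ^ 2 + a.c ^ 2 + a.d ^ 2 = 1 ∧ r.a ^ 2 + r.b ^ 2 + r.c ^ 2 + r.d ^ 2 = 1) := by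
    omega
  rcases hcases with h | h | ⟨h, h'⟩
  · have hr := eq_zero_of_sum_sq h
    obtain ⟨k, hk⟩ := norm_p (.inr hr)
    rw [hr, toD_zero, mul_zero] at hV00 hV10
    exact exists_circuit_of_lower_left_eq_zero hV hl' (k := k)
      (by rw [hV00, hk, toD_pow, toD_omega, add_zero]) hV10
  · have ha0 := eq_zero_of_sum_sq h
    obtain ⟨k, hk⟩ := norm_p (.inl ha0)
    have hr : r = -(sqrtTwo * p) := by linear_combination ha0 - ha
    have hV00' : V 0 0 = 0 := by
      rw [hV00, hr, toD_neg, toD_mul, toD_sqrtTwo]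
      linear_combination (-p.toD) * hs
    have hV10' : V 1 0 = omega ^ (k + 4) := by
      rw [hV10, hr, toD_neg, toD_mul, toD_sqrtTwo, hk, pow_add, omega_pow_four, toD_pow, toD_omega]
      linear_combination (-omega ^ k) * hs
    have hX : evalD [.H, .S, .S, .H] = !![0, 1; 1, 0] := by
      have h := invSqrtTwo_mul_self_add
      have hi := imag_mul_self (R := dyadic)
      have hi' : (imag * (imag * invSqrtTwo) : DOmega) = -invSqrtTwo := by
        linear_combination invSqrtTwo * hi
      simp [evalD, gateD, hi', h]
    refine exists_circuit_of_mul (n := 0) [.H, .S, .S, .H] [.H, .S, .S, .H]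
      (by rw [hX, Matrix.one_fin_two]; simp) (by decide)
      (exists_circuit_of_lower_left_eq_zero ((isSpecial_evalD _).mul hV)
        (hasLevel_zero_evalD_mul (by decide) hl') (k := k + 4) ?_ ?_)
    · rw [hX, Matrix.mul_apply, Fin.sum_univ_two]; simp [hV10']
    · rw [hX, Matrix.mul_apply, Fin.sum_univ_two]; simp [hV00']
  · obtain ⟨i, hi⟩ := exists_eq_omega_pow h
    obtain ⟨j, hj⟩ := exists_eq_omega_pow h'
    have h1 := sqrtTwo_dvd_iff.1 (⟨p, by rw [ha]; ring⟩ : sqrtTwo ∣ a - r)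
    have h2 := (omega_pow_parity i).1
    have h3 := (omega_pow_parity j).1
    rw [hi, hj] at h1
    simp only [sub_a, sub_c] at h1
    -- The congruence `a ≡ r` modulo `√2` makes `i - j` even, and `7j` stands for `-j` modulo 8.
    -- Then `S^n` equalizes the two entries and `H` sends the column to a multiple of the first
    -- basis vector.
    obtain ⟨n, hn⟩ : ∃ n, i + 7 * j = 2 * n := ⟨(i + 7 * j) / 2, by omega⟩
    have hV00' : V 0 0 = invSqrtTwo * omega ^ i := by
      have : (omega : DOmega) ^ i = sqrtTwo * p.toD + r.toD := by
        rw [← toD_omega, ← toD_pow, ← hi, ha, toD_add, toD_mul, toD_sqrtTwo]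
      rw [hV00, this]
      linear_combination (-p.toD) * hs
    have hV10' : omega ^ (2 * n) * V 1 0 = invSqrtTwo * omega ^ i := by
      have : (omega : DOmega) ^ (2 * n) * omega ^ j = omega ^ i := by
        rw [← pow_add, ← hn, show i + 7 * j + j = i + 8 * j by ring, pow_add, pow_mul,
          omega_pow_eight, one_pow, mul_one]
      rw [hV10, hj, toD_pow, toD_omega, ← this]
      ring
    have hP : evalD (.H :: List.replicate n .S) =
        !![invSqrtTwo, invSqrtTwo * omega ^ (2 * n);
          invSqrtTwo, -invSqrtTwo * omega ^ (2 * n)] := by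
      rw [evalD_cons, evalD_replicate_S]
      simp [gateD]
    have hT : Circuit.tCount (.H :: List.replicate n .S) = 0 := by
      rw [show Gate.H :: List.replicate n .S = [.H] ++ List.replicate n .S from rfl, tCount_append,
        tCount_replicate_of_ne (by decide)]
      decide
    refine exists_circuit_of_mul (n := 0) (.H :: List.replicate n .S)
      (List.replicate (3 * n) .S ++ [.H]) ?_ ?_
      (exists_circuit_of_lower_left_eq_zero ((isSpecial_evalD _).mul hV)
        (hasLevel_zero_evalD_mul hT hl') (k := i) ?_ ?_)
    · rw [evalD_append, evalD_cons .H (List.replicate n .S), Matrix.mul_assoc,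
        ← Matrix.mul_assoc (evalD [.H]),
        show evalD [.H] * gateD .H = 1 by simp [evalD, gateD_H_mul_self], Matrix.one_mul,
        evalD_replicate_S_mul]
    · rw [tCount_append, tCount_replicate_of_ne (by decide)]; decide
    · rw [hP, Matrix.mul_apply, Fin.sum_univ_two]
      simp only [Matrix.of_apply, Matrix.cons_val_zero, Matrix.cons_val_one]
      linear_combination invSqrtTwo * hV00' + invSqrtTwo * hV10'
        + omega ^ i * invSqrtTwo_mul_self_add
    · rw [hP, Matrix.mul_apply, Fin.sum_univ_two]
      simp only [Matrix.of_apply, Matrix.cons_val_zero, Matrix.cons_val_one]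
      linear_combination invSqrtTwo * hV00' - invSqrtTwo * hV10'

theorem evalD_T_inverse : evalD [.T] * evalD [.S, .S, .S, .T] = 1 := by
  have h : (omega : DOmega) * (imag * (imag * (imag * omega))) = 1 := by
    rw [← omega_pow_eight, ← omega_pow_two]; ring
  rw [Matrix.one_fin_two]
  simp [evalD, gateD, h]

theorem inLattice_T_inverse : (delta : DOmega) • inLattice (evalD [.S, .S, .S, .T])
    = toDHom.mapMatrix !![delta, imag; 0, -delta * omega ^ 3] := by
  have h := sqrtTwo_mul_invSqrtTwo
  have hE : evalD [.S, .S, .S, .T] = !![1, 0; 0, -omega ^ 3] := by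
    have : (imag * (imag * (imag * omega)) : DOmega) = -omega ^ 3 := by
      rw [← omega_pow_two]; linear_combination (omega ^ 3) * omega_pow_four (R := dyadic)
    simp [evalD, gateD, this]
  have h2 : (delta : DOmega) * (1 + omega ^ 3) = imag * sqrtTwo := by
    rw [show (omega : DOmega) ^ 3 = omega ^ 2 * omega by ring, omega_pow_two]
    ext <;> simp
  rw [inLattice_eq, hE]
  ext1 i j; fin_cases i <;> fin_cases j <;> simp [toDHom_apply, toD_neg, toD_mul, toD_pow]
  linear_combination invSqrtTwo * h2 + imag * h

/-- The first two equations will come from unitarity of the columns, the third from the determinant.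
A nonzero `p` forces `r = p`, and then the determinant forces `s = q`; likewise with the columns
exchanged. -/
theorem parity_of_columns : ∀ p q r s : ZMod 2, p * p + p * r = 0 → q * q + q * s = 0 →
    p * s - q * r = 0 → ¬(p = 0 ∧ q = 0) → p + r = 0 ∧ q + s = 0 := by
  decide

/-- The columns of `M`, when the second row is divisible by `δ`. -/
theorem par_column {p r : ZOmega} {m : ℕ}
    (h : (sqrtTwo * p + delta * r).dag * (sqrtTwo * p + delta * r)
      + (delta * r).dag * (delta * r) = 2 * (delta.dag * delta) ^ (m + 1)) :
    par p * par p + par p * par r = 0 := by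
  have h2 := sqrtTwo_mul_self (R := ℤ)
  have ht := sqrtTwo_mul_halfTrace (p.dag * r * delta)
  simp only [dag_mul, dag_dag] at ht
  -- This is the norm equation divided by 2. The cross term is a trace over `√2`, and modulo `δ` it
  -- survives as `p r`, while the other multiples of `δ` disappear.
  have key : p.dag * p + delta.dag * delta * (r.dag * r) + halfTrace (p.dag * r * delta)
      = (delta.dag * delta) ^ (m + 1) := by
    apply mul_left_cancel₀ sqrtTwo_ne_zero
    apply mul_left_cancel₀ sqrtTwo_ne_zero
    simp only [dag_add, dag_mul, dag_sqrtTwo] at h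
    linear_combination h + sqrtTwo * ht
      + (delta.dag * delta * (r.dag * r) - (delta.dag * delta) ^ (m + 1)) * h2
  have h3 := congrArg par key
  simp only [map_add, map_mul, map_pow, par_dag, par_delta, par_halfTrace_mul_delta] at h3
  simpa using h3

/-- Multiplying by `δ T⁻¹` turns the rows `(p, q)` and `δ(r, s)` into `δ(p + ir, q + is)` and
`-δ²ω³(r, s)`. Unitarity and the determinant make `p + ir` and `q + is` divisible by `δ`, so a
factor `δ²` splits off where only one `δ` was spent: the level drops by one. -/
theorem HasLevel.step {V : Matrix (Fin 2) (Fin 2) DOmega} (hV : IsSpecial V) {m : ℕ}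
    {M : Matrix (Fin 2) (Fin 2) ZOmega}
    (hM : (delta : DOmega) ^ (m + 1) • inLattice V = toDHom.mapMatrix M)
    (h10 : par (M 1 0) = 0) (h11 : par (M 1 1) = 0) (h0 : ¬(par (M 0 0) = 0 ∧ par (M 0 1) = 0)) :
    HasLevel m (evalD [.S, .S, .S, .T] * V) := by
  obtain ⟨r, hr⟩ := par_eq_zero_iff_dvd.1 h10
  obtain ⟨s, hs⟩ := par_eq_zero_iff_dvd.1 h11
  have hc0 := hV.column hM 0
  have hc1 := hV.column hM 1
  rw [hr] at hc0
  rw [hs] at hc1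
  obtain ⟨-, j, hj⟩ := hV
  have hdet : M 0 0 * s - M 0 1 * r = delta ^ (2 * m + 1) * omega ^ j := by
    apply mul_left_cancel₀ delta_ne_zero
    have h1 := congrArg Matrix.det hM
    rw [Matrix.det_smul, det_inLattice, hj, ← RingHom.map_det, Matrix.det_fin_two, hr, hs] at h1
    simp only [Fintype.card_fin] at h1
    apply toD_injective
    rw [show delta * (M 0 0 * s - M 0 1 * r) = M 0 0 * (delta * s) - M 0 1 * (delta * r) by ring,
      ← toDHom_apply, ← h1]
    simp only [toD_mul, toD_pow, toD_delta, toD_omega]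
    ring
  have hpd := congrArg par hdet
  simp only [map_sub, map_mul, map_pow, par_delta] at hpd
  obtain ⟨h2, h3⟩ := parity_of_columns _ _ _ _ (par_column hc0) (par_column hc1)
    (by simpa using hpd) h0
  obtain ⟨x, hx⟩ := par_eq_zero_iff_dvd.1
    (show par (M 0 0 + imag * r) = 0 by rw [map_add, map_mul, par_imag, one_mul, h2])
  obtain ⟨y, hy⟩ := par_eq_zero_iff_dvd.1
    (show par (M 0 1 + imag * s) = 0 by rw [map_add, map_mul, par_imag, one_mul, h3])
  refine ⟨!![x, y; -omega ^ 3 * r, -omega ^ 3 * s], ?_⟩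
  have h4 : !![delta, imag; 0, -delta * omega ^ 3] * M
      = (delta * delta : ZOmega) • !![x, y; -omega ^ 3 * r, -omega ^ 3 * s] := by
    rw [Matrix.eta_fin_two M, hr, hs, Matrix.mul_fin_two,
      show delta * M 0 0 + imag * (delta * r) = delta * delta * x by
        linear_combination delta * hx,
      show delta * M 0 1 + imag * (delta * s) = delta * delta * y by
        linear_combination delta * hy]
    ext1 i j; fin_cases i <;> fin_cases j <;> simp <;> ring
  have h6 : (delta * delta : DOmega) • toDHom.mapMatrix !![x, y; -omega ^ 3 * r, -omega ^ 3 * s]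
      = toDHom.mapMatrix (!![delta, imag; 0, -delta * omega ^ 3] * M) := by
    rw [h4]
    ext1 i j; fin_cases i <;> fin_cases j <;> simp [toDHom_apply, toD_mul, toD_neg]
  have h5 : (delta * delta : DOmega) • ((delta : DOmega) ^ m
      • inLattice (evalD [.S, .S, .S, .T] * V))
      = (delta * delta : DOmega) • toDHom.mapMatrix !![x, y; -omega ^ 3 * r, -omega ^ 3 * s] := by
    rw [h6, map_mul, ← inLattice_T_inverse, ← hM, inLattice_mul, smul_smul, Matrix.smul_mul,
      Matrix.mul_smul, smul_smul]
    congr 1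
    ring
  exact (isUnit_delta.mul isUnit_delta).smul_left_cancel.1 h5

/-- The induction step of exact synthesis, when the second row is divisible by `δ`. -/
theorem exists_circuit_of_second_row {m : ℕ}
    (ih : ∀ V, IsSpecial V → HasLevel m V → ∃ C, evalD C = V ∧ Circuit.tCount C ≤ m)
    {V : Matrix (Fin 2) (Fin 2) DOmega} (hV : IsSpecial V)
    {M : Matrix (Fin 2) (Fin 2) ZOmega}
    (hM : (delta : DOmega) ^ (m + 1) • inLattice V = toDHom.mapMatrix M)
    (h10 : par (M 1 0) = 0) (h11 : par (M 1 1) = 0) :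
    ∃ C, evalD C = V ∧ Circuit.tCount C ≤ m + 1 := by
  by_cases h0 : par (M 0 0) = 0 ∧ par (M 0 1) = 0
  · have hdvd : ∀ i j, ∃ x, M i j = delta * x := by
      intro i j
      apply par_eq_zero_iff_dvd.1
      fin_cases i <;> fin_cases j
      exacts [h0.1, h0.2, h10, h11]
    choose N hN using hdvd
    obtain ⟨C, hC, hc⟩ := ih V hV ⟨Matrix.of N, by
      apply isUnit_delta.smul_left_cancel.1
      rw [smul_smul, ← pow_succ', hM]
      ext1 i j
      simp [hN, toDHom_apply, toD_mul]⟩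
    exact ⟨C, hC, by omega⟩
  · refine exists_circuit_of_mul (n := m) [.S, .S, .S, .T] [.T] evalD_T_inverse
      (by rw [show Circuit.tCount [Gate.T] = 1 by decide]; omega)
      (ih _ ((isSpecial_evalD _).mul hV) (HasLevel.step hV hM h10 h11 h0))

/-- A singular matrix over `𝔽₂` has one of the three nonzero linear relations between its rows.
Modulo `δ`, `H` swaps the rows and `S` adds the second to the first, so Clifford gates reduce every
relation to the vanishing of the second row. -/
theorem row_relation : ∀ p q r s : ZMod 2, p * s - q * r = 0 →
    (r = 0 ∧ s = 0) ∨ (p = 0 ∧ q = 0) ∨ (p + r = 0 ∧ q + s = 0) := by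
  decide

theorem exists_circuit_of_first_row {m : ℕ}
    (ih : ∀ V, IsSpecial V → HasLevel m V → ∃ C, evalD C = V ∧ Circuit.tCount C ≤ m)
    {V : Matrix (Fin 2) (Fin 2) DOmega} (hV : IsSpecial V)
    {M : Matrix (Fin 2) (Fin 2) ZOmega}
    (hM : (delta : DOmega) ^ (m + 1) • inLattice V = toDHom.mapMatrix M)
    (h0 : par (M 0 0) = 0) (h1 : par (M 0 1) = 0) :
    ∃ C, evalD C = V ∧ Circuit.tCount C ≤ m + 1 := by
  have hM' : (delta : DOmega) ^ (m + 1) • inLattice (evalD [.H] * V)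
      = toDHom.mapMatrix (!![0, 1; 1, 0] * M) := by
    rw [inLattice_mul, show evalD [.H] = gateD .H by simp [evalD], inLattice_H, map_mul, ← hM,
      Matrix.mul_smul]
  have hT : Circuit.tCount [Gate.H] = 0 := by decide
  refine exists_circuit_of_mul (n := m + 1) [.H] [.H] evalD_H_mul_self (by omega)
    (exists_circuit_of_second_row ih ((isSpecial_evalD _).mul hV) hM' ?_ ?_)
  · simp [Matrix.mul_apply, Fin.sum_univ_two, h0]
  · simp [Matrix.mul_apply, Fin.sum_univ_two, h1]

theorem exists_circuit_of_equal_rows {m : ℕ}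
    (ih : ∀ V, IsSpecial V → HasLevel m V → ∃ C, evalD C = V ∧ Circuit.tCount C ≤ m)
    {V : Matrix (Fin 2) (Fin 2) DOmega} (hV : IsSpecial V)
    {M : Matrix (Fin 2) (Fin 2) ZOmega}
    (hM : (delta : DOmega) ^ (m + 1) • inLattice V = toDHom.mapMatrix M)
    (h0 : par (M 0 0) + par (M 1 0) = 0) (h1 : par (M 0 1) + par (M 1 1) = 0) :
    ∃ C, evalD C = V ∧ Circuit.tCount C ≤ m + 1 := by
  have hM' : (delta : DOmega) ^ (m + 1) • inLattice (evalD (List.replicate 1 .S) * V)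
      = toDHom.mapMatrix (!![1, -omega ^ 3; 0, imag] * M) := by
    rw [inLattice_mul, show evalD (List.replicate 1 .S) = gateD .S by simp [evalD], inLattice_S, map_mul,
      ← hM,
      Matrix.mul_smul]
  have hT : Circuit.tCount (List.replicate (3 * 1) Gate.S) = 0 :=
    tCount_replicate_of_ne (by decide) _
  refine exists_circuit_of_mul (n := m + 1) (List.replicate 1 .S) (List.replicate (3 * 1) .S)
    (evalD_replicate_S_mul 1) (by omega)
    (exists_circuit_of_first_row ih ((isSpecial_evalD _).mul hV) hM' ?_ ?_)
  · simp only [Matrix.mul_apply, Fin.sum_univ_two]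
    simpa [CharTwo.neg_eq] using h0
  · simp only [Matrix.mul_apply, Fin.sum_univ_two]
    simpa [CharTwo.neg_eq] using h1

/-- Exact synthesis: a special matrix of level `m` is implemented by a circuit with at most `m`
gates `T`. -/
theorem exists_circuit_of_level (m : ℕ) : ∀ V, IsSpecial V → HasLevel m V →
    ∃ C, evalD C = V ∧ Circuit.tCount C ≤ m := by
  induction m with
  | zero => exact fun V hV hl => exists_circuit_of_level_zero hV hl
  | succ m ih =>
    intro V hV ⟨M, hM⟩
    obtain ⟨j, hj⟩ := hV.2
    have hdet : M 0 0 * M 1 1 - M 0 1 * M 1 0 = delta ^ (2 * m + 2) * omega ^ j := by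
      have h1 := congrArg Matrix.det hM
      rw [Matrix.det_smul, det_inLattice, hj, ← RingHom.map_det, Matrix.det_fin_two] at h1
      simp only [Fintype.card_fin] at h1
      apply toD_injective
      rw [← toDHom_apply, ← h1]
      simp only [toD_mul, toD_pow, toD_delta, toD_omega]
      ring
    have hpd := congrArg par hdet
    simp only [map_sub, map_mul, map_pow, par_delta] at hpd
    have hpd' : par (M 0 0) * par (M 1 1) - par (M 0 1) * par (M 1 0) = 0 := by
      rw [hpd, zero_pow (by omega), zero_mul]
    rcases row_relation _ _ _ _ hpd' with ⟨h1, h2⟩ | ⟨h1, h2⟩ | ⟨h1, h2⟩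
    · exact exists_circuit_of_second_row ih hV hM h1 h2
    · exact exists_circuit_of_first_row ih hV hM h1 h2
    · exact exists_circuit_of_equal_rows ih hV hM h1 h2

/-! ### Special unitary matrices -/

theorem isSpecial_specialMatrix {u t : DOmega} (h : u.dag * u + t.dag * t = 1) :
    IsSpecial (specialMatrix u t) := by
  refine ⟨?_, 0, ?_⟩
  · ext1 i j; fin_cases i <;> fin_cases j <;>
      simp [specialMatrix, Matrix.mul_apply, Fin.sum_univ_two, star_eq_dag, h, dag_neg]
    · ring
    · ring
    · linear_combination h
  · rw [specialMatrix, Matrix.det_fin_two_of, pow_zero]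
    linear_combination h

/-- In the lattice basis, `√2^K` times the matrix has entries built from `(u₀ - t₀)/√2`, its
conjugate, `t₀` and traces over `√2`. Since `√2` always divides `z - z†` and `z + z†`, the single
congruence makes all of them integral; finally `√2^K` is `δ^(2K)` up to a unit. -/
theorem hasLevel_specialMatrix {u t : DOmega} {K : ℕ} {u₀ t₀ : ZOmega}
    (hu : sqrtTwo ^ (K + 1) * u = u₀.toD) (ht : sqrtTwo ^ (K + 1) * t = t₀.toD)
    (h : sqrtTwo ∣ u₀ - t₀) : HasLevel (2 * K) (specialMatrix u t) := by
  obtain ⟨x, hx⟩ := h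
  obtain ⟨y, hy⟩ := sqrtTwo_dvd_sub_dag x
  have hs := sqrtTwo_mul_invSqrtTwo
  have hud : sqrtTwo ^ (K + 1) * u.dag = u₀.toD.dag := by
    rw [← hu, dag_mul, dag_pow, dag_sqrtTwo]
  have htd : sqrtTwo ^ (K + 1) * t.dag = t₀.toD.dag := by
    rw [← ht, dag_mul, dag_pow, dag_sqrtTwo]
  have hx' : u₀.toD - t₀.toD = sqrtTwo * x.toD := by
    rw [← toD_sub, hx, toD_mul, toD_sqrtTwo]
  have hxd : u₀.toD.dag - t₀.toD.dag = sqrtTwo * x.toD.dag := by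
    rw [← dag_sub, hx', dag_mul, dag_sqrtTwo]
  have hy' : x.toD - x.toD.dag = sqrtTwo * y.toD := by
    rw [← toD_dag, ← toD_sub, hy, toD_mul, toD_sqrtTwo]
  have htr : sqrtTwo * (halfTrace t₀).toD = t₀.toD + t₀.toD.dag := by
    rw [← toD_dag, ← toD_add, ← sqrtTwo_mul_halfTrace, toD_mul, toD_sqrtTwo]
  have h1 : (sqrtTwo : DOmega) ^ K • inLattice (specialMatrix u t)
      = toDHom.mapMatrix !![x, y - t₀.dag; t₀, halfTrace t₀ + x.dag] := by
    rw [inLattice_eq]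
    ext1 i j
    apply isUnit_sqrtTwo.mul_left_cancel
    fin_cases i <;> fin_cases j <;>
      simp [specialMatrix, toDHom_apply, toD_sub, toD_add, toD_dag]
    · linear_combination hu - ht + hx'
    · apply isUnit_sqrtTwo.mul_left_cancel
      linear_combination (sqrtTwo ^ (K + 1) * (u - t - t.dag - u.dag)) * hs
        + hu - ht - hud - htd + hx' - hxd + sqrtTwo * hy'
        + t₀.toD.dag * sqrtTwo_mul_self (R := dyadic)
    · linear_combination sqrtTwo * ht
    · linear_combination ht + hud + hxd - htr
  refine ⟨(deltaUnit : ZOmega) ^ K • !![x, y - t₀.dag; t₀, halfTrace t₀ + x.dag], ?_⟩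
  rw [pow_mul, delta_sq, mul_pow, mul_comm, ← smul_smul, h1]
  have h2 : (deltaUnit : ZOmega).toD = deltaUnit := by ext <;> simp [deltaUnit]
  ext1 i j
  fin_cases i <;> fin_cases j <;> simp [toDHom_apply, toD_mul, toD_pow, h2]

/-- Integrality of `t` follows from integrality of `t† t`. -/
theorem isDenominatorExponent_of_unitary {u t : DOmega} (h : u.dag * u + t.dag * t = 1) {k : ℕ}
    (hu : IsDenominatorExponent k u) : IsDenominatorExponent k t := by
  classical
  obtain ⟨v, hv⟩ := hu
  -- The least `j` is shown to be 0: for `j > 0`, `w† w` is divisible by `δ`, hence so is `w`,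
  -- because its residue in `𝔽₂` is unchanged by `†`.
  have hex : ∃ j, ∃ w : ZOmega, delta ^ j * (sqrtTwo ^ k * t) = w.toD := by
    obtain ⟨l, w, hw⟩ := exists_isDenominatorExponent t
    refine ⟨2 * l, deltaUnit ^ l * sqrtTwo ^ k * w, ?_⟩
    have h2 : (deltaUnit : ZOmega).toD = deltaUnit := by ext <;> simp [deltaUnit]
    rw [pow_mul, delta_sq, toD_mul, toD_mul, toD_pow, toD_pow, h2, toD_sqrtTwo, ← hw]
    ring
  obtain ⟨w, hw⟩ := Nat.find_spec hex
  rcases hj : Nat.find hex with _ | j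
  · rw [hj, pow_zero, one_mul] at hw
    exact ⟨w, hw⟩
  · exfalso
    rw [hj] at hw
    have h1 : w.dag * w
        = (delta.dag * delta) ^ (j + 1) * (sqrtTwo ^ k * sqrtTwo ^ k - v.dag * v) := by
      apply toD_injective
      simp only [toD_mul, toD_dag, toD_pow, toD_sub, toD_delta, toD_sqrtTwo, ← hw, ← hv, dag_mul,
        dag_pow, dag_sqrtTwo]
      linear_combination ((delta.dag * delta) ^ (j + 1) * sqrtTwo ^ k * sqrtTwo ^ k) * h
    have h2 := congrArg par h1
    simp only [map_mul, map_pow, par_dag, par_delta] at h2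
    have h3 : par w = 0 := by simpa using h2
    obtain ⟨w', rfl⟩ := par_eq_zero_iff_dvd.1 h3
    refine Nat.find_min hex (m := j) (by omega) ⟨w', isUnit_delta.mul_left_cancel ?_⟩
    rw [← mul_assoc, ← pow_succ', hw, toD_mul, toD_delta]

/-- Up to conjugation by `T`, a special unitary matrix whose entry `u` has denominator exponent
`K + 1` is implemented by a circuit with at most `2K` gates `T`. -/
theorem exists_circuit_specialMatrix {u t : DOmega} (h : u.dag * u + t.dag * t = 1) {K : ℕ}
    (hu : IsDenominatorExponent (K + 1) u) :
    ∃ t', (t' = t ∨ t' = omega * t) ∧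
      ∃ C, evalD C = specialMatrix u t' ∧ Circuit.tCount C ≤ 2 * K := by
  obtain ⟨t₀, ht₀⟩ := isDenominatorExponent_of_unitary h hu
  obtain ⟨u₀, hu₀⟩ := hu
  have hsum : u₀.dag * u₀ + t₀.dag * t₀ = sqrtTwo ^ (2 * K + 2) := by
    apply toD_injective
    simp only [toD_add, toD_mul, toD_dag, toD_pow, toD_sqrtTwo, ← hu₀, ← ht₀, dag_mul, dag_pow,
      dag_sqrtTwo]
    linear_combination sqrtTwo ^ (2 * K + 2) * h
  -- The sum of norms is even, so `u₀` and `t₀` have the same parity. If both are even, dividing by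
  -- `δ` and repeating the parity argument gives `δ² ∣ u₀ - t₀`. If both are odd, each is congruent
  -- to 1 or `ω` modulo `√2`, and multiplication by `ω` exchanges these classes.
  have key : sqrtTwo ∣ u₀ - t₀ ∨ sqrtTwo ∣ u₀ - omega * t₀ := by
    have hpar := congrArg par hsum
    simp only [map_add, map_mul, map_pow, par_dag, par_sqrtTwo] at hpar
    have hpar' : par u₀ = par t₀ := by
      revert hpar
      simp only [ne_eq, Nat.add_eq_zero_iff, OfNat.ofNat_ne_zero, and_false, not_false_eq_true,
        zero_pow]
      generalize par u₀ = a
      generalize par t₀ = b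
      revert a b
      decide
    by_cases h0 : par u₀ = 0
    · left
      obtain ⟨u₁, rfl⟩ := par_eq_zero_iff_dvd.1 h0
      obtain ⟨t₁, rfl⟩ := par_eq_zero_iff_dvd.1 (hpar' ▸ h0)
      have h1 : (1 + sqrtTwo) * (u₁.dag * u₁ + t₁.dag * t₁) = sqrtTwo ^ (2 * K + 1) := by
        apply mul_left_cancel₀ sqrtTwo_ne_zero
        simp only [dag_mul] at hsum
        linear_combination hsum - (u₁.dag * u₁ + t₁.dag * t₁) * delta_mul_dag (R := ℤ)
      have h2 := congrArg par h1
      simp only [map_add, map_mul, map_pow, par_dag, par_sqrtTwo, map_one] at h2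
      have h3 : par (u₁ - t₁) = 0 := by
        rw [map_sub]
        revert h2
        simp only [ne_eq, Nat.add_eq_zero_iff, one_ne_zero, and_false, not_false_eq_true,
          zero_pow]
        generalize par u₁ = a
        generalize par t₁ = b
        revert a b
        decide
      obtain ⟨y, hy⟩ := par_eq_zero_iff_dvd.1 h3
      refine ⟨deltaUnit * y, ?_⟩
      rw [← mul_assoc, ← delta_sq, ← mul_sub, hy]
      ring
    · rw [sqrtTwo_dvd_iff, sqrtTwo_dvd_iff]
      have h0' : ¬ par t₀ = 0 := hpar' ▸ h0
      rw [par_eq_zero_iff] at h0 h0'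
      simp
      omega
  rcases key with hk | hk
  · exact ⟨t, .inl rfl, exists_circuit_of_level _ _ (isSpecial_specialMatrix h)
      (hasLevel_specialMatrix hu₀ ht₀ hk)⟩
  · refine ⟨omega * t, .inr rfl, exists_circuit_of_level _ _ (isSpecial_specialMatrix ?_)
      (hasLevel_specialMatrix hu₀ (t₀ := omega * t₀) ?_ hk)⟩
    · rw [dag_mul]
      linear_combination h + (t.dag * t) * dag_omega_mul_omega (R := dyadic)
    · rw [toD_mul, toD_omega, ← ht₀]; ring

/-! ### Exact synthesis of the output circuit -/

theorem map_specialMatrix (u t : DOmega) :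
    toComplexHom.mapMatrix (specialMatrix u t) = matrixU u t := by
  ext i j; fin_cases i <;> fin_cases j <;>
    simp [specialMatrix, matrixU, toComplexHom_apply, toComplex_neg]

theorem omegaC_mul_conj : omegaC * (starRingEnd ℂ) omegaC = 1 := by
  rw [conj_omegaC]; linear_combination -omegaC_pow_four

theorem matrixU'_eq (u t : DOmega) : matrixU' u t = matrixU u (omega * t) := by
  have h := omegaC_mul_conj
  ext i j; fin_cases i <;> fin_cases j <;>
    simp [matrixU', matrixU, Gate.matrix, Matrix.mul_apply, Fin.sum_univ_two, dag_mul,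
      toComplex_mul, toComplex_dag]
  · ring
  · linear_combination ((starRingEnd ℂ) u.toComplex) * h

theorem specialMatrix_omega_mul (u t : DOmega) :
    gateD .T * specialMatrix u t * evalD [.S, .S, .S, .T] = specialMatrix u (omega * t) := by
  have hE : evalD [.S, .S, .S, .T] = !![1, 0; 0, -omega ^ 3] := by
    have : (imag * (imag * (imag * omega)) : DOmega) = -omega ^ 3 := by
      rw [← omega_pow_two]; linear_combination (omega ^ 3) * omega_pow_four (R := dyadic)
    simp [evalD, gateD, this]
  have hd : (omega : DOmega).dag = -omega ^ 3 := by
    rw [show (omega : DOmega) ^ 3 = omega ^ 2 * omega by ring, omega_pow_two]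
    ext <;> simp
  rw [hE]
  simp [gateD, specialMatrix, dag_mul, hd]
  constructor
  · ring
  · linear_combination (-u.dag) * omega_pow_four (R := dyadic)

/-- Conjugation by `T` is itself a circuit operation, so synthesizing one of the two operators
yields the other, though perhaps with more gates `T`. -/
theorem exists_circuit_omega_iff (u t : DOmega) :
    (∃ C, evalD C = specialMatrix u (omega * t)) ↔ ∃ C, evalD C = specialMatrix u t := by
  have hT : evalD [.T] = gateD .T := by simp [evalD]
  have h1 : evalD [.S, .S, .S, .T] * gateD .T = 1 := by
    rw [← hT]; exact mul_eq_one_comm.1 evalD_T_inverse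
  constructor
  · rintro ⟨C, hC⟩
    refine ⟨[.S, .S, .S, .T] ++ C ++ [.T], ?_⟩
    rw [evalD_append, evalD_append, hC, ← specialMatrix_omega_mul, hT]
    simp only [← Matrix.mul_assoc]
    rw [h1, Matrix.one_mul, Matrix.mul_assoc, h1, Matrix.mul_one]
  · rintro ⟨C, hC⟩
    refine ⟨[.T] ++ C ++ [.S, .S, .S, .T], ?_⟩
    rw [evalD_append, evalD_append, hC, ← specialMatrix_omega_mul, hT]

theorem exists_exactSynthesis {M : Matrix (Fin 2) (Fin 2) ℂ} (h : ∃ C : Circuit, C.eval = M) :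
    ∃ C, ExactSynthesis M C := by
  classical
  have hex : ∃ n, ∃ C : Circuit, C.eval = M ∧ C.tCount = n := h.imp' (fun C => C.tCount)
    fun C hC => ⟨C, hC, rfl⟩
  obtain ⟨C, hC, hn⟩ := Nat.find_spec hex
  exact ⟨C, hC, fun D hD => hn ▸ Nat.find_min' hex ⟨D, hD, rfl⟩⟩

theorem eval_eq_matrixU {C : Circuit} {u t : DOmega} (h : evalD C = specialMatrix u t) :
    C.eval = matrixU u t := by
  rw [← map_evalD, h, map_specialMatrix]

/-- Both exact synthesis problems of the algorithm have solutions. -/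
theorem exists_exactSynthesis_matrixU {u t : DOmega} (h : u.dag * u + t.dag * t = 1) :
    (∃ C, ExactSynthesis (matrixU u t) C) ∧ ∃ C, ExactSynthesis (matrixU' u t) C := by
  have hex : ∃ C, evalD C = specialMatrix u t := by
    obtain ⟨t', ht', C, hC, -⟩ := exists_circuit_specialMatrix h
      (isDenominatorExponent_mono (Nat.le_succ _) (isDenominatorExponent_least u))
    rcases ht' with rfl | rfl
    · exact ⟨C, hC⟩
    · exact (exists_circuit_omega_iff u t).1 ⟨C, hC⟩
  refine ⟨exists_exactSynthesis ?_, exists_exactSynthesis ?_⟩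
  · exact hex.imp fun C hC => eval_eq_matrixU hC
  · rw [matrixU'_eq]
    exact ((exists_circuit_omega_iff u t).2 hex).imp fun C hC => eval_eq_matrixU hC

/-- The better of the two circuits has at most `2K` gates `T` if `K + 1` is a denominator
exponent of `u`. -/
theorem min_tCount_le {u t : DOmega} (h : u.dag * u + t.dag * t = 1) {C C' : Circuit}
    (hC : ExactSynthesis (matrixU u t) C) (hC' : ExactSynthesis (matrixU' u t) C') {K : ℕ}
    (hK : IsDenominatorExponent (K + 1) u) : min C.tCount C'.tCount ≤ 2 * K := by
  obtain ⟨t', ht', D, hD, hn⟩ := exists_circuit_specialMatrix h hK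
  rcases ht' with rfl | rfl
  · exact (min_le_left _ _).trans ((hC.2 D (eval_eq_matrixU hD)).trans hn)
  · exact (min_le_right _ _).trans ((hC'.2 D (by rw [matrixU'_eq, eval_eq_matrixU hD])).trans hn)

/-- A special matrix is determined by its first column and its determinant. -/
theorem IsSpecial.second_column {V : Matrix (Fin 2) (Fin 2) DOmega} (hV : IsSpecial V) :
    V 0 1 = -(V 1 0).dag * V.det ∧ V 1 1 = (V 0 0).dag * V.det := by
  have h1 : V.adjugate = V.det • Vᴴ := by
    rw [← Matrix.mul_one V.adjugate, ← mul_eq_one_comm.1 hV.1, ← Matrix.mul_assoc,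
      Matrix.adjugate_mul, Matrix.smul_mul, Matrix.one_mul]
  rw [Matrix.adjugate_fin_two] at h1
  have h00 := congrFun (congrFun h1 0) 0
  have h01 := congrFun (congrFun h1 0) 1
  simp [star_eq_dag] at h00 h01
  constructor
  · linear_combination -h01
  · linear_combination h00

theorem IsSpecial.first_column {V : Matrix (Fin 2) (Fin 2) DOmega} (hV : IsSpecial V) :
    (V 0 0).dag * V 0 0 + (V 1 0).dag * V 1 0 = 1 := by
  have := congrFun (congrFun hV.1 0) 0
  simpa [Matrix.mul_apply, Fin.sum_univ_two, star_eq_dag] using this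

/-! ### The operator norm -/

/-- The C*-identity. It applies to a difference of special unitary matrices, which is a scaled
unitary matrix. -/
theorem sq_opNorm_of_conjTranspose_mul {M : Matrix (Fin 2) (Fin 2) ℂ} {c : ℝ} (hc : 0 ≤ c)
    (h : Mᴴ * M = (c : ℂ) • 1) : opNorm M ^ 2 = c := by
  rw [opNorm, pow_two, ← CStarRing.norm_star_mul_self, ← map_star, ← map_mul,
    Matrix.star_eq_conjTranspose, h, map_smul, map_one, norm_smul, norm_one, mul_one]
  simp [abs_of_nonneg hc]

theorem column_le_opNorm (M : Matrix (Fin 2) (Fin 2) ℂ) (j : Fin 2) :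
    Complex.normSq (M 0 j) + Complex.normSq (M 1 j) ≤ opNorm M ^ 2 := by
  have h := (Matrix.toEuclideanCLM (𝕜 := ℂ) M).le_opNorm (EuclideanSpace.single j 1)
  rw [PiLp.norm_single, norm_one, mul_one] at h
  have h2 := pow_le_pow_left₀ (norm_nonneg _) h 2
  rw [EuclideanSpace.norm_sq_eq, Fin.sum_univ_two, Matrix.ofLp_toEuclideanCLM] at h2
  simpa [Complex.normSq_eq_norm_sq, Matrix.mulVec_single, opNorm] using h2

/-- The unit complex number `e^{-iθ/2}`. -/
def target (θ : ℝ) : ℂ := Complex.exp (-(Complex.I * (θ / 2)))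

theorem normSq_target (θ : ℝ) : Complex.normSq (target θ) = 1 := by
  rw [Complex.normSq_eq_norm_sq, target, Complex.norm_exp]
  simp

theorem conj_target (θ : ℝ) : (starRingEnd ℂ) (target θ) = Complex.exp (Complex.I * (θ / 2)) := by
  rw [target, ← Complex.exp_conj]
  congr 1
  simp [Complex.conj_ofNat]

theorem Rz_eq (θ : ℝ) : Rz θ = !![target θ, 0; 0, (starRingEnd ℂ) (target θ)] := by
  rw [conj_target]; rfl

theorem normSq_add_of_unit {u t : DOmega} (h : u.dag * u + t.dag * t = 1) :
    Complex.normSq u.toComplex + Complex.normSq t.toComplex = 1 := by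
  have := congrArg toComplex h
  rw [toComplex_add, toComplex_dag_mul_self, toComplex_dag_mul_self, toComplex_one] at this
  exact_mod_cast this

theorem mem_unitDisk_iff {z : ℂ} : z ∈ unitDisk ↔ Complex.normSq z ≤ 1 := by
  rw [unitDisk, mem_closedBall_zero_iff, Complex.normSq_eq_norm_sq, sq_le_one_iff₀ (norm_nonneg z)]

theorem mem_unitDisk_of_unit {u t : DOmega} (h : u.dag * u + t.dag * t = 1) :
    u.toComplex ∈ unitDisk := by
  rw [mem_unitDisk_iff]
  linarith [normSq_add_of_unit h, Complex.normSq_nonneg t.toComplex]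

theorem bullet_unit {u t : DOmega} (h : u.dag * u + t.dag * t = 1) :
    u.bullet.dag * u.bullet + t.bullet.dag * t.bullet = 1 := by
  rw [← bullet_dag, ← bullet_dag, ← bullet_mul, ← bullet_mul, ← bullet_add, h, bullet_one]

/-- As `|z| = 1` and `|u|² + |t|² = 1`, the left side of the inequality is `2 - 2 Re(z̄ u)`. -/
theorem mem_epsRegion_iff {θ ε : ℝ} {u t : DOmega} (h : u.dag * u + t.dag * t = 1) :
    u.toComplex ∈ epsRegion θ ε ↔
      Complex.normSq (target θ - u.toComplex) + Complex.normSq t.toComplex ≤ ε ^ 2 := by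
  have h1 := normSq_add_of_unit h
  have h2 := normSq_target θ
  rw [epsRegion, Set.mem_ofPred_eq, and_iff_right (mem_unitDisk_of_unit h)]
  change 1 - ε ^ 2 / 2 ≤ u.toComplex.re * (target θ).re + u.toComplex.im * (target θ).im ↔ _
  rw [Complex.normSq_apply] at h1 h2
  rw [Complex.normSq_apply (target θ - _)]
  simp only [Complex.sub_re, Complex.sub_im]
  constructor <;> intro h3 <;> nlinarith

/-- In the special case of determinant one, the approximation condition is membership in the
`ε`-region. -/
theorem opNorm_sub_matrixU {θ ε : ℝ} (hε : 0 < ε) {u t : DOmega} (h : u.dag * u + t.dag * t = 1) :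
    opNorm (Rz θ - matrixU u t) ≤ ε ↔ u.toComplex ∈ epsRegion θ ε := by
  rw [mem_epsRegion_iff h, ← sq_opNorm_of_conjTranspose_mul (M := Rz θ - matrixU u t)
    (add_nonneg (Complex.normSq_nonneg _) (Complex.normSq_nonneg _))]
  · exact (sq_le_sq₀ (norm_nonneg _) hε.le).symm
  · rw [Rz_eq, matrixU, toComplex_dag, toComplex_dag]
    push_cast
    rw [Complex.normSq_eq_conj_mul_self, Complex.normSq_eq_conj_mul_self]
    ext i j; fin_cases i <;> fin_cases j <;> simp [Matrix.mul_apply, Fin.sum_univ_two] <;> ring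

/-! ### Approximations with determinant different from one -/

theorem omegaC_pow_re_le (j : ℕ) :
    (omega : DOmega) ^ j = 1 ∨ (omegaC ^ j).re ≤ Real.sqrt 2 / 2 := by
  have h8 : omegaC ^ 8 = 1 := by
    rw [show 8 = 4 * 2 from rfl, pow_mul, omegaC_pow_four]; norm_num
  have hj : omegaC ^ j = omegaC ^ (j % 8) := by
    conv_lhs => rw [← Nat.div_add_mod j 8, pow_add, pow_mul, h8, one_pow, one_mul]
  rw [omega_pow_mod, hj]
  have hlt : j % 8 < 8 := Nat.mod_lt _ (by norm_num)
  have hpos : 0 ≤ Real.sqrt 2 := Real.sqrt_nonneg 2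
  have hω : omegaC = ⟨Real.sqrt 2 / 2, Real.sqrt 2 / 2⟩ := by
    rw [omegaC_eq]; apply Complex.ext <;> simp
  have h3 : omegaC ^ 3 = Complex.I * omegaC := by rw [pow_succ, omegaC_sq]
  have h5 : omegaC ^ 5 = -omegaC := by rw [pow_succ, omegaC_pow_four]; ring
  have h6 : omegaC ^ 6 = -Complex.I := by
    rw [show 6 = 4 + 2 from rfl, pow_add, omegaC_pow_four, omegaC_sq]; ring
  have h7 : omegaC ^ 7 = -Complex.I * omegaC := by rw [pow_succ, h6]
  generalize j % 8 = k at hlt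
  interval_cases k
  · exact .inl (pow_zero _)
  all_goals right
  · simp [hω]
  · rw [omegaC_sq, Complex.I_re]; positivity
  · rw [h3, hω]; simp; linarith
  · rw [omegaC_pow_four]; simp; linarith
  · rw [h5, hω]; simp; linarith
  · rw [h6, Complex.neg_re, Complex.I_re]; linarith
  · rw [h7, hω]; simp

/-- A vector of the unit disk has inner product at least `c` with the unit vectors `(1, 0)` and
`(d₁, d₂)`, so `2c` is at most the length of their sum, `√(2 + 2d₁)`. The final bound is `cos(π/8)`.
-/
theorem le_half_sqrt_two_add {a b d₁ d₂ c : ℝ} (hab : a ^ 2 + b ^ 2 ≤ 1)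
    (hd : d₁ * d₁ + d₂ * d₂ = 1) (hd₁ : d₁ ≤ Real.sqrt 2 / 2) (h1 : c ≤ a)
    (h2 : c ≤ a * d₁ + b * d₂) : c ≤ Real.sqrt (2 + Real.sqrt 2) / 2 := by
  have h3 : a * (1 + d₁) + b * d₂ ≤ Real.sqrt (2 + Real.sqrt 2) := by
    apply Real.le_sqrt_of_sq_le
    have h4 : (a * (1 + d₁) + b * d₂) ^ 2 + (a * d₂ - b * (1 + d₁)) ^ 2
        = (a ^ 2 + b ^ 2) * ((1 + d₁) ^ 2 + d₂ ^ 2) := by ring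
    have h5 : (a ^ 2 + b ^ 2) * ((1 + d₁) ^ 2 + d₂ ^ 2) ≤ (1 + d₁) ^ 2 + d₂ ^ 2 :=
      mul_le_of_le_one_left (by positivity) hab
    linarith [sq_nonneg (a * d₂ - b * (1 + d₁))]
  linarith

/-- With determinant `d`, the two columns of the error bound `Re(z̄ u)` and `Re(z u† d)` from below.
Both cannot be close to 1 when `d` is at an angle of at least `π/4` from 1. -/
theorem one_sub_le_cos_of_det_ne_one {θ ε : ℝ} {D : Circuit}
    (hD : Approximates θ ε D) (hdet : (evalD D).det ≠ 1) :
    1 - ε ^ 2 / 2 ≤ Real.cos (Real.pi / 8) := by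
  have hV := isSpecial_evalD D
  obtain ⟨j, hj⟩ := hV.2
  obtain ⟨h01, h11⟩ := hV.second_column
  have hcol := normSq_add_of_unit hV.first_column
  have hz := normSq_target θ
  have hd : (omegaC ^ j).re ≤ Real.sqrt 2 / 2 :=
    (omegaC_pow_re_le j).resolve_left fun h => hdet (hj.trans h)
  have hdn : Complex.normSq (omegaC ^ j) = 1 := by
    have h1 : Complex.normSq omegaC = 1 := by
      have := omegaC_mul_conj
      rw [Complex.mul_conj] at this
      exact_mod_cast this
    rw [map_pow, h1, one_pow]
  have heval : ∀ a b, D.eval a b = (evalD D a b).toComplex := fun a b => by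
    rw [← map_evalD]; rfl
  have hle : opNorm (Rz θ - D.eval) ^ 2 ≤ ε ^ 2 := pow_le_pow_left₀ (norm_nonneg _) hD 2
  have hc0 := (column_le_opNorm (Rz θ - D.eval) 0).trans hle
  have hc1 := (column_le_opNorm (Rz θ - D.eval) 1).trans hle
  simp only [Matrix.sub_apply, heval, h01, h11, hj, Rz_eq] at hc0 hc1
  simp [toComplex_mul, toComplex_neg, toComplex_dag, toComplex_pow] at hc0 hc1
  rw [Real.cos_pi_div_eight]
  set u := (evalD D 0 0).toComplex
  set t := (evalD D 1 0).toComplex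
  set z := target θ
  set d := omegaC ^ j
  have hjn : Complex.normSq omegaC ^ j = 1 := by rw [← map_pow]; exact hdn
  simp only [hjn, mul_one] at hc1
  simp only [Complex.normSq_apply, Complex.sub_re, Complex.sub_im, Complex.mul_re, Complex.mul_im,
    Complex.conj_re, Complex.conj_im] at *
  obtain ⟨u1, u2⟩ := u
  obtain ⟨z1, z2⟩ := z
  obtain ⟨d1, d2⟩ := d
  obtain ⟨t1, t2⟩ := t
  simp only at *
  set c := 1 - ε ^ 2 / 2 with hc
  set a := z1 * u1 + z2 * u2 with ha
  set b := z1 * u2 - z2 * u1 with hb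
  have hab : a ^ 2 + b ^ 2 ≤ 1 := by
    have : a ^ 2 + b ^ 2 = (z1 * z1 + z2 * z2) * (u1 * u1 + u2 * u2) := by rw [ha, hb]; ring
    rw [this, hz]
    nlinarith [sq_nonneg t1, sq_nonneg t2]
  have h1 : c ≤ a := by linarith
  have h2 : c ≤ a * d1 + b * d2 := by
    have : (u1 * d1 + u2 * d2) * (u1 * d1 + u2 * d2) + (u1 * d2 - u2 * d1) * (u1 * d2 - u2 * d1)
        = (u1 * u1 + u2 * u2) * (d1 * d1 + d2 * d2) := by ring
    rw [hdn] at this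
    linarith
  exact le_half_sqrt_two_add hab hdn hd h1 h2

/-- Some power of `ω` is within an angle of `π/8` of the target. -/
theorem exists_omega_pow_mem_epsRegion {θ ε : ℝ} (h : 1 - ε ^ 2 / 2 ≤ Real.cos (Real.pi / 8)) :
    ∃ j : ℕ, ((omega : DOmega) ^ j).toComplex ∈ epsRegion θ ε := by
  -- The multiple of `π/4` nearest to `-θ/2` is within `π/8` of it; reducing `n` modulo 8 gives a
  -- natural exponent.
  set n : ℤ := round (-(θ / 2) / (Real.pi / 4)) with hn
  have hpi := Real.pi_pos
  have habs : |(-(θ / 2)) - n * (Real.pi / 4)| ≤ Real.pi / 8 := by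
    have h1 := abs_sub_round (-(θ / 2) / (Real.pi / 4))
    rw [← hn] at h1
    have h2 : (-(θ / 2)) - n * (Real.pi / 4)
        = (-(θ / 2) / (Real.pi / 4) - n) * (Real.pi / 4) := by field_simp
    rw [h2, abs_mul, abs_of_pos (show 0 < Real.pi / 4 by positivity)]
    nlinarith
  obtain ⟨j, hj⟩ : ∃ j : ℕ, (j : ℤ) = n % 8 :=
    ⟨(n % 8).toNat, Int.toNat_of_nonneg (Int.emod_nonneg _ (by norm_num))⟩
  have hjn : (j : ℝ) * (Real.pi / 4) = n * (Real.pi / 4) - (n / 8 : ℤ) * (2 * Real.pi) := by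
    have h1 : (j : ℤ) = n - 8 * (n / 8) := by rw [hj]; omega
    have h2 : (j : ℝ) = n - 8 * (n / 8 : ℤ) := by exact_mod_cast h1
    rw [h2]; ring
  have hω : omegaC ^ j = ⟨Real.cos (n * (Real.pi / 4)), Real.sin (n * (Real.pi / 4))⟩ := by
    rw [omegaC, ← Complex.exp_nat_mul, show (j : ℂ) * (Complex.I * (Real.pi / 4))
      = ((j * (Real.pi / 4) : ℝ) : ℂ) * Complex.I by push_cast; ring]
    apply Complex.ext
    · rw [Complex.exp_ofReal_mul_I_re, hjn, Real.cos_sub_int_mul_two_pi]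
    · rw [Complex.exp_ofReal_mul_I_im, hjn, Real.sin_sub_int_mul_two_pi]
  have ht : target θ = ⟨Real.cos (-(θ / 2)), Real.sin (-(θ / 2))⟩ := by
    rw [target, show -(Complex.I * (θ / 2)) = ((-(θ / 2) : ℝ) : ℂ) * Complex.I by push_cast; ring]
    exact Complex.ext (Complex.exp_ofReal_mul_I_re _) (Complex.exp_ofReal_mul_I_im _)
  refine ⟨j, ?_, ?_⟩
  · rw [toComplex_pow, toComplex_omega, hω, mem_unitDisk_iff, Complex.normSq_apply]
    nlinarith [Real.sin_sq_add_cos_sq (n * (Real.pi / 4))]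
  · change 1 - ε ^ 2 / 2 ≤ _ * (target θ).re + _ * (target θ).im
    rw [toComplex_pow, toComplex_omega, hω, ht]
    simp only
    have : Real.cos (n * (Real.pi / 4)) * Real.cos (-(θ / 2))
        + Real.sin (n * (Real.pi / 4)) * Real.sin (-(θ / 2))
        = Real.cos |-(θ / 2) - n * (Real.pi / 4)| := by
      rw [Real.cos_abs, Real.cos_sub]; ring
    rw [this]
    exact h.trans (Real.cos_le_cos_of_nonneg_of_le_pi (abs_nonneg _) (by linarith) habs)

/-! ## Density of the exactly implementable operators -/

/-- The first column of the powers of the matrix with rows `(u, -t†)` and `(t, u†)`. -/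
def pairPow (u t : DOmega) : ℕ → DOmega × DOmega
  | 0 => (1, 0)
  | n + 1 => (u * (pairPow u t n).1 - t.dag * (pairPow u t n).2,
      t * (pairPow u t n).1 + u.dag * (pairPow u t n).2)

theorem pairPow_unit {u t : DOmega} (h : u.dag * u + t.dag * t = 1) (n : ℕ) :
    (pairPow u t n).1.dag * (pairPow u t n).1 + (pairPow u t n).2.dag * (pairPow u t n).2 = 1 := by
  induction n with
  | zero => simp [pairPow]
  | succ n ih =>
    simp only [pairPow, dag_sub, dag_mul, dag_add, dag_dag]
    generalize (pairPow u t n).1 = x at ih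
    generalize (pairPow u t n).2 = y at ih
    linear_combination h * (x.dag * x + y.dag * y) + ih

theorem norm_le_one_of_unit {u t : DOmega} (h : u.dag * u + t.dag * t = 1) :
    ‖u.toComplex‖ ≤ 1 ∧ ‖t.toComplex‖ ≤ 1 := by
  have h1 := normSq_add_of_unit h
  rw [Complex.normSq_eq_norm_sq, Complex.normSq_eq_norm_sq] at h1
  constructor <;> nlinarith [norm_nonneg u.toComplex, norm_nonneg t.toComplex]

/-- If `t` is small, the powers of the matrix stay close to the powers of its diagonal part. -/
theorem norm_pairPow_sub_le {u t : DOmega} (h : u.dag * u + t.dag * t = 1) (n : ℕ) :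
    ‖(pairPow u t n).1.toComplex - u.toComplex ^ n‖ ≤ n * ‖t.toComplex‖ := by
  induction n with
  | zero => simp [pairPow]
  | succ n ih =>
    have h1 := norm_le_one_of_unit h
    have h2 := norm_le_one_of_unit (pairPow_unit h n)
    have h3 : (pairPow u t (n + 1)).1.toComplex - u.toComplex ^ (n + 1)
        = u.toComplex * ((pairPow u t n).1.toComplex - u.toComplex ^ n)
          - t.dag.toComplex * (pairPow u t n).2.toComplex := by
      rw [pairPow, toComplex_sub, toComplex_mul, toComplex_mul]
      ring
    have h4 : ‖t.dag.toComplex‖ = ‖t.toComplex‖ := by rw [toComplex_dag, RCLike.norm_conj]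
    rw [h3]
    refine (norm_sub_le _ _).trans ?_
    rw [norm_mul, norm_mul, h4]
    have h5 := mul_le_mul h1.1 ih (norm_nonneg _) zero_le_one
    have h6 := mul_le_of_le_one_right (norm_nonneg t.toComplex) h2.2
    push_cast
    linarith

/-- The powers of a special unitary matrix in terms of the powers of its eigenvalue `a + i s`. -/
theorem pairPow_toComplex {u t : DOmega} (h : u.dag * u + t.dag * t = 1) {s : ℝ} (hs : s ≠ 0)
    (hs2 : s ^ 2 + u.toComplex.re ^ 2 = 1) (n : ℕ) :
    (pairPow u t n).1.toComplex = ⟨((⟨u.toComplex.re, s⟩ : ℂ) ^ n).re,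
        ((⟨u.toComplex.re, s⟩ : ℂ) ^ n).im / s * u.toComplex.im⟩ ∧
      (pairPow u t n).2.toComplex
        = ((((⟨u.toComplex.re, s⟩ : ℂ) ^ n).im / s : ℝ) : ℂ) * t.toComplex := by
  have h1 := normSq_add_of_unit h
  rw [Complex.normSq_apply, Complex.normSq_apply] at h1
  induction n with
  | zero => constructor <;> simp [pairPow, Complex.ext_iff]
  | succ n ih =>
    rw [pairPow, pow_succ]
    simp only [toComplex_sub, toComplex_add, toComplex_mul, toComplex_dag, ih.1, ih.2]
    generalize (⟨u.toComplex.re, s⟩ : ℂ) ^ n = w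
    generalize u.toComplex = u at *
    generalize t.toComplex = t at *
    obtain ⟨w1, w2⟩ := w
    obtain ⟨u1, u2⟩ := u
    obtain ⟨t1, t2⟩ := t
    simp only [Complex.ext_iff, Complex.sub_re, Complex.sub_im, Complex.add_re, Complex.add_im,
      Complex.mul_re, Complex.mul_im, Complex.conj_re, Complex.conj_im, Complex.ofReal_re,
      Complex.ofReal_im] at *
    refine ⟨⟨?_, ?_⟩, ?_, ?_⟩ <;> field_simp
    -- The two hypotheses combine to `s² = (Im u)² + |t|²`.
    · linear_combination w2 * (hs2 - h1)
    all_goals ring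

/-- An element of the unit circle that is not a root of unity has powers with arbitrarily small
nonzero imaginary part. -/
theorem exists_pow_im_small {l : ℂ} (hl : ‖l‖ = 1) (hroot : ∀ n : ℕ, 0 < n → l ^ n ≠ 1) {δ : ℝ}
    (hδ : 0 < δ) : ∃ n : ℕ, (l ^ n).im ≠ 0 ∧ |(l ^ n).im| < δ := by
  -- By compactness two distinct powers are within `δ`, so their quotient, again a power, is within
  -- `δ` of 1. A real power on the unit circle would be `±1`, with square 1.
  obtain ⟨a, -, φ, hφ, hlim⟩ := tendsto_subseq_of_bounded (x := fun n : ℕ => l ^ n)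
    (Metric.isBounded_closedBall (x := (0 : ℂ)) (r := 1)) (fun n => by simp [hl])
  obtain ⟨N, hN⟩ := Metric.cauchySeq_iff'.1 hlim.cauchySeq δ hδ
  have h1 := hN (N + 1) (Nat.le_succ N)
  obtain ⟨k, hk⟩ := Nat.exists_eq_add_of_lt (hφ (Nat.lt_succ_self N))
  have hk' : φ (N + 1) = φ N + (k + 1) := by rw [← add_assoc]; exact hk
  have h2 : ‖l ^ (k + 1) - 1‖ < δ := by
    rw [dist_eq_norm, Function.comp_apply, Function.comp_apply, hk', pow_add,
      show l ^ φ N * l ^ (k + 1) - l ^ φ N = l ^ φ N * (l ^ (k + 1) - 1) by ring, norm_mul,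
      norm_pow, hl, one_pow, one_mul] at h1
    exact h1
  refine ⟨k + 1, fun h0 => ?_, ?_⟩
  · have hn : Complex.normSq (l ^ (k + 1)) = 1 := by
      rw [Complex.normSq_eq_norm_sq, norm_pow, hl]; simp
    rw [Complex.normSq_apply, h0] at hn
    apply hroot (2 * (k + 1)) (by positivity)
    rw [mul_comm, pow_mul]
    generalize l ^ (k + 1) = w at h0 hn
    apply Complex.ext
    · rw [pow_two, Complex.mul_re, h0, Complex.one_re]; linarith
    · rw [pow_two, Complex.mul_im, h0, Complex.one_im]; ring
  · refine lt_of_le_of_lt ?_ h2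
    simpa using Complex.abs_im_le_norm (l ^ (k + 1) - 1)

theorem not_isIntegral_half : ¬ IsIntegral ℤ (1 / 2 : ℂ) := by
  intro h
  have h1 : IsIntegral ℤ (algebraMap ℚ ℂ (1 / 2)) := by simpa using h
  rw [isIntegral_algebraMap_iff (algebraMap ℚ ℂ).injective] at h1
  obtain ⟨n, hn⟩ := IsIntegrallyClosed.isIntegral_iff.1 h1
  have h2 : (2 * n : ℚ) = 1 := by
    rw [eq_intCast] at hn
    rw [hn]; norm_num
  have h3 : 2 * n = 1 := by exact_mod_cast h2
  omega

/-- The eigenvalues of the chosen operator are not roots of unity. -/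
theorem pow_ne_one_of_re {l : ℂ} (hre : l.re = (1 + Real.sqrt 2 / 2) / 2) (n : ℕ)
    (hn : 0 < n) : l ^ n ≠ 1 := by
  intro h
  -- For a root of unity, `l + l̄ = 1 + √2/2` would be an algebraic integer, and so would `(√2/2)² =
  -- 1/2`.
  have hint : ∀ m : ℂ, m ^ n = 1 → IsIntegral ℤ m := fun m hm =>
    IsIntegral.of_pow hn (hm ▸ isIntegral_one)
  have h1 := (hint l h).add (hint ((starRingEnd ℂ) l) (by rw [← map_pow, h, map_one]))
  have h2 : l + (starRingEnd ℂ) l = 1 + ((Real.sqrt 2 / 2 : ℝ) : ℂ) := by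
    rw [Complex.add_conj, hre]; push_cast; ring
  rw [h2] at h1
  have h3 : IsIntegral ℤ ((Real.sqrt 2 / 2 : ℝ) : ℂ) := by
    simpa using h1.sub isIntegral_one
  apply not_isIntegral_half
  have h4 := h3.mul h3
  have h5 : ((Real.sqrt 2 / 2 : ℝ) : ℂ) * ((Real.sqrt 2 / 2 : ℝ) : ℂ) = 1 / 2 := by
    rw [← Complex.ofReal_mul, show Real.sqrt 2 / 2 * (Real.sqrt 2 / 2) = 1 / 2 by
      rw [div_mul_div_comm, Real.mul_self_sqrt (by norm_num)]; norm_num]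
    push_cast; ring
  rwa [h5] at h4

/-- There are operators with `Im u ≠ 0` and `Re u` and `|t|` as small as desired. -/
theorem exists_unit_near_one {δ : ℝ} (hδ : 0 < δ) : ∃ u t : DOmega, u.dag * u + t.dag * t = 1 ∧
    u.toComplex.im ≠ 0 ∧ |u.toComplex.im| < δ ∧ ‖t.toComplex‖ < δ := by
  set c : DOmega := ⟨0, 0, 0, half⟩ with hc
  have h2 : c + c = 1 := by
    ext1 <;> simp only [hc, add_a, add_b, add_c, add_d, add_zero, one_a, one_b, one_c, one_d]
    rw [← two_mul, two_mul_half]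
  have hd : c.dag = c := by ext1 <;> simp [hc]
  have hhc : c.toComplex = 1 / 2 := by
    have := congrArg toComplex h2
    rw [toComplex_add, toComplex_one] at this
    linear_combination this / 2
  have hωc : omegaC = ⟨Real.sqrt 2 / 2, Real.sqrt 2 / 2⟩ := by
    rw [omegaC_eq]; apply Complex.ext <;> simp
  -- An explicit operator whose eigenvalues have real part `(1 + √2/2)/2`, the value covered by
  -- `pow_ne_one_of_re`. In its `n`-th power both `Im u` and `t` are scaled by `Im(lⁿ)/s`, so both
  -- become small together while `Im u` stays nonzero.
  set u₀ : DOmega := c * (1 + omega.dag) with hu₀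
  set t₀ : DOmega := c * (omega.dag - 1) with ht₀
  have hunit : u₀.dag * u₀ + t₀.dag * t₀ = 1 := by
    simp only [hu₀, ht₀, dag_mul, dag_add, dag_sub, dag_one, dag_dag, hd]
    linear_combination (2 * c * c) * dag_omega_mul_omega (R := dyadic) + (2 * c + 1) * h2
  have hu : u₀.toComplex = ⟨(1 + Real.sqrt 2 / 2) / 2, -Real.sqrt 2 / 4⟩ := by
    rw [hu₀, toComplex_mul, toComplex_add, toComplex_dag, toComplex_omega, toComplex_one, hhc, hωc]
    apply Complex.ext <;> simp <;> ring
  have hre : u₀.toComplex.re = (1 + Real.sqrt 2 / 2) / 2 := by rw [hu]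
  have him : u₀.toComplex.im ≠ 0 := by rw [hu]; simp
  have h1 := normSq_add_of_unit hunit
  have hnn := Complex.normSq_nonneg t₀.toComplex
  rw [Complex.normSq_apply] at h1
  have hpos : 0 < 1 - u₀.toComplex.re ^ 2 := by
    have := mul_self_pos.2 him
    linarith [sq u₀.toComplex.re]
  set s := Real.sqrt (1 - u₀.toComplex.re ^ 2) with hs
  have hs0 : 0 < s := Real.sqrt_pos.2 hpos
  have hs2 : s ^ 2 + u₀.toComplex.re ^ 2 = 1 := by rw [hs, Real.sq_sqrt hpos.le]; ring
  set l : ℂ := ⟨u₀.toComplex.re, s⟩ with hl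
  have hln : ‖l‖ = 1 := by
    rw [← sq_eq_sq₀ (norm_nonneg _) zero_le_one, ← Complex.normSq_eq_norm_sq, Complex.normSq_apply,
      hl]
    simp only; linarith [sq u₀.toComplex.re, sq s]
  obtain ⟨n, hn0, hn⟩ := exists_pow_im_small hln (pow_ne_one_of_re hre) hδ
  obtain ⟨hu', ht'⟩ := pairPow_toComplex hunit hs0.ne' hs2 n
  refine ⟨_, _, pairPow_unit hunit n, ?_, ?_, ?_⟩
  · rw [hu']
    exact mul_ne_zero (div_ne_zero hn0 hs0.ne') him
  · rw [hu']
    refine lt_of_le_of_lt ?_ hn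
    have hle : |u₀.toComplex.im| ≤ s := abs_le_of_sq_le_sq (by nlinarith) hs0.le
    rw [abs_mul, abs_div, abs_of_pos hs0, div_mul_eq_mul_div, div_le_iff₀ hs0]
    exact mul_le_mul_of_nonneg_left hle (abs_nonneg _)
  · rw [ht']
    refine lt_of_le_of_lt ?_ hn
    have hle : ‖t₀.toComplex‖ ≤ s := by
      rw [Complex.normSq_eq_norm_sq] at h1
      apply le_of_sq_le_sq _ hs0.le
      nlinarith [mul_self_nonneg u₀.toComplex.im]
    rw [norm_mul, Complex.norm_real, Real.norm_eq_abs, abs_div, abs_of_pos hs0, div_mul_eq_mul_div,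
      div_le_iff₀ hs0]
    exact mul_le_mul_of_nonneg_left hle (abs_nonneg _)

/-- Every angle is approximated by a multiple of `ψ`, with an error of at most `ψ`. -/
theorem exists_nat_mul_near {ψ : ℝ} (hψ : ψ ≠ 0) (α : ℝ) : ∃ N : ℕ, N * |ψ| ≤ 2 * Real.pi ∧
    ‖Complex.exp ((N * ψ : ℝ) * Complex.I) - Complex.exp (α * Complex.I)‖ ≤ |ψ| := by
  wlog hpos : 0 < ψ generalizing ψ α
  · obtain ⟨N, hN, h⟩ := this (neg_ne_zero.2 hψ) (-α) (by
      rcases lt_or_gt_of_ne hψ with h | h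
      · linarith
      · exact absurd h hpos)
    refine ⟨N, by rwa [abs_neg] at hN, ?_⟩
    rw [abs_neg] at h
    refine le_trans (le_of_eq ?_) h
    rw [← RCLike.norm_conj, map_sub, ← Complex.exp_conj, ← Complex.exp_conj]
    simp
  have h2pi : (0 : ℝ) < 2 * Real.pi := Real.two_pi_pos
  -- Reducing the angle to `[0, 2π)` and taking the floor of `β/ψ` keeps the total rotation `N ψ`
  -- within one turn.
  set β := toIcoMod h2pi 0 α with hβ
  have hmem := toIcoMod_mem_Ico h2pi 0 α
  rw [← hβ, zero_add] at hmem
  have hexp : Complex.exp (α * Complex.I) = Complex.exp (β * Complex.I) := by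
    have h1 : α = β + (toIcoDiv h2pi 0 α) * (2 * Real.pi) := by
      have := toIcoMod_add_toIcoDiv_zsmul h2pi 0 α
      rw [zsmul_eq_mul] at this
      exact this.symm
    rw [h1, Complex.exp_eq_exp_iff_exists_int]
    exact ⟨toIcoDiv h2pi 0 α, by push_cast; ring⟩
  rw [hexp, abs_of_pos hpos]
  have hN1 := Nat.floor_le (div_nonneg hmem.1 hpos.le)
  have hN2 := Nat.lt_floor_add_one (β / ψ)
  rw [le_div_iff₀ hpos] at hN1
  rw [div_lt_iff₀ hpos] at hN2
  refine ⟨⌊β / ψ⌋₊, by linarith [hmem.2], ?_⟩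
  have h1 : Complex.exp ((⌊β / ψ⌋₊ * ψ : ℝ) * Complex.I) - Complex.exp (β * Complex.I)
      = Complex.exp (β * Complex.I)
        * (Complex.exp (Complex.I * ((⌊β / ψ⌋₊ * ψ - β : ℝ) : ℂ)) - 1) := by
    rw [mul_sub, mul_one, ← Complex.exp_add]
    congr 2; push_cast; ring
  rw [h1, norm_mul, Complex.norm_exp_ofReal_mul_I, one_mul]
  refine (Real.norm_exp_I_mul_ofReal_sub_one_le).trans ?_
  rw [Real.norm_eq_abs, abs_le]
  constructor <;> linarith

theorem one_sub_pow_le {r : ℝ} (h0 : 0 ≤ r) (N : ℕ) : 1 - r ^ N ≤ N * (1 - r) := by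
  have := one_add_mul_le_pow (a := r - 1) (by linarith) N
  rw [add_sub_cancel] at this
  linarith

/-- Every point of the unit circle is a limit of entries of exactly implementable operators. -/
theorem exists_unit_near (α : ℝ) {δ : ℝ} (hδ : 0 < δ) : ∃ u t : DOmega,
    u.dag * u + t.dag * t = 1 ∧ ‖u.toComplex - Complex.exp (α * Complex.I)‖ < δ := by
  have hpi := Real.pi_pos
  obtain ⟨u, t, h, hβ0, hβ, ht⟩ := exists_unit_near_one
    -- The budget `10π` is `4π|t|` for replacing powers of the matrix by powers of `u'`, `4π|t|` for
    -- `|u'| ≠ 1`, and `2π|β|` for the angular step.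
    (δ := min (1 / 2) (δ / (10 * Real.pi))) (by positivity)
  -- First column of `U · Z U Z` with `Z = diag(1, -1)`. The first-order off-diagonal terms cancel:
  -- `t' = 2iβt`, whereas the rotation angle is still of order `β`. So a full turn takes about `1/β`
  -- steps and accumulates an error only of order `|t|`.
  set u' : DOmega := u * u + t.dag * t with hu'
  set t' : DOmega := t * u - u.dag * t with ht'
  have h' : u'.dag * u' + t'.dag * t' = 1 := by
    simp only [hu', ht', dag_mul, dag_add, dag_sub, dag_dag]
    linear_combination (u.dag * u + t.dag * t + 1) * h
  set β := u.toComplex.im with hβdef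
  set x := u.toComplex.re with hxdef
  have hn := normSq_add_of_unit h
  rw [Complex.normSq_apply, ← hβdef, ← hxdef] at hn
  have hut : u'.toComplex = ⟨1 - 2 * β ^ 2, 2 * β * x⟩ := by
    rw [hu', toComplex_add, toComplex_mul, toComplex_dag_mul_self]
    apply Complex.ext
    · rw [Complex.add_re, Complex.mul_re, Complex.ofReal_re, ← hβdef, ← hxdef]
      linear_combination hn
    · rw [Complex.add_im, Complex.mul_im, Complex.ofReal_im, ← hβdef, ← hxdef]
      ring
  have htn : ‖t'.toComplex‖ = 2 * |β| * ‖t.toComplex‖ := by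
    have : t'.toComplex = ((2 * β : ℝ) * Complex.I) * t.toComplex := by
      rw [ht', toComplex_sub, toComplex_mul, toComplex_mul, toComplex_dag, mul_comm t.toComplex,
        ← sub_mul, Complex.sub_conj]
    rw [this, norm_mul, norm_mul, Complex.norm_I, mul_one, Complex.norm_real, Real.norm_eq_abs,
      abs_mul, abs_two]
  have hβ1 : |β| < 1 / 2 := hβ.trans_le (min_le_left _ _)
  have ht1 : ‖t.toComplex‖ < 1 / 2 := ht.trans_le (min_le_left _ _)
  have hβ2 : |β| * (10 * Real.pi) < δ :=
    (lt_div_iff₀ (by positivity)).1 (hβ.trans_le (min_le_right _ _))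
  have ht2 : ‖t.toComplex‖ * (10 * Real.pi) < δ :=
    (lt_div_iff₀ (by positivity)).1 (ht.trans_le (min_le_right _ _))
  have hβpos : 0 < |β| := abs_pos.2 hβ0
  have hβsq : β ^ 2 < 1 / 4 := by rw [← sq_abs]; nlinarith
  have hx : 1 / 2 ≤ |x| := by
    rw [Complex.normSq_eq_norm_sq] at hn
    apply abs_le_of_sq_le_sq' _ (abs_nonneg x) |>.2
    rw [sq_abs]
    nlinarith [norm_nonneg t.toComplex]
  have hx1 : |x| ≤ 1 := by
    apply abs_le_of_sq_le_sq _ zero_le_one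
    nlinarith [mul_self_nonneg β, Complex.normSq_nonneg t.toComplex]
  set r := ‖u'.toComplex‖ with hr
  set ψ := Complex.arg u'.toComplex with hψ
  have hr1 : r ≤ 1 := (norm_le_one_of_unit h').1
  have hr2 : 1 / 2 ≤ r := by
    have := Complex.abs_re_le_norm u'.toComplex
    rw [hut] at this
    rw [hr, hut]
    refine le_trans ?_ this
    exact le_trans (by linarith) (le_abs_self _)
  have hrpos : 0 < r := by linarith
  have hsin : Real.sin ψ * r = 2 * β * x := by
    rw [hψ, Complex.sin_arg, div_mul_cancel₀ _ hrpos.ne', hut]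
  have hsinabs : |Real.sin ψ| * r = 2 * |β| * |x| := by
    have := congrArg abs hsin
    rwa [abs_mul, abs_mul, abs_mul, abs_of_pos hrpos, abs_two] at this
  have hψle : |ψ| ≤ Real.pi / 2 := by
    rw [hψ, Complex.abs_arg_le_pi_div_two_iff, hut]
    simp only; linarith
  -- From `|sin ψ| r = 2|β||x|` with `r ≤ 1` and `|x| ≥ 1/2`. The upper bound that follows uses `r ≥
  -- 1/2`, `|x| ≤ 1` and Jordan's inequality.
  have hψ1 : |β| ≤ |ψ| := by
    have h1 := Real.abs_sin_le_abs (x := ψ)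
    nlinarith [abs_nonneg (Real.sin ψ)]
  have hψ2 : |ψ| ≤ 2 * Real.pi * |β| := by
    have h1 := Real.mul_abs_le_abs_sin hψle
    have h2 : |Real.sin ψ| ≤ 4 * |β| := by nlinarith [abs_nonneg (Real.sin ψ)]
    rw [div_mul_eq_mul_div, div_le_iff₀ hpi] at h1
    nlinarith
  have hψ0 : ψ ≠ 0 := abs_pos.1 (hβpos.trans_le hψ1)
  obtain ⟨N, hN, hNα⟩ := exists_nat_mul_near hψ0 α
  refine ⟨_, _, pairPow_unit h' N, ?_⟩
  have e1 := norm_pairPow_sub_le h' N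
  have e2 : ‖u'.toComplex ^ N - Complex.exp ((N * ψ : ℝ) * Complex.I)‖ ≤ N * ‖t'.toComplex‖ := by
    have hpol : u'.toComplex ^ N - Complex.exp ((N * ψ : ℝ) * Complex.I)
        = ((r ^ N - 1 : ℝ) : ℂ) * Complex.exp ((N * ψ : ℝ) * Complex.I) := by
      conv_lhs => rw [← Complex.norm_mul_exp_arg_mul_I u'.toComplex, ← hr, ← hψ, mul_pow,
        ← Complex.exp_nat_mul]
      push_cast
      rw [sub_mul, one_mul, mul_assoc]
    have hrn : r ^ 2 + ‖t'.toComplex‖ ^ 2 = 1 := by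
      have := normSq_add_of_unit h'
      rwa [Complex.normSq_eq_norm_sq, Complex.normSq_eq_norm_sq] at this
    rw [hpol, norm_mul, Complex.norm_exp_ofReal_mul_I, mul_one, Complex.norm_real,
      Real.norm_eq_abs, abs_sub_comm, abs_of_nonneg
        (by linarith [pow_le_one₀ (n := N) hrpos.le hr1])]
    refine (one_sub_pow_le hrpos.le N).trans (mul_le_mul_of_nonneg_left ?_ N.cast_nonneg)
    -- `1 - r ≤ 1 - r² = |t'|² ≤ |t'|`.
    nlinarith [norm_nonneg t'.toComplex, (norm_le_one_of_unit h').2]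
  have e3 : N * ‖t'.toComplex‖ ≤ 4 * Real.pi * ‖t.toComplex‖ := by
    have : (N : ℝ) * |β| ≤ 2 * Real.pi :=
      (mul_le_mul_of_nonneg_left hψ1 N.cast_nonneg).trans hN
    rw [htn]
    nlinarith [norm_nonneg t.toComplex]
  have e4 : ‖(pairPow u' t' N).1.toComplex - Complex.exp (α * Complex.I)‖
      ≤ ‖(pairPow u' t' N).1.toComplex - u'.toComplex ^ N‖
        + ‖u'.toComplex ^ N - Complex.exp ((N * ψ : ℝ) * Complex.I)‖
        + ‖Complex.exp ((N * ψ : ℝ) * Complex.I) - Complex.exp (α * Complex.I)‖ := by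
    refine le_trans (le_of_eq ?_) (norm_add₃_le)
    congr 1; ring
  linarith

theorem exists_unit_mem_epsRegion (θ : ℝ) {ε : ℝ} (hε : 0 < ε) : ∃ u t : DOmega,
    u.dag * u + t.dag * t = 1 ∧ u.toComplex ∈ epsRegion θ ε := by
  obtain ⟨u, t, h, hu⟩ := exists_unit_near (-(θ / 2)) (δ := ε ^ 2 / 2) (by positivity)
  refine ⟨u, t, h, mem_unitDisk_of_unit h, ?_⟩
  have htg : Complex.exp ((-(θ / 2) : ℝ) * Complex.I) = target θ := by
    rw [target]; congr 1; push_cast; ring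
  rw [htg] at hu
  change 1 - ε ^ 2 / 2 ≤ _ * (target θ).re + _ * (target θ).im
  have h1 := Complex.abs_re_le_norm ((starRingEnd ℂ) (target θ) * (u.toComplex - target θ))
  have hz := normSq_target θ
  have hz' : ‖target θ‖ = 1 := by
    rw [Complex.normSq_eq_norm_sq] at hz
    nlinarith [norm_nonneg (target θ)]
  rw [norm_mul, RCLike.norm_conj, hz', one_mul] at h1
  have h2 := (abs_le.1 (h1.trans hu.le)).1
  rw [Complex.normSq_apply] at hz
  simp only [Complex.mul_re, Complex.conj_re, Complex.conj_im, Complex.sub_re, Complex.sub_im] at h2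
  linarith

/-! ## Existence of the enumeration -/

/-- A nonempty set whose elements of bounded level are finite in number can be enumerated by
increasing level. -/
theorem exists_monotone_enumeration {α : Type*} {S : Set α} {f : α → ℕ} (hS : S.Nonempty)
    (hfin : ∀ k, {x | x ∈ S ∧ f x ≤ k}.Finite) :
    ∃ e : ℕ → α, Set.range e = S ∧ Monotone fun i => f (e i) := by
  have hcount : S.Countable := by
    have : S = ⋃ k, {x | x ∈ S ∧ f x ≤ k} := by
      ext x
      simp only [Set.mem_iUnion, Set.mem_ofPred_eq]
      exact ⟨fun h => ⟨f x, h, le_rfl⟩, fun ⟨_, h, _⟩ => h⟩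
    rw [this]
    exact Set.countable_iUnion fun k => (hfin k).countable
  obtain ⟨c, hc⟩ := Set.countable_iff_exists_injOn.1 hcount
  have hB : ∀ k, ∃ b, ∀ x ∈ S, f x ≤ k → c x < b := fun k => by
    obtain ⟨b, hb⟩ := ((hfin k).image c).bddAbove
    exact ⟨b + 1, fun x hx hk => Nat.lt_succ_of_le (hb ⟨x, ⟨hx, hk⟩, rfl⟩)⟩
  choose B hB using hB
  -- An injective code that refines the level: the offsets `B j` exceed every `c` of level at most
  -- `j`, so the codes of a level lie above those of all lower levels.
  set g : α → ℕ := fun x => ∑ j ∈ Finset.range (f x), B j + c x with hg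
  have hlt : ∀ x ∈ S, ∀ y, f x < f y → g x < g y := fun x hx y hxy => by
    have h1 := Finset.sum_le_sum_of_subset (f := B) (Finset.range_mono (Nat.succ_le_of_lt hxy))
    rw [Finset.sum_range_succ] at h1
    have h2 := hB (f x) x hx le_rfl
    simp only [hg]
    omega
  have hinj : Set.InjOn g S := fun x hx y hy hxy => by
    rcases lt_trichotomy (f x) (f y) with h | h | h
    · exact absurd hxy (hlt x hx y h).ne
    · simp only [hg, h, add_right_inj] at hxy
      exact hc hx hy hxy
    · exact absurd hxy (hlt y hy x h).ne'
  obtain ⟨x₀, hx₀, hmin⟩ : ∃ x ∈ S, ∀ y ∈ S, f x ≤ f y := by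
    obtain ⟨x, hx, h⟩ := WellFounded.has_min (measure f).wf S hS
    exact ⟨x, hx, fun y hy => not_lt.1 (h y hy)⟩
  -- The `i`-th term is the element with the largest code at most `i`, and the lowest-level element
  -- `x₀` while there is none. Each element thus appears at the index given by its own code.
  have hmax : ∀ i, ∃ x ∈ S, (∀ y ∈ S, g y ≤ i → g x ≤ i ∧ g y ≤ g x) ∧ (i < g x → x = x₀) := by
    intro i
    by_cases hne : {x | x ∈ S ∧ g x ≤ i}.Nonempty
    · have hf : {x | x ∈ S ∧ g x ≤ i}.Finite := by
        refine Set.Finite.of_finite_image ((Set.finite_Iic i).subset ?_)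
          (hinj.mono fun x hx => hx.1)
        rintro _ ⟨x, hx, rfl⟩
        exact hx.2
      obtain ⟨x, hx, h⟩ := Set.exists_max_image _ g hf hne
      exact ⟨x, hx.1, fun y hy hyi => ⟨hx.2, h y ⟨hy, hyi⟩⟩, fun h => absurd hx.2 (not_le.2 h)⟩
    · exact ⟨x₀, hx₀, fun y hy hyi => absurd ⟨y, hy, hyi⟩ hne, fun _ => rfl⟩
  choose e heS he he₀ using hmax
  refine ⟨e, Set.Subset.antisymm (Set.range_subset_iff.2 heS) fun x hx => ⟨g x, ?_⟩, ?_⟩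
  · obtain ⟨h1, h2⟩ := he (g x) x hx le_rfl
    exact hinj (heS _) hx (le_antisymm h1 h2)
  · intro i j hij
    rcases lt_or_ge i (g (e i)) with h | h
    · change f (e i) ≤ f (e j)
      rw [he₀ i h]
      exact hmin _ (heS j)
    · by_contra hlt'
      exact absurd (hlt _ (heS j) _ (not_le.1 hlt')) (not_lt.2 (he j _ (heS i) (h.trans hij)).2)

/-! ### Finiteness of the candidates of bounded exponent. -/

theorem dag_mul_self_add_bullet (v : ZOmega) : v.dag * v + v.bullet.dag * v.bullet
    = ((2 * (v.a ^ 2 + v.b ^ 2 + v.c ^ 2 + v.d ^ 2) : ℤ) : ZOmega) := by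
  generalize hN : 2 * (v.a ^ 2 + v.b ^ 2 + v.c ^ 2 + v.d ^ 2) = N
  ext <;> simp <;> linarith

theorem normSq_toComplex_add_bullet (v : ZOmega) :
    Complex.normSq v.toD.toComplex + Complex.normSq v.bullet.toD.toComplex
      = 2 * (v.a ^ 2 + v.b ^ 2 + v.c ^ 2 + v.d ^ 2) := by
  have h := congrArg (fun x => toComplexHom (toDHom x)) (dag_mul_self_add_bullet v)
  simp only [map_add, map_intCast] at h
  rw [toDHom_apply, toDHom_apply, toD_mul, toD_mul, toD_dag, toD_dag, toComplexHom_apply,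
    toComplexHom_apply, toComplex_dag_mul_self, toComplex_dag_mul_self] at h
  exact_mod_cast h

theorem normSq_sqrtTwo_pow_mul (k : ℕ) (u : DOmega) :
    Complex.normSq (sqrtTwo ^ k * u).toComplex = 2 ^ k * Complex.normSq u.toComplex := by
  rw [toComplex_mul, toComplex_pow, toComplex_sqrtTwo, map_mul, map_pow, Complex.normSq_ofReal,
    Real.mul_self_sqrt (by norm_num)]

theorem normSq_bullet_sqrtTwo_pow_mul (k : ℕ) (u : DOmega) :
    Complex.normSq (sqrtTwo ^ k * u).bullet.toComplex
      = 2 ^ k * Complex.normSq u.bullet.toComplex := by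
  rw [bullet_mul, bullet_pow, bullet_sqrtTwo, toComplex_mul, toComplex_pow, toComplex_neg,
    toComplex_sqrtTwo, map_mul, map_pow, Complex.normSq_neg, Complex.normSq_ofReal,
    Real.mul_self_sqrt (by norm_num)]

/-- The scaled grid problem for two bounded sets has finitely many solutions of each level. -/
theorem finite_scaledGridSolutions (k : ℕ) :
    {u : DOmega | u ∈ scaledGridSolutions unitDisk unitDisk ∧
      leastDenominatorExponent u ≤ k}.Finite := by
  set I : Set ℤ := Set.Icc (-2 ^ k) (2 ^ k)
  have hI : I.Finite := Set.finite_Icc _ _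
  refine ((hI.prod (hI.prod (hI.prod hI))).image fun x : ℤ × ℤ × ℤ × ℤ =>
    invSqrtTwo ^ k * (⟨x.1, x.2.1, x.2.2.1, x.2.2.2⟩ : ZOmega).toD).subset ?_
  rintro u ⟨⟨hu, hub⟩, hk⟩
  obtain ⟨v, hv⟩ := isDenominatorExponent_iff.2 hk
  have hsum := normSq_toComplex_add_bullet v
  rw [toD_bullet, ← hv, normSq_sqrtTwo_pow_mul, normSq_bullet_sqrtTwo_pow_mul] at hsum
  rw [mem_unitDisk_iff] at hu hub
  have hle : v.a ^ 2 + v.b ^ 2 + v.c ^ 2 + v.d ^ 2 ≤ 2 ^ k := by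
    have : ((v.a : ℝ) ^ 2 + v.b ^ 2 + v.c ^ 2 + v.d ^ 2) ≤ 2 ^ k := by
      have h2 : (0 : ℝ) < 2 ^ k := by positivity
      nlinarith
    exact_mod_cast this
  have hmem : ∀ m : ℤ, m ^ 2 ≤ 2 ^ k → m ∈ I := fun m hm => by
    have h1 : |m| ≤ 2 ^ k := by
      rw [← sq_abs] at hm
      nlinarith [abs_nonneg m, Int.le_self_sq |m|]
    exact abs_le.1 h1
  refine ⟨(v.a, v.b, v.c, v.d), ⟨hmem _ ?_, hmem _ ?_, hmem _ ?_, hmem _ ?_⟩, ?_⟩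
  any_goals nlinarith [sq_nonneg v.a, sq_nonneg v.b, sq_nonneg v.c, sq_nonneg v.d]
  change invSqrtTwo ^ k * v.toD = u
  rw [← hv, ← mul_assoc, ← mul_pow, mul_comm invSqrtTwo, sqrtTwo_mul_invSqrtTwo, one_pow, one_mul]

theorem mem_scaledGridSolutions_of_unit {θ ε : ℝ} {u t : DOmega}
    (h : u.dag * u + t.dag * t = 1) (hu : u.toComplex ∈ epsRegion θ ε) :
    u ∈ scaledGridSolutions (epsRegion θ ε) unitDisk :=
  ⟨hu, mem_unitDisk_of_unit (bullet_unit h)⟩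

theorem exists_enumeratesGrid (θ : ℝ) {ε : ℝ} (hε : 0 < ε) :
    ∃ e : ℕ → DOmega, EnumeratesGrid (epsRegion θ ε) unitDisk e := by
  obtain ⟨u, t, h, hu⟩ := exists_unit_mem_epsRegion θ hε
  obtain ⟨e, h1, h2⟩ := exists_monotone_enumeration
    (S := scaledGridSolutions (epsRegion θ ε) unitDisk) (f := leastDenominatorExponent)
    ⟨u, mem_scaledGridSolutions_of_unit h hu⟩ fun k =>
      (finite_scaledGridSolutions k).subset fun x hx => ⟨⟨hx.1.1.1, hx.1.2⟩, hx.2⟩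
  exact ⟨e, h1, h2⟩

/-! ## Runs of the algorithm -/

theorem xi_dag (u : DOmega) : (xi u).dag = xi u := by
  rw [xi, dag_sub, dag_mul, dag_dag, dag_one, mul_comm]

theorem dag_mul_self_eq_xi_iff {u t : DOmega} :
    t.dag * t = xi u ↔ u.dag * u + t.dag * t = 1 := by
  rw [xi, eq_sub_iff_add_eq, add_comm]

/-- The candidate `u` is the upper left entry of an exactly implementable operator. -/
def IsSolvable (u : DOmega) : Prop := ∃ t : DOmega, u.dag * u + t.dag * t = 1

variable {e : ℕ → DOmega} {factor : FactoringProcedure}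

/-- With a factoring oracle, a candidate is abandoned only if it is not solvable. -/
theorem Step.of_candidate (hfactor : IsFactoringOracle factor) {i : ℕ} {s : State}
    (h : Step e factor (.candidate i) s) :
    s = .candidate (i + 1) ∧ ¬ IsSolvable (e i) ∨
      ∃ t, s = .synthesize (e i) t ∧ (e i).dag * e i + t.dag * t = 1 := by
  cases h with
  | skip _ n ℓ hn hn0 hF =>
    obtain ⟨F, hF', -⟩ := hfactor n hn0
    rw [hF] at hF'
    cases hF'
  | reject _ n ℓ hn F hF h =>
    refine .inl ⟨rfl, fun ⟨t, ht⟩ => h.sound_none (fun hn0 p hp => ?_) t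
      (dag_mul_self_eq_xi_iff.2 ht)⟩
    obtain ⟨F', hF', hprime, -⟩ := hfactor n hn0
    rw [hF hn0, Option.some_inj] at hF'
    subst hF'
    exact hprime p hp
  | accept _ n ℓ hn F hF t h =>
    exact .inr ⟨t, rfl, dag_mul_self_eq_xi_iff.1 (h.sound_some (xi_dag _) hn)⟩

theorem exists_step_candidate (hfactor : IsFactoringOracle factor) (i : ℕ) :
    ∃ s, Step e factor (.candidate i) s := by
  obtain ⟨n, ℓ, hn⟩ := exists_normIs (xi_dag (e i))
  obtain ⟨F, hF, hF'⟩ : ∃ F : List ℕ, (n ≠ 0 → factor n = some F) ∧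
      (n ≠ 0 → (∀ p ∈ F, p.Prime) ∧ F.prod = n.natAbs) := by
    by_cases hn0 : n = 0
    · exact ⟨[], fun h => absurd hn0 h, fun h => absurd hn0 h⟩
    · obtain ⟨F, h1, h2⟩ := hfactor n hn0
      exact ⟨F, fun _ => h1, fun _ => h2⟩
  obtain ⟨_ | t, h⟩ := exists_diophantineReturns (xi_dag (e i)) hn hF'
  · exact ⟨_, .reject i n ℓ hn F hF h⟩
  · exact ⟨_, .accept i n ℓ hn F hF t h⟩

theorem exists_step_synthesize {u t : DOmega} (h : u.dag * u + t.dag * t = 1) :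
    ∃ s, Step e factor (.synthesize u t) s := by
  obtain ⟨⟨C, hC⟩, C', hC'⟩ := exists_exactSynthesis_matrixU h
  rcases le_total C.tCount C'.tCount with hle | hle
  · exact ⟨_, .outputU u t C C' hC hC' hle⟩
  · exact ⟨_, .outputU' u t C C' hC hC' hle⟩

/-- What is known in each state of the algorithm. -/
def Invariant (e : ℕ → DOmega) : State → Prop
  | .candidate i => ∀ j < i, ¬ IsSolvable (e j)
  | .synthesize u t => ∃ i, u = e i ∧ u.dag * u + t.dag * t = 1 ∧ ∀ j < i, ¬ IsSolvable (e j)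
  | .output C => ∃ i t C₁ C₂, (e i).dag * e i + t.dag * t = 1 ∧ (∀ j < i, ¬ IsSolvable (e j)) ∧
      ExactSynthesis (matrixU (e i) t) C₁ ∧ ExactSynthesis (matrixU' (e i) t) C₂ ∧
      (C = C₁ ∨ C = C₂) ∧ C.tCount = min C₁.tCount C₂.tCount

theorem Reachable.invariant (hfactor : IsFactoringOracle factor) {s : State}
    (h : Reachable e factor s) : Invariant e s := by
  induction h with
  | refl => exact fun j hj => absurd hj (Nat.not_lt_zero j)
  | @tail s s' _ hstep ih =>
    cases s with
    | candidate i =>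
      rcases hstep.of_candidate hfactor with ⟨rfl, h⟩ | ⟨t, rfl, h⟩
      · intro j hj
        rcases Nat.lt_succ_iff_lt_or_eq.1 hj with hj | rfl
        · exact ih j hj
        · exact h
      · exact ⟨i, rfl, h, ih⟩
    | synthesize u t =>
      obtain ⟨i, rfl, h, hi⟩ := ih
      cases hstep with
      | outputU _ _ C C' hC hC' hle =>
        exact ⟨i, t, C, C', h, hi, hC, hC', .inl rfl, (min_eq_left hle).symm⟩
      | outputU' _ _ C C' hC hC' hle =>
        exact ⟨i, t, C, _, h, hi, hC, hC', .inr rfl, (min_eq_right hle).symm⟩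
    | output C => cases hstep

/-- A synthesis state is followed by an output, which has no successor, so an infinite run would
visit every candidate and reject each one, including the solvable one. -/
theorem alwaysReturns (hfactor : IsFactoringOracle factor) (hsolv : ∃ j, IsSolvable (e j)) :
    AlwaysReturns e factor := by
  constructor
  · rintro ⟨s, hs0, hs⟩
    have hcand : ∀ i, s i = .candidate i := by
      intro i
      induction i with
      | zero => exact hs0
      | succ i ih =>
        have h1 := hs i
        rw [ih] at h1
        rcases h1.of_candidate hfactor with ⟨h, -⟩ | ⟨t, h, -⟩
        · exact h
        · have h2 := hs (i + 1)
          have h3 := hs (i + 1 + 1)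
          rw [h] at h2
          generalize s (i + 1 + 1) = s₁ at h2 h3
          cases h2 <;> cases h3
    obtain ⟨j, hj⟩ := hsolv
    have h1 := hs j
    rw [hcand, hcand] at h1
    rcases h1.of_candidate hfactor with ⟨-, h⟩ | ⟨t, h, -⟩
    · exact h hj
    · cases h
  · intro s hs
    cases s with
    | candidate i => exact .inr (exists_step_candidate hfactor i)
    | synthesize u t =>
      obtain ⟨i, rfl, h, -⟩ := hs.invariant hfactor
      exact .inr (exists_step_synthesize h)
    | output C => exact .inl ⟨C, rfl⟩

/-- Every approximation yields a solvable candidate whose exponent bounds its `T`-count from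
below. -/
theorem exists_solvable_of_approximates {θ ε : ℝ} (hε : 0 < ε) {D : Circuit}
    (hD : Approximates θ ε D) : ∃ u, u ∈ scaledGridSolutions (epsRegion θ ε) unitDisk ∧
      IsSolvable u ∧ 2 * leastDenominatorExponent u ≤ D.tCount + 2 := by
  by_cases hdet : (evalD D).det = 1
  · have hV := isSpecial_evalD D
    obtain ⟨h01, h11⟩ := hV.second_column
    rw [hdet, mul_one] at h01 h11
    have hunit := hV.first_column
    have hsp : evalD D = specialMatrix (evalD D 0 0) (evalD D 1 0) := by
      ext1 i j
      fin_cases i <;> fin_cases j <;> simp [specialMatrix, h01, h11]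
    refine ⟨evalD D 0 0, mem_scaledGridSolutions_of_unit hunit ?_, ⟨_, hunit⟩,
      two_mul_leastDenominatorExponent_le hsp (hsp ▸ hdet)⟩
    rw [← opNorm_sub_matrixU hε hunit, ← eval_eq_matrixU hsp]
    exact hD
  -- For other determinants `ε` is so large that a power of `ω` with `t = 0` is a candidate; its
  -- exponent 0 makes the bound trivial.
  · obtain ⟨j, hj⟩ := exists_omega_pow_mem_epsRegion (one_sub_le_cos_of_det_ne_one hD hdet)
    have hunit : ((omega : DOmega) ^ j).dag * omega ^ j + (0 : DOmega).dag * 0 = 1 := by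
      rw [dag_pow, ← mul_pow, dag_omega_mul_omega, one_pow, mul_zero, add_zero]
    refine ⟨omega ^ j, mem_scaledGridSolutions_of_unit hunit hj, ⟨0, hunit⟩, ?_⟩
    have : leastDenominatorExponent ((omega : DOmega) ^ j) ≤ 0 :=
      isDenominatorExponent_iff.1 ⟨omega ^ j, by rw [pow_zero, one_mul, toD_pow, toD_omega]⟩
    omega

theorem Returns.approximates {θ ε : ℝ} (hε : 0 < ε) (hfactor : IsFactoringOracle factor)
    (he : EnumeratesGrid (epsRegion θ ε) unitDisk e) {C : Circuit} (h : Returns e factor C) :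
    Approximates θ ε C := by
  obtain ⟨i, t, C₁, C₂, hunit, -, h₁, h₂, hC, -⟩ := Reachable.invariant hfactor h
  have hi : (e i).toComplex ∈ epsRegion θ ε := (he.range_eq ▸ Set.mem_range_self i :
    e i ∈ scaledGridSolutions (epsRegion θ ε) unitDisk).1
  have hunit' : (e i).dag * e i + (omega * t).dag * (omega * t) = 1 := by
    rw [dag_mul]
    linear_combination hunit + t.dag * t * dag_omega_mul_omega (R := dyadic)
  rcases hC with rfl | rfl
  · rw [Approximates, h₁.1]
    exact (opNorm_sub_matrixU hε hunit).2 hi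
  · rw [Approximates, h₂.1, matrixU'_eq]
    exact (opNorm_sub_matrixU hε hunit').2 hi

theorem Returns.tCount_le {θ ε : ℝ} (hε : 0 < ε) (hfactor : IsFactoringOracle factor)
    (he : EnumeratesGrid (epsRegion θ ε) unitDisk e) {C D : Circuit} (h : Returns e factor C)
    (hD : Approximates θ ε D) : C.tCount ≤ D.tCount := by
  obtain ⟨i, t, C₁, C₂, hunit, hi, h₁, h₂, -, hC⟩ := Reachable.invariant hfactor h
  obtain ⟨u, hu, hsolv, hle⟩ := exists_solvable_of_approximates hε hD
  rw [← he.range_eq] at hu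
  obtain ⟨j, rfl⟩ := hu
  have hij : i ≤ j := not_lt.1 fun hlt => hi j hlt hsolv
  have hmono : leastDenominatorExponent (e i) ≤ leastDenominatorExponent (e j) :=
    he.increasing hij
  -- The subtraction is truncated: for exponent 0 it still gives `K = 0`, and the output then has no
  -- gate `T`.
  have hmin := min_tCount_le hunit h₁ h₂ (K := leastDenominatorExponent (e i) - 1)
    (isDenominatorExponent_iff.2 (by omega))
  omega

end

end CliffordT

theorem proposition8p2 (θ ε : ℝ) (hε : 0 < ε)
    (factor : CliffordT.FactoringProcedure) (hfactor : CliffordT.IsFactoringOracle factor) :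
    (∃ e : ℕ → CliffordT.DOmega,
      CliffordT.EnumeratesGrid (CliffordT.epsRegion θ ε) CliffordT.unitDisk e) ∧
    ∀ e : ℕ → CliffordT.DOmega,
      CliffordT.EnumeratesGrid (CliffordT.epsRegion θ ε) CliffordT.unitDisk e →
      CliffordT.AlwaysReturns e factor ∧
      ∀ C : CliffordT.Circuit, CliffordT.Returns e factor C →
        CliffordT.Approximates θ ε C ∧
        ∀ D : CliffordT.Circuit, CliffordT.Approximates θ ε D → C.tCount ≤ D.tCount := by
  refine ⟨CliffordT.exists_enumeratesGrid θ hε, fun e he => ⟨?_, fun C hC => ⟨?_, fun D hD => ?_⟩⟩⟩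
  · obtain ⟨u, t, h, hu⟩ := CliffordT.exists_unit_mem_epsRegion θ hε
    have hmem := CliffordT.mem_scaledGridSolutions_of_unit h hu
    rw [← he.range_eq] at hmem
    obtain ⟨j, rfl⟩ := hmem
    exact CliffordT.alwaysReturns hfactor ⟨j, t, h⟩
  · exact hC.approximates hε hfactor he
  · exact hC.tCount_le hε hfactor he hD
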